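/- **Theorem (Hamiltonian simulation by a truncated Dyson series).** There are absolute constants $c_0,C>0$ such that the following holds for all integers $n_s,n_a\ge 0$, $M\ge 1$ and all real $\alpha>0$, $t\in[0,\frac1{2\alpha}]$, $\epsilon>0$. *Input.* Let $H:[0,t]\to\mathbb C^{2^{n_s}\times 2^{n_s}}$ be differentiable and Hermitian-valued, with integrable derivative and $\max_s\|H(s)\|\le\alpha$ (spectral norm), and put $\langle\|\dot H\|\rangle=\frac1t\int_0^t\|\dot H(s)\|\,\mathrm ds$. Suppose that $$M\ \ge\ c_0\,\frac{t^2}{\epsilon}\Big(\langle\|\dot H\|\rangle+\max_s\|H(s)\|^2\Big),$$ and let $\operatorname{HAM-T}$ be a unitary on $\mathbb C^M\otimes(\mathbb C^2)^{\otimes n_a}\otimes(\mathbb C^2)^{\otimes n_s}$ with $$(\langle 0|_a\otimes 1)\,\operatorname{HAM-T}\,(|0\rangle_a\otimes 1)=\sum_{m=0}^{M-1}|m\rangle\langle m|\otimes\frac{H(mt/M)}{\alpha}.$$ On qubits it acts on $\lceil\log_2 M\rceil+n_a+n_s$ of them, as the identity where the time index is not smaller than $M$. *Circuits.* A circuit acts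 on the $n_s$ system qubits and $q$ further qubits. It is a sequence of primitive gates (arbitrary two-qubit unitaries) and queries, a query being one use of $\operatorname{HAM-T}$, of its inverse, or of a singly controlled version of either, on qubits of choice. A circuit that performs the unitary $V$ implements the operation $W=(\langle 0|\otimes 1)V(|0\rangle\otimes 1)$ on the system; its failure probability on a unit vector $\psi$ is the probability that measuring the $q$ further qubits of $V(|0\rangle\otimes\psi)$ does not return $0\cdots0$. *Conclusion.* There is a circuit, depending only on $n_s,n_a,M,\alpha,t,\epsilon$ (and not on $H$ or on $\operatorname{HAM-T}$), such that for every $H$ and $\operatorname{HAM-T}$ as above the operation $W$ satisfies $$\Big\|W-\mathcal T\big[e^{-i\int_0^tH(s)\,\mathrm ds}\big]\Big\|\le\epsilon$$ with failure probability at most $C\epsilon$ on every unit vector. Here $$\mathcal T\big[e^{-i\int_0^tH(s)\,\mathrm ds}\big]=\sum_{k\ge0}(-i)^k\int_{0\le t_1\le\cdots\le t_k\le t}H(t_k)\cdots H(t_1)\,\mathrm dt_1\cdots\mathrm dt_k .$$ With $L(\epsilon)=\frac{\log(1/\epsilon')}{\log\log(1/\epsilon')}$ and $\epsilon'=\min(\epsilon,\frac1{16})$,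 the circuit uses 1. at most $C\,L(\epsilon)$ queries, 2. $n_s+q$ qubits, where $q\le C(n_a+\log M+1)$, 3. at most $C\,(n_a+\log M+1)\,L(\epsilon)$ primitive gates. In particular, if $M$ is chosen of the order of $X=\frac{t^2}{\epsilon}(\langle\|\dot H\|\rangle+\max_s\|H(s)\|^2)$, where $X$ is bounded away from $0$, then $\log M=\log X+O(1)$. -/

import Mathlib

open scoped Matrix.Norms.L2Operator

noncomputable section

namespace DysonSim

/-! ## Qubits and operators -/

/-- Computational basis states of a family of qubits labelled by `W`. -/
abbrev Bits (W : Type) : Type := W → Bool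

/-- Operators on the qubits labelled by `W`: square matrices of size `2 ^ |W|`.  They carry the
spectral norm. -/
abbrev QOp (W : Type) : Type := Matrix (Bits W) (Bits W) ℂ

/-- The integer `∑ i, x i * 2 ^ i` stored in a register of `n` qubits. -/
def bitsVal {n : ℕ} (x : Bits (Fin n)) : ℕ := ∑ i, if x i then 2 ^ (i : ℕ) else 0

open Classical in
/-- The operator `A` applied to the wires `e r`, `r : R`, tensored with the identity on all other
wires. -/
def onWires {R W : Type} (e : R ↪ W) (A : QOp R) : QOp W := fun x y =>
  if ∀ w, w ∉ Set.range e → x w = y w then A (x ∘ e) (y ∘ e) else 0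

open Classical in
/-- The controlled operator `|0⟩⟨0| ⊗ 1 + |1⟩⟨1| ⊗ A`, the control being the wire `none`. -/
def controlled {R : Type} (A : QOp R) : QOp (Option R) := fun x y =>
  if x none = y none then
    if x none = true then A (x ∘ some) (y ∘ some)
    else if x ∘ some = y ∘ some then 1 else 0
  else 0

/-! ## The time-dependent Hamiltonian and its propagator -/

/-- The `k`-th term of the Dyson series without the factor `(-i)^k`, i.e. the time-ordered integral
`∫ H(t_k) ⋯ H(t_1)` over `0 ≤ t_1 ≤ ⋯ ≤ t_k ≤ t`. -/
def dysonTerm {ns : ℕ} (H : ℝ → QOp (Fin ns)) : ℕ → ℝ → QOp (Fin ns)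
  | 0, _ => 1
  | k + 1, t => ∫ s in (0 : ℝ)..t, H s * dysonTerm H k s

/-- The time-ordered exponential `𝒯 exp (-i ∫₀ᵗ H(s) ds)`, defined by its Dyson series. -/
def timeOrderedExp {ns : ℕ} (H : ℝ → QOp (Fin ns)) (t : ℝ) : QOp (Fin ns) :=
  ∑' k : ℕ, (-Complex.I) ^ k • dysonTerm H k t

/-- The average rate of change `(1/t) ∫₀ᵗ ‖dH/ds‖ ds`. -/
def avgDerivNorm {ns : ℕ} (H : ℝ → QOp (Fin ns)) (t : ℝ) : ℝ :=
  (1 / t) * ∫ s in (0 : ℝ)..t, ‖derivWithin H (Set.Icc 0 t) s‖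

/-- `max ‖H(s)‖` over `s ∈ [0, t]`. -/
def maxNorm {ns : ℕ} (H : ℝ → QOp (Fin ns)) (t : ℝ) : ℝ :=
  ⨆ s : Set.Icc (0 : ℝ) t, ‖H s‖

/-- A differentiable Hamiltonian on `[0, t]`, with norm bounded by `α` and integrable derivative. -/
structure IsHamiltonian {ns : ℕ} (H : ℝ → QOp (Fin ns)) (t α : ℝ) : Prop where
  hermitian : ∀ s ∈ Set.Icc 0 t, (H s).IsHermitian
  norm_le : ∀ s ∈ Set.Icc 0 t, ‖H s‖ ≤ α
  differentiable : DifferentiableOn ℝ H (Set.Icc 0 t)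
  integrable : IntervalIntegrable (derivWithin H (Set.Icc 0 t)) MeasureTheory.volume 0 t

/-! ## The oracle -/

/-- Operators on `ℂ^M ⊗ (ℂ²)^{⊗ na} ⊗ (ℂ²)^{⊗ ns}` (time index, ancilla, system). -/
abbrev OracleOp (M na ns : ℕ) : Type :=
  Matrix (Fin M × Bits (Fin na) × Bits (Fin ns)) (Fin M × Bits (Fin na) × Bits (Fin ns)) ℂ

/-- `O` is a unitary with
`(⟨0|ₐ ⊗ 1) O (|0⟩ₐ ⊗ 1) = ∑ m < M, |m⟩⟨m| ⊗ H (m t / M) / α`. -/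
structure IsHamT {M na ns : ℕ} (O : OracleOp M na ns) (H : ℝ → QOp (Fin ns)) (t α : ℝ) :
    Prop where
  unitary : O ∈ Matrix.unitaryGroup (Fin M × Bits (Fin na) × Bits (Fin ns)) ℂ
  block : ∀ (m m' : Fin M) (y y' : Bits (Fin ns)),
    O (m, fun _ => false, y) (m', fun _ => false, y') =
      if m = m' then H ((m : ℕ) * t / M) y y' / (α : ℂ) else 0

/-- The qubits on which the oracle acts: `⌈log₂ M⌉` for the time index, `na` ancillas, `ns` system
qubits. -/
abbrev OracleReg (M na ns : ℕ) : Type := Fin (Nat.clog 2 M) ⊕ Fin na ⊕ Fin ns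

open Classical in
/-- The oracle as an operator on qubits; it is the identity on the basis states whose time index is
not smaller than `M`. -/
def OracleOp.toQubits {M na ns : ℕ} (O : OracleOp M na ns) : QOp (OracleReg M na ns) :=
  fun x y =>
    if hx : bitsVal (fun i => x (Sum.inl i)) < M then
      if hy : bitsVal (fun i => y (Sum.inl i)) < M then
        O (⟨_, hx⟩, fun i => x (Sum.inr (Sum.inl i)), fun i => x (Sum.inr (Sum.inr i)))
          (⟨_, hy⟩, fun i => y (Sum.inr (Sum.inl i)), fun i => y (Sum.inr (Sum.inr i)))
      else 0
    else if x = y then 1 else 0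

/-! ## Circuits with oracle queries -/

/-- One step of a circuit on the wires `W`: a primitive gate, which is an arbitrary unitary on two
wires, or a query to the oracle or to the controlled oracle on chosen wires, or to the inverse of
one of these (`inv = true`).  The oracle itself is left open. -/
inductive Op (M na ns : ℕ) (W : Type) : Type
  | gate (e : Fin 2 ↪ W) (A : Matrix.unitaryGroup (Bits (Fin 2)) ℂ) : Op M na ns W
  | query (e : OracleReg M na ns ↪ W) (inv : Bool) : Op M na ns W
  | ctrlQuery (e : Option (OracleReg M na ns) ↪ W) (inv : Bool) : Op M na ns W

/-- Whether a step is an oracle query (and not a primitive gate). -/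
def Op.isQuery {M na ns : ℕ} {W : Type} : Op M na ns W → Bool
  | .gate _ _ => false
  | .query _ _ => true
  | .ctrlQuery _ _ => true

open Matrix in
/-- The operator performed by a step when the oracle is `O`. -/
def Op.eval {M na ns : ℕ} {W : Type} (O : OracleOp M na ns) : Op M na ns W → QOp W
  | .gate e A => onWires e (A : QOp (Fin 2))
  | .query e inv => onWires e (if inv then O.toQubitsᴴ else O.toQubits)
  | .ctrlQuery e inv => onWires e (controlled (if inv then O.toQubitsᴴ else O.toQubits))

/-- A circuit on `ns` system qubits and `q` further qubits: the list of its steps, in the order in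
which they are applied. -/
abbrev Circuit (M na ns q : ℕ) : Type := List (Op M na ns (Fin ns ⊕ Fin q))

namespace Circuit

variable {M na ns q : ℕ}

/-- The operator performed by the circuit when the oracle is `O`. -/
def eval (O : OracleOp M na ns) : Circuit M na ns q → QOp (Fin ns ⊕ Fin q)
  | [] => 1
  | op :: c => eval O c * op.eval O

/-- The number of oracle queries. -/
def queryCount (c : Circuit M na ns q) : ℕ := c.countP fun op => op.isQuery

/-- The number of primitive gates. -/
def gateCount (c : Circuit M na ns q) : ℕ := c.countP fun op => !op.isQuery

/-- The operation `(⟨0| ⊗ 1) V (|0⟩ ⊗ 1)` on the system that the circuit implements when the `q`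
further qubits start in `|0⟩` and are finally found in `|0⟩`. -/
def implemented (O : OracleOp M na ns) (c : Circuit M na ns q) : QOp (Fin ns) := fun y y' =>
  c.eval O (Sum.elim y fun _ => false) (Sum.elim y' fun _ => false)

/-- The failure probability on the system state `ψ`: the probability that a measurement of the `q`
further qubits, after the circuit has been run on `|0⟩ ⊗ ψ`, does not return `0 ⋯ 0`. -/
def failureProb (O : OracleOp M na ns) (c : Circuit M na ns q) (ψ : Bits (Fin ns) → ℂ) : ℝ :=
  ∑ z : Bits (Fin q), if z = fun _ => false then 0 else
    ∑ y : Bits (Fin ns),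
      ‖∑ y' : Bits (Fin ns), c.eval O (Sum.elim y z) (Sum.elim y' fun _ => false) * ψ y'‖ ^ 2

end Circuit

/-- `log (1/ε) / log log (1/ε)`.  This expression is meaningful only for small `ε`, so that for
`ε ≥ 1/16` its value at `1/16` is taken. -/
def logOverLogLog (ε : ℝ) : ℝ :=
  Real.log (1 / min ε (1 / 16)) / Real.log (Real.log (1 / min ε (1 / 16)))

end DysonSim

end

open scoped Matrix.Norms.L2Operator

noncomputable section

namespace DysonSim

open Matrix

/-! ## Operators on some of the wires -/

section SetWires

variable {R R' W : Type}

/-! Discretization. With G_m = -i(t/M)H(mt/M), the Dyson series is replaced by the sum over k of S_k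
= Σ G_{m_k}⋯G_{m_1} over m_1 < ⋯ < m_k < M. All orders together form the Euler product Π(1 + G_m).
Each Euler step errs by the variation of H on its own subinterval plus max‖H‖² times the step, times
the step, so the total error involves only the average of ‖dH/ds‖
(`norm_eulerProduct_sub_propagator_le`). Cutting the series at order k costs a multiple of (t
max‖H‖)^k/k! (`norm_truncatedSeries_sub_le`).

Encoding. Put p = tα ≤ 1/2. A unary clock reads 1⋯10⋯0 with k ones with probability (1-p)p^k, except
for the full word, which has probability p^k. The successive ones switch on queries at times drawn
from uniform superpositions over m < M. The weight p^k turns the factors 1/(αM) of the queries into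
t/M, so the overlap of the final with the initial auxiliary state is (1-p) times the truncated
series, its last term weighted by 1/(1-p). A rotation of one qubit brings this to -A/2
(`walkOp_block`), and one round of oblivious amplitude amplification returns (3A - AA*A)/2
(`amplification_block`). If A is δ-close to a unitary, δ ≤ 1, the result is 3δ-close to it
(`norm_amplified_sub_le`).

Saving qubits. One time register per query would cost (order)·log M qubits, so two registers are
used alternately. After the times of two consecutive queries have been compared, the older register
is unprepared, tested for being 0 and prepared again. On the branch where the test succeeds, this
averages over the older time, restricted to the correct order (`Tracks.test`). Failure is recorded
coherently in a flag, so the circuit stays unitary and the flags take part in the final overlap.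
Only this branch has to be followed, and `Tracks` describes it.

Order of truncation. The clock and the flags take a qubit per order, so the order must be O(log M)
as well as O(L(ε)). If εM² ≥ 1, then ⌈8L(ε)⌉ has both properties. Otherwise the hypothesis on M
already forces (t max‖H‖)^4 ≤ ε/1024, and order 4 suffices (`truncation_error_le`,
`truncationOrder_le_log`).

The time-ordered exponential solves the Schrödinger equation and is unitary. The bound on the
failure probability therefore follows from the operator error. -/

/-- The basis state that is `r` on the wires `e` and `x` on all others. -/
def setWires (e : R ↪ W) (r : Bits R) (x : Bits W) : Bits W := Function.extend e r x

theorem setWires_apply (e : R ↪ W) (r : Bits R) (x : Bits W) (i : R) :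
    setWires e r x (e i) = r i :=
  e.injective.extend_apply _ _ _

theorem setWires_of_notMem (e : R ↪ W) (r : Bits R) (x : Bits W) {w : W}
    (h : w ∉ Set.range e) : setWires e r x w = x w :=
  Function.extend_apply' _ _ _ h

theorem setWires_comp (e : R ↪ W) (r : Bits R) (x : Bits W) : setWires e r x ∘ e = r :=
  funext fun _ => setWires_apply ..

theorem setWires_comp_self (e : R ↪ W) (x : Bits W) : setWires e (x ∘ e) x = x := by
  funext w
  by_cases h : w ∈ Set.range e
  · obtain ⟨r, rfl⟩ := h
    rw [setWires_apply]; rfl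
  · rw [setWires_of_notMem _ _ _ h]

theorem setWires_setWires (e : R ↪ W) (r r' : Bits R) (x : Bits W) :
    setWires e r' (setWires e r x) = setWires e r' x := by
  funext w
  by_cases h : w ∈ Set.range e
  · obtain ⟨r, rfl⟩ := h
    simp only [setWires_apply]
  · simp only [setWires_of_notMem _ _ _ h]

theorem setWires_of_ne (e : R ↪ W) (r : Bits R) (x : Bits W) {w : W} (h : ∀ i, e i ≠ w) :
    setWires e r x w = x w :=
  setWires_of_notMem _ _ _ (by rintro ⟨i, hi⟩; exact h i hi)

end SetWires

section OnWires

set_option linter.unusedSectionVars false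

variable {R W X : Type} [Fintype R] [DecidableEq R] [Fintype W] [DecidableEq W]
  [Fintype X] [DecidableEq X]

/-- Gates are analysed through this action on state vectors: a summand survives only if its basis
state agrees with `x` off the chosen wires. -/
theorem onWires_mulVec (e : R ↪ W) (A : QOp R) (Ψ : Bits W → ℂ) (x : Bits W) :
    (onWires e A *ᵥ Ψ) x = ∑ r, A (x ∘ e) r * Ψ (setWires e r x) := by
  symm
  refine Finset.sum_of_injOn (fun r => setWires e r x) ?_ ?_ ?_ ?_
  · intro r _ r' _ h
    have := congrArg (fun z : Bits W => z ∘ e) h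
    simpa [setWires_comp] using this
  · simp
  · intro y _ hy
    have : onWires e A x y = 0 := by
      rw [onWires, if_neg]
      intro h
      apply hy
      refine ⟨y ∘ e, by simp, ?_⟩
      funext w
      by_cases hw : ∃ r, e r = w
      · obtain ⟨r, rfl⟩ := hw
        simp [setWires_apply]
      · simp only [setWires_of_notMem _ _ _ hw]
        exact h w hw
    simp [this]
  · intro r _
    have : onWires e A x (setWires e r x) = A (x ∘ e) r := by
      rw [onWires, if_pos, setWires_comp]
      intro w hw
      rw [setWires_of_notMem _ _ _ hw]
    simp only [this]

theorem ext_mulVec {m n : Type*} [Fintype n] [DecidableEq n] {A B : Matrix m n ℂ}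
    (h : ∀ v, A *ᵥ v = B *ᵥ v) : A = B :=
  Matrix.mulVec_injective (funext h)

theorem onWires_mul (e : R ↪ W) (A B : QOp R) : onWires e (A * B) = onWires e A * onWires e B := by
  refine ext_mulVec fun v => ?_
  funext x
  rw [← mulVec_mulVec]
  simp only [onWires_mulVec, setWires_setWires, setWires_comp, Finset.mul_sum,
    Matrix.mul_apply, Finset.sum_mul]
  rw [Finset.sum_comm]
  simp only [mul_assoc]

theorem onWires_one (e : R ↪ W) : onWires e (1 : QOp R) = 1 := by
  refine ext_mulVec fun v => ?_
  funext x
  simp [onWires_mulVec, Matrix.one_apply, setWires_comp_self]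

theorem onWires_conjTranspose (e : R ↪ W) (A : QOp R) : onWires e Aᴴ = (onWires e A)ᴴ := by
  ext x y
  simp only [onWires, conjTranspose_apply, eq_comm (a := x _)]
  split_ifs <;> simp

theorem onWires_onWires (e : R ↪ W) (f : W ↪ X) (A : QOp R) :
    onWires f (onWires e A) = onWires (e.trans f) A := by
  ext x y
  have : (∀ w, w ∉ Set.range (e.trans f) → x w = y w) ↔
      (∀ w, w ∉ Set.range f → x w = y w) ∧
        ∀ w, w ∉ Set.range e → (x ∘ f) w = (y ∘ f) w := by
    constructor
    · intro h
      refine ⟨fun w hw => h w ?_, fun w hw => h _ ?_⟩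
      · rintro ⟨r, rfl⟩
        exact hw ⟨_, rfl⟩
      · rintro ⟨r, hr⟩
        exact hw ⟨r, f.injective hr⟩
    · rintro ⟨h1, h2⟩ w hw
      by_cases h : w ∈ Set.range f
      · obtain ⟨w, rfl⟩ := h
        refine h2 w ?_
        rintro ⟨r, rfl⟩
        exact hw ⟨r, rfl⟩
      · exact h1 w h
  simp only [onWires, this]
  by_cases h1 : ∀ w, w ∉ Set.range f → x w = y w
  · by_cases h2 : ∀ w, w ∉ Set.range e → (x ∘ f) w = (y ∘ f) w
    · rw [if_pos h1, if_pos h2, if_pos ⟨h1, h2⟩]; rfl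
    · rw [if_pos h1, if_neg h2, if_neg fun h => h2 h.2]
  · rw [if_neg h1, if_neg fun h => h1 h.1]

theorem onWires_mem_unitary (e : R ↪ W) {A : QOp R} (hA : A ∈ unitaryGroup (Bits R) ℂ) :
    onWires e A ∈ unitaryGroup (Bits W) ℂ := by
  rw [mem_unitaryGroup_iff] at hA ⊢
  rw [star_eq_conjTranspose, ← onWires_conjTranspose, ← onWires_mul, ← star_eq_conjTranspose, hA,
    onWires_one]

theorem onWires_equiv (e : W ≃ X) (A : QOp W) (x y : Bits X) :
    onWires e.toEmbedding A x y = A (x ∘ e) (y ∘ e) := by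
  rw [onWires, if_pos]
  · rfl
  · intro w hw
    exact absurd ⟨e.symm w, by simp⟩ hw

end OnWires

/-! ## Unitarity of the oracle on qubits -/

/-- Splitting the basis by the control bit makes the matrix block diagonal with blocks 1 and A. -/
theorem controlled_mem_unitary {R : Type} [Fintype R] [DecidableEq R] {A : QOp R}
    (hA : A ∈ unitaryGroup (Bits R) ℂ) : controlled A ∈ unitaryGroup (Bits (Option R)) ℂ := by
  let E : Bits (Option R) ≃ Bits R ⊕ Bits R :=
    (Equiv.piOptionEquivProd (β := fun _ => Bool)).trans (Equiv.boolProdEquivSum _)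
  have h : controlled A = (fromBlocks 1 0 0 A).submatrix E E := by
    ext x y
    rcases hx : x none <;> rcases hy : y none <;>
      simp [controlled, E, Equiv.piOptionEquivProd, Equiv.boolProdEquivSum, hx, hy,
        Matrix.one_apply, funext_iff, Function.comp_def]
  rw [mem_unitaryGroup_iff, star_eq_conjTranspose] at hA ⊢
  rw [h, conjTranspose_submatrix, submatrix_mul_equiv, fromBlocks_conjTranspose,
    fromBlocks_multiply]
  simp [hA]

/-! ### Binary expansions -/

theorem bitsVal_lt : ∀ {n : ℕ} (x : Bits (Fin n)), bitsVal x < 2 ^ n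
  | 0, x => by simp [bitsVal]
  | n + 1, x => by
    have := bitsVal_lt (fun i : Fin n => x i.castSucc)
    simp only [bitsVal, Fin.sum_univ_castSucc, Fin.val_castSucc, Fin.val_last] at this ⊢
    split_ifs <;> omega

theorem bitsVal_injective : ∀ {n : ℕ}, Function.Injective (bitsVal (n := n))
  | 0 => fun x y _ => Subsingleton.elim x y
  | n + 1 => fun x y h => by
    have hx := bitsVal_lt (fun i : Fin n => x i.castSucc)
    have hy := bitsVal_lt (fun i : Fin n => y i.castSucc)
    have ih := @bitsVal_injective n (fun i => x i.castSucc) (fun i => y i.castSucc)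
    simp only [bitsVal, Fin.sum_univ_castSucc, Fin.val_castSucc, Fin.val_last] at hx hy h ih
    have h1 : x (Fin.last n) = y (Fin.last n) ∧
        (fun i : Fin n => x i.castSucc) = fun i => y i.castSucc := by
      rcases h1 : x (Fin.last n) <;> rcases h2 : y (Fin.last n) <;> simp [h1, h2] at h ⊢
      · exact ih h
      · omega
      · omega
      · exact ih h
    funext i
    refine Fin.lastCases h1.1 (fun i => congrFun h1.2 i) i

theorem bitsVal_surjective {n m : ℕ} (hm : m < 2 ^ n) : ∃ x : Bits (Fin n), bitsVal x = m := by
  have h : Function.Bijective (fun x : Bits (Fin n) => (⟨bitsVal x, bitsVal_lt x⟩ : Fin (2 ^ n))) :=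
    (Fintype.bijective_iff_injective_and_card _).2
      ⟨fun x y h => bitsVal_injective (by simpa using h), by simp⟩
  obtain ⟨x, hx⟩ := h.2 ⟨m, hm⟩
  exact ⟨x, by simpa using hx⟩

section Oracle

variable {M na ns : ℕ}

/-- The basis states of the oracle register whose time index is smaller than `M`. -/
def timeIndexEquiv : {x : Bits (OracleReg M na ns) // bitsVal (fun i => x (Sum.inl i)) < M} ≃
    Fin M × Bits (Fin na) × Bits (Fin ns) :=
  Equiv.ofBijective
    (fun x => (⟨_, x.2⟩, fun i => x.1 (Sum.inr (Sum.inl i)), fun i => x.1 (Sum.inr (Sum.inr i))))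
    (by
      constructor
      · rintro ⟨x, hx⟩ ⟨y, hy⟩ h
        simp only [Prod.mk.injEq, Fin.mk.injEq] at h
        obtain ⟨h1, h2, h3⟩ := h
        have h1 := bitsVal_injective h1
        ext w
        rcases w with w | w | w
        · exact congrFun h1 w
        · exact congrFun h2 w
        · exact congrFun h3 w
      · rintro ⟨m, a, s⟩
        -- M ≤ 2^⌈log₂ M⌉, so every time index has a binary word.
        obtain ⟨x, hx⟩ := bitsVal_surjective
          (n := Nat.clog 2 M) (m := m) (m.2.trans_le (Nat.le_pow_clog (by norm_num) M))
        refine ⟨⟨Sum.elim x (Sum.elim a s), by simp [hx]⟩, ?_⟩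
        simp [hx])

/-- Splitting the basis by whether the time index is below M gives the blocks O and 1. -/
theorem toQubits_mem_unitary {O : OracleOp M na ns}
    (hO : O ∈ unitaryGroup (Fin M × Bits (Fin na) × Bits (Fin ns)) ℂ) :
    O.toQubits ∈ unitaryGroup (Bits (OracleReg M na ns)) ℂ := by
  classical
  let E : Bits (OracleReg M na ns) ≃ (Fin M × Bits (Fin na) × Bits (Fin ns)) ⊕
      {x : Bits (OracleReg M na ns) // ¬ bitsVal (fun i => x (Sum.inl i)) < M} :=
    (Equiv.sumCompl fun x : Bits (OracleReg M na ns) =>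
      bitsVal (fun i => x (Sum.inl i)) < M).symm.trans
      (Equiv.sumCongr timeIndexEquiv (Equiv.refl _))
  have h : O.toQubits = (fromBlocks O 0 0 1).submatrix E E := by
    ext x y
    by_cases hx : bitsVal (fun i => x (Sum.inl i)) < M <;>
    by_cases hy : bitsVal (fun i => y (Sum.inl i)) < M
    · simp [OracleOp.toQubits, E, hx, hy, Equiv.sumCompl_symm_apply_of_pos, timeIndexEquiv]
      rfl
    · simp [OracleOp.toQubits, E, hx, hy, Equiv.sumCompl_symm_apply_of_pos,
        Equiv.sumCompl_symm_apply_of_neg]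
    · have hxy : x ≠ y := by rintro rfl; exact hx hy
      simp [OracleOp.toQubits, E, hx, hy, Equiv.sumCompl_symm_apply_of_pos,
        Equiv.sumCompl_symm_apply_of_neg, hxy]
    · simp [OracleOp.toQubits, E, hx, hy, Equiv.sumCompl_symm_apply_of_neg, Matrix.one_apply]
  rw [mem_unitaryGroup_iff, star_eq_conjTranspose] at hO ⊢
  rw [h, conjTranspose_submatrix, submatrix_mul_equiv, fromBlocks_conjTranspose,
    fromBlocks_multiply]
  simp [hO]

end Oracle

/-! ## Lists of operations -/

section Ops

set_option linter.unusedSectionVars false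

variable {M na ns : ℕ} {R W X : Type} [Fintype R] [DecidableEq R] [Fintype W] [DecidableEq W]
  [Fintype X] [DecidableEq X]

/-- The operator performed by a list of operations on arbitrary wires. -/
def opsEval (O : OracleOp M na ns) : List (Op M na ns W) → QOp W
  | [] => 1
  | op :: c => opsEval O c * op.eval O

@[simp] theorem opsEval_nil (O : OracleOp M na ns) : opsEval O ([] : List (Op M na ns W)) = 1 := rfl

@[simp] theorem opsEval_cons (O : OracleOp M na ns) (op : Op M na ns W) (c : List (Op M na ns W)) :
    opsEval O (op :: c) = opsEval O c * op.eval O := rfl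

@[simp] theorem opsEval_append (O : OracleOp M na ns) (c c' : List (Op M na ns W)) :
    opsEval O (c ++ c') = opsEval O c' * opsEval O c := by
  induction c with
  | nil => simp
  | cons op c ih => simp [ih, Matrix.mul_assoc]

namespace Op

/-- The operation on other wires. -/
def map (f : W ↪ X) : Op M na ns W → Op M na ns X
  | .gate e A => .gate (e.trans f) A
  | .query e inv => .query (e.trans f) inv
  | .ctrlQuery e inv => .ctrlQuery (e.trans f) inv

/-- The inverse operation. -/
def inverse : Op M na ns W → Op M na ns W
  | .gate e A => .gate e A⁻¹
  | .query e inv => .query e !inv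
  | .ctrlQuery e inv => .ctrlQuery e !inv

@[simp] theorem isQuery_map (f : W ↪ X) (op : Op M na ns W) :
    (op.map f).isQuery = op.isQuery := by cases op <;> rfl

@[simp] theorem isQuery_inverse (op : Op M na ns W) :
    op.inverse.isQuery = op.isQuery := by cases op <;> rfl

theorem eval_map (O : OracleOp M na ns) (f : W ↪ X) (op : Op M na ns W) :
    (op.map f).eval O = onWires f (op.eval O) := by
  cases op <;> simp [map, eval, onWires_onWires]

theorem controlled_conjTranspose {R : Type} (A : QOp R) : controlled Aᴴ = (controlled A)ᴴ := by
  ext x y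
  rcases hx : x none <;> rcases hy : y none <;> by_cases h : x ∘ some = y ∘ some <;>
    simp [controlled, hx, hy, h, eq_comm (a := y ∘ some)]

theorem eval_inverse (O : OracleOp M na ns) (op : Op M na ns W) :
    op.inverse.eval O = (op.eval O)ᴴ := by
  cases op with
  | gate e A =>
    simp only [inverse, eval, ← onWires_conjTranspose]
    rfl
  | query e inv => cases inv <;> simp [inverse, eval, ← onWires_conjTranspose]
  | ctrlQuery e inv =>
    cases inv <;> simp [inverse, eval, ← onWires_conjTranspose, controlled_conjTranspose]

theorem eval_mem_unitary {O : OracleOp M na ns}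
    (hO : O ∈ unitaryGroup (Fin M × Bits (Fin na) × Bits (Fin ns)) ℂ) (op : Op M na ns W) :
    op.eval O ∈ unitaryGroup (Bits W) ℂ := by
  have h := toQubits_mem_unitary hO
  have h' : O.toQubitsᴴ ∈ unitaryGroup (Bits (OracleReg M na ns)) ℂ := Unitary.star_mem h
  cases op with
  | gate e A => exact onWires_mem_unitary e A.2
  | query e inv => cases inv <;> exact onWires_mem_unitary e (by simpa)
  | ctrlQuery e inv =>
    cases inv <;> exact onWires_mem_unitary e (controlled_mem_unitary (by simpa))

end Op

theorem opsEval_mem_unitary {O : OracleOp M na ns}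
    (hO : O ∈ unitaryGroup (Fin M × Bits (Fin na) × Bits (Fin ns)) ℂ) (c : List (Op M na ns W)) :
    opsEval O c ∈ unitaryGroup (Bits W) ℂ := by
  induction c with
  | nil => exact one_mem _
  | cons op c ih => exact mul_mem ih (op.eval_mem_unitary hO)

theorem opsEval_map (O : OracleOp M na ns) (f : W ↪ X) (c : List (Op M na ns W)) :
    opsEval O (c.map (Op.map f)) = onWires f (opsEval O c) := by
  induction c with
  | nil => simp [onWires_one]
  | cons op c ih => simp [ih, Op.eval_map, onWires_mul]

theorem opsEval_inverse (O : OracleOp M na ns) (c : List (Op M na ns W)) :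
    opsEval O (c.map Op.inverse).reverse = (opsEval O c)ᴴ := by
  induction c with
  | nil => simp
  | cons op c ih => simp [ih, Op.eval_inverse]

/-! ## Controlled one-qubit gates -/

/-- The two-qubit matrix that applies `V` to the second qubit if the first qubit is `p`. -/
def ctrlMat (p : Bool) (V : Matrix Bool Bool ℂ) : QOp (Fin 2) := fun x y =>
  if x 0 = y 0 then if x 0 = p then V (x 1) (y 1) else if x 1 = y 1 then 1 else 0 else 0

theorem ctrlMat_mem_unitary (p : Bool) {V : Matrix Bool Bool ℂ} (hV : V ∈ unitaryGroup Bool ℂ) :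
    ctrlMat p V ∈ unitaryGroup (Bits (Fin 2)) ℂ := by
  let E : Bits (Fin 2) ≃ Bool ⊕ Bool :=
    (finTwoArrowEquiv Bool).trans (Equiv.boolProdEquivSum _)
  have h : ctrlMat p V =
      (fromBlocks (if p then 1 else V) 0 0 (if p then V else 1)).submatrix E E := by
    ext x y
    cases p <;> rcases hx : x 0 <;> rcases hy : y 0 <;>
      simp [ctrlMat, E, Equiv.boolProdEquivSum, hx, hy, Matrix.one_apply, finTwoArrowEquiv]
  rw [mem_unitaryGroup_iff, star_eq_conjTranspose] at hV ⊢
  rw [h, conjTranspose_submatrix, submatrix_mul_equiv, fromBlocks_conjTranspose,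
    fromBlocks_multiply]
  cases p <;> simp [hV]

/-- Two distinct wires as an embedding. -/
def pairEmb {u t : W} (h : u ≠ t) : Fin 2 ↪ W :=
  ⟨![u, t], by
    intro i j hij
    fin_cases i <;> fin_cases j <;> simp_all [eq_comm]⟩

@[simp] theorem pairEmb_zero {u t : W} (h : u ≠ t) : pairEmb h 0 = u := rfl

@[simp] theorem pairEmb_one {u t : W} (h : u ≠ t) : pairEmb h 1 = t := rfl

/-- The gate that applies `V` to the wire `t` if the wire `u` is `p`. -/
def ctrlGate (p : Bool) {u t : W} (h : u ≠ t) (V : unitaryGroup Bool ℂ) : Op M na ns W :=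
  .gate (pairEmb h) ⟨ctrlMat p V, ctrlMat_mem_unitary p V.2⟩

@[simp] theorem isQuery_ctrlGate (p : Bool) {u t : W} (h : u ≠ t) (V : unitaryGroup Bool ℂ) :
    (ctrlGate p h V : Op M na ns W).isQuery = false := rfl

theorem setWires_pairEmb {u t : W} (h : u ≠ t) (r : Bits (Fin 2)) (x : Bits W) :
    setWires (pairEmb h) r x = Function.update (Function.update x u (r 0)) t (r 1) := by
  funext w
  by_cases h1 : w = t
  · subst h1
    simpa using setWires_apply (pairEmb h) r x 1
  by_cases h2 : w = u
  · subst h2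
    simpa [h1] using setWires_apply (pairEmb h) r x 0
  · rw [setWires_of_notMem]
    · simp [h1, h2]
    · rintro ⟨i, hi⟩
      fin_cases i
      · exact h2 hi.symm
      · exact h1 hi.symm

theorem ctrlGate_mulVec (O : OracleOp M na ns) (p : Bool) {u t : W} (h : u ≠ t)
    (V : unitaryGroup Bool ℂ) (Ψ : Bits W → ℂ) (x : Bits W) :
    ((ctrlGate p h V).eval O *ᵥ Ψ) x =
      if x u = p then ∑ b, (V : Matrix Bool Bool ℂ) (x t) b * Ψ (Function.update x t b) else Ψ x := by
  have hE : ⇑(finTwoArrowEquiv Bool).symm = fun p => ![p.1, p.2] := rfl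
  simp only [ctrlGate, Op.eval, onWires_mulVec, setWires_pairEmb]
  rw [← (finTwoArrowEquiv Bool).symm.sum_comp, Fintype.sum_prod_type, Finset.sum_eq_single (x u)]
  · simp only [ctrlMat, hE, Matrix.cons_val_zero,
      Matrix.cons_val_one, Function.comp_apply, pairEmb_zero, pairEmb_one, if_true,
      Function.update_eq_self]
    split_ifs with hu
    · rfl
    · simp
  · intro b _ hb
    simp [ctrlMat, hE, hb.symm]
  · simp

/-- A real rotation. -/
def rotMat (a b : ℝ) : Matrix Bool Bool ℂ := fun i j =>
  match i, j with
  | false, false => a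
  | false, true => -b
  | true, false => b
  | true, true => a

theorem rotMat_mem_unitary {a b : ℝ} (h : a ^ 2 + b ^ 2 = 1) :
    rotMat a b ∈ unitaryGroup Bool ℂ := by
  have h : (a : ℂ) ^ 2 + (b : ℂ) ^ 2 = 1 := by exact_mod_cast h
  rw [mem_unitaryGroup_iff]
  ext i j
  cases i <;> cases j <;> simp [Matrix.mul_apply, rotMat, star_apply] <;>
    first | linear_combination h | ring

/-- A real rotation as a unitary. -/
def rot (a b : ℝ) (h : a ^ 2 + b ^ 2 = 1) : unitaryGroup Bool ℂ := ⟨_, rotMat_mem_unitary h⟩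

/-- Multiplication by a phase. -/
def phase (z : ℂ) (h : z * star z = 1) : unitaryGroup Bool ℂ :=
  ⟨z • 1, by
    rw [mem_unitaryGroup_iff]
    simp only [star_smul, star_one, smul_mul_smul_comm, mul_one, h, one_smul]⟩

theorem ctrlGate_phase_mulVec (O : OracleOp M na ns) (p : Bool) {u t : W} (h : u ≠ t)
    (z : ℂ) (hz : z * star z = 1) (Ψ : Bits W → ℂ) (x : Bits W) :
    ((ctrlGate p h (phase z hz)).eval O *ᵥ Ψ) x = if x u = p then z * Ψ x else Ψ x := by
  rw [ctrlGate_mulVec]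
  congr 1
  rcases ht : x t <;> simp [phase, Matrix.one_apply, ← ht]

/-- The flip of a qubit. -/
def flip : unitaryGroup Bool ℂ :=
  ⟨of fun i j => if i = j then 0 else 1, by
    rw [mem_unitaryGroup_iff]
    ext i j
    cases i <;> cases j <;> simp [Matrix.mul_apply, star_apply]⟩

/-- A square root of the flip of a qubit. -/
def sqrtFlip : unitaryGroup Bool ℂ :=
  ⟨of fun i j => if i = j then (1 + Complex.I) / 2 else (1 - Complex.I) / 2, by
    rw [mem_unitaryGroup_iff]
    ext i j
    have h2 : (starRingEnd ℂ) 2 = 2 := map_ofNat _ 2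
    cases i <;> cases j <;> simp [Matrix.mul_apply, star_apply, h2] <;>
      first
      | linear_combination (-1 / 2 : ℂ) * Complex.I_sq
      | linear_combination (1 / 2 : ℂ) * Complex.I_sq⟩

theorem ctrlGate_flip_mulVec (O : OracleOp M na ns) (p : Bool) {u t : W} (h : u ≠ t)
    (Ψ : Bits W → ℂ) (x : Bits W) :
    ((ctrlGate p h flip).eval O *ᵥ Ψ) x =
      Ψ (if x u = p then Function.update x t (!x t) else x) := by
  rw [ctrlGate_mulVec]
  split_ifs with hu
  · rcases ht : x t <;> simp [flip]
  · rfl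

end Ops

/-! ## Reversible computations -/

section Toffoli

set_option linter.unusedSectionVars false

variable {M na ns : ℕ} {W : Type} [Fintype W] [DecidableEq W]

/-- The data of a generalized Toffoli gate, which flips the target if the two controls have the
prescribed values. -/
structure Toffoli (W : Type) where
  u : W
  v : W
  t : W
  pu : Bool
  pv : Bool
  huv : u ≠ v
  hut : u ≠ t
  hvt : v ≠ t

namespace Toffoli

/-- The action on basis states. -/
def act (T : Toffoli W) (x : Bits W) : Bits W :=
  Function.update x T.t (xor (x T.t) (decide (x T.u = T.pu) && decide (x T.v = T.pv)))

theorem act_act (T : Toffoli W) (x : Bits W) : T.act (T.act x) = x := by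
  have h1 := T.hut
  have h2 := T.hvt
  simp [act, h1, h2]

/-- Decomposition into two-qubit gates. -/
def ops (T : Toffoli W) : List (Op M na ns W) :=
  [ctrlGate T.pv T.hvt sqrtFlip, ctrlGate T.pu T.huv flip, ctrlGate T.pv T.hvt sqrtFlip⁻¹,
    ctrlGate T.pu T.huv flip, ctrlGate T.pu T.hut sqrtFlip]

/-- Between the two flips of `v`, its condition is negated exactly when the condition on `u` holds,
so the gate acts when exactly one of the two conditions holds. -/
theorem flip_conj_mulVec (O : OracleOp M na ns) (T : Toffoli W) (V : unitaryGroup Bool ℂ)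
    (Ψ : Bits W → ℂ) (x : Bits W) :
    ((ctrlGate T.pu T.huv flip).eval O *ᵥ (ctrlGate T.pv T.hvt V).eval O *ᵥ
      (ctrlGate T.pu T.huv flip).eval O *ᵥ Ψ) x =
      if xor (decide (x T.u = T.pu)) (decide (x T.v = T.pv)) then
        ∑ b, (V : Matrix Bool Bool ℂ) (x T.t) b * Ψ (Function.update x T.t b) else Ψ x := by
  have huv := T.huv
  have hut := T.hut
  have hvt := T.hvt
  simp only [ctrlGate_mulVec _ _ T.hvt, ctrlGate_flip_mulVec]
  by_cases hu : x T.u = T.pu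
  · simp only [hu, if_true, decide_true, Bool.true_xor, Function.update_self, ne_eq, hvt, huv, hut,
      not_false_iff, Function.update_of_ne, hvt.symm]
    by_cases hv : x T.v = T.pv
    · rw [← hv]; simp
    · have hv' : (!x T.v) = T.pv := by
        rcases h : x T.v <;> rcases h' : T.pv <;> simp_all
      have hx : ∀ b, Function.update (Function.update (Function.update x T.v T.pv) T.t b)
          T.v (!T.pv) = Function.update x T.t b := by
        intro b
        rw [← hv', Function.update_comm hvt.symm]
        simp
      simp [hv, hv', hx]
  · simp [hu, hut]

/-- With a, b ∈ {0,1} the truth values of the two conditions, the gates apply the square root of the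
flip to the power a + b - (a xor b) = 2ab. -/
theorem ops_mulVec (O : OracleOp M na ns) (T : Toffoli W) (Ψ : Bits W → ℂ) (x : Bits W) :
    (opsEval O T.ops *ᵥ Ψ) x = Ψ (T.act x) := by
  have hut := T.hut
  have hvt := T.hvt
  simp only [ops, opsEval_cons, opsEval_nil, Matrix.one_mul, ← mulVec_mulVec]
  rw [ctrlGate_mulVec _ _ T.hut]
  simp only [flip_conj_mulVec, ctrlGate_mulVec _ _ T.hvt, act]
  have h2 : (starRingEnd ℂ) 2 = 2 := map_ofNat _ 2
  have hx : ∀ b, x T.t = b → Function.update x T.t b = x := by rintro _ rfl; simp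
  by_cases hu : x T.u = T.pu <;> by_cases hv : x T.v = T.pv <;> rcases ht : x T.t <;>
    simp [hu, hv, hut, hvt, sqrtFlip, h2, hx _ ht] <;>
    first
    | linear_combination ((Ψ x - Ψ (Function.update x T.t true)) / 2) * Complex.I_sq
    | linear_combination ((Ψ x - Ψ (Function.update x T.t false)) / 2) * Complex.I_sq
    | linear_combination ((Ψ (Function.update x T.t true) - Ψ x) / 2) * Complex.I_sq
    | linear_combination ((Ψ (Function.update x T.t false) - Ψ x) / 2) * Complex.I_sq

end Toffoli
end Toffoli

/-! ## Operators implemented with clean ancillas -/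

section Implements

set_option linter.unusedSectionVars false

variable {M na ns : ℕ} {L R X : Type} [Fintype L] [DecidableEq L] [Fintype R] [DecidableEq R]

/-- The isometry that adjoins qubits in the state `|0⟩`. -/
def adjoinZeros (L R : Type) [Fintype L] [DecidableEq L] [Fintype R] [DecidableEq R] :
    Matrix (Bits (L ⊕ R)) (Bits L) ℂ :=
  fun x y => if x = Sum.elim y (fun _ => false) then 1 else 0

theorem elim_eq_iff (x : Bits (L ⊕ R)) (y : Bits L) (z : Bits R) :
    x = Sum.elim y z ↔ x ∘ Sum.inr = z ∧ x ∘ Sum.inl = y := by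
  constructor
  · rintro rfl
    simp
  · rintro ⟨rfl, rfl⟩
    simp

theorem adjoinZeros_mulVec (Ψ : Bits L → ℂ) (x : Bits (L ⊕ R)) :
    (adjoinZeros L R *ᵥ Ψ) x =
      if x ∘ Sum.inr = fun _ => false then Ψ (x ∘ Sum.inl) else 0 := by
  simp only [mulVec, dotProduct, adjoinZeros, elim_eq_iff]
  split_ifs with h <;> simp [h]

theorem adjoinZeros_isometry : (adjoinZeros L R)ᴴ * adjoinZeros L R = 1 := by
  ext x y
  rw [Matrix.mul_apply, Finset.sum_eq_single (Sum.elim y fun _ => false)]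
  · simp [adjoinZeros, elim_eq_iff, Function.comp_def, Matrix.one_apply, eq_comm (a := x)]
  · intro z _ hz
    simp [adjoinZeros, hz]
  · simp

/-- The operators `U O` are performed, for every unitary oracle `O`, by one list of at most `g`
primitive gates and at most `k` queries, with the help of clean ancillas labelled by `R`. -/
def Implements (R : Type) [Fintype R] [DecidableEq R] (g k : ℕ)
    (U : OracleOp M na ns → QOp L) : Prop :=
  ∃ c : List (Op M na ns (L ⊕ R)),
    c.countP (fun op => !op.isQuery) ≤ g ∧ c.countP (fun op => op.isQuery) ≤ k ∧
    ∀ O ∈ unitaryGroup (Fin M × Bits (Fin na) × Bits (Fin ns)) ℂ,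
      opsEval O c * adjoinZeros L R = adjoinZeros L R * U O

/-- With ι the isometry adjoining zeros and V the operator of the list, Vι = ιU gives U*U = ι*V*Vι =
1. -/
theorem Implements.unitary {g k : ℕ} {U : OracleOp M na ns → QOp L} (h : Implements R g k U)
    {O : OracleOp M na ns} (hO : O ∈ unitaryGroup (Fin M × Bits (Fin na) × Bits (Fin ns)) ℂ) :
    U O ∈ unitaryGroup (Bits L) ℂ := by
  obtain ⟨c, -, -, hc⟩ := h
  have hu := opsEval_mem_unitary hO c
  rw [mem_unitaryGroup_iff', star_eq_conjTranspose] at hu ⊢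
  calc (U O)ᴴ * U O = (adjoinZeros L R * U O)ᴴ * (adjoinZeros L R * U O) := by
        rw [conjTranspose_mul, Matrix.mul_assoc, ← Matrix.mul_assoc _ (adjoinZeros L R),
          adjoinZeros_isometry, Matrix.one_mul]
    _ = 1 := by
        rw [← hc O hO, conjTranspose_mul, Matrix.mul_assoc, ← Matrix.mul_assoc _ (opsEval O c),
          hu, Matrix.one_mul, adjoinZeros_isometry]

theorem Implements.mono {g g' k k' : ℕ} {U : OracleOp M na ns → QOp L} (h : Implements R g k U)
    (hg : g ≤ g') (hk : k ≤ k') : Implements R g' k' U := by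
  obtain ⟨c, h1, h2, hc⟩ := h
  exact ⟨c, h1.trans hg, h2.trans hk, hc⟩

theorem Implements.mul {g g' k k' : ℕ} {U U' : OracleOp M na ns → QOp L}
    (h : Implements R g k U) (h' : Implements R g' k' U') :
    Implements R (g + g') (k + k') (fun O => U O * U' O) := by
  obtain ⟨c, h1, h2, hc⟩ := h
  obtain ⟨c', h1', h2', hc'⟩ := h'
  refine ⟨c' ++ c, ?_, ?_, fun O hO => ?_⟩
  · rw [List.countP_append]; omega
  · rw [List.countP_append]; omega
  · rw [opsEval_append, Matrix.mul_assoc, hc' O hO, ← Matrix.mul_assoc, hc O hO, Matrix.mul_assoc]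

/-- Multiplying Vι = ιU by V* and U* gives V*ι = ιU*. Unitarity of U is what ensures that the
inverse list also returns the ancillas to 0. -/
theorem Implements.conjTranspose {g k : ℕ} {U : OracleOp M na ns → QOp L}
    (h : Implements R g k U) : Implements R g k (fun O => (U O)ᴴ) := by
  have hU := fun O hO => h.unitary (O := O) hO
  obtain ⟨c, h1, h2, hc⟩ := h
  refine ⟨(c.map Op.inverse).reverse, ?_, ?_, fun O hO => ?_⟩
  · simpa [List.countP_map, Function.comp_def] using h1
  · simpa [List.countP_map, Function.comp_def] using h2
  · have hU := hU O hO
    have hu := opsEval_mem_unitary hO c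
    rw [mem_unitaryGroup_iff, star_eq_conjTranspose] at hU
    rw [mem_unitaryGroup_iff', star_eq_conjTranspose] at hu
    rw [opsEval_inverse]
    calc (opsEval O c)ᴴ * adjoinZeros L R
        = (opsEval O c)ᴴ * (adjoinZeros L R * U O * (U O)ᴴ) := by
          rw [Matrix.mul_assoc (adjoinZeros L R), hU, Matrix.mul_one]
      _ = adjoinZeros L R * (U O)ᴴ := by
          rw [← hc O hO, Matrix.mul_assoc, ← Matrix.mul_assoc, hu, Matrix.one_mul]

theorem onWires_inl_mul (A : QOp L) :
    onWires (Function.Embedding.inl : L ↪ L ⊕ R) A * adjoinZeros L R = adjoinZeros L R * A := by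
  refine ext_mulVec fun Ψ => ?_
  funext x
  rw [← mulVec_mulVec, ← mulVec_mulVec, onWires_mulVec]
  have h1 (r : Bits L) : setWires (Function.Embedding.inl : L ↪ L ⊕ R) r x ∘ Sum.inl = r :=
    setWires_comp _ _ _
  have h2 (r : Bits L) :
      setWires (Function.Embedding.inl : L ↪ L ⊕ R) r x ∘ Sum.inr = x ∘ Sum.inr := by
    funext w
    exact setWires_of_notMem _ _ _ (by simp)
  simp only [adjoinZeros_mulVec, h1, h2]
  split_ifs
  · rfl
  · simp

theorem Implements.ops (c : List (Op M na ns L)) {g k : ℕ}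
    (hg : c.countP (fun op => !op.isQuery) ≤ g) (hk : c.countP (fun op => op.isQuery) ≤ k) :
    Implements R g k (fun O => opsEval O c) := by
  refine ⟨c.map (Op.map .inl), ?_, ?_, fun O _ => ?_⟩
  · simpa [List.countP_map, Function.comp_def] using hg
  · simpa [List.countP_map, Function.comp_def] using hk
  · rw [opsEval_map, onWires_inl_mul]

/-- The operation is charged both as a gate and as a query, which avoids a case distinction and only
weakens the gate count. -/
theorem Implements.op (op : Op M na ns L) : Implements R 1 1 (fun O => op.eval O) := by
  have := Implements.ops (R := R) [op] (g := 1) (k := 1) List.countP_le_length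
    List.countP_le_length
  simpa using this

theorem Implements.gate (op : Op M na ns L) (h : op.isQuery = false) :
    Implements R 1 0 (fun O => op.eval O) := by
  have := Implements.ops (R := R) [op] (g := 1) (k := 0) (by simp [h]) (by simp [h])
  simpa using this

end Implements

/-! ## Computing and uncomputing -/

section Programs

set_option linter.unusedSectionVars false

variable {M na ns : ℕ} {L R W : Type} [Fintype L] [DecidableEq L] [Fintype R] [DecidableEq R]
  [Fintype W] [DecidableEq W]

/-- The effect of a list of Toffoli gates on a basis state. -/
def run : List (Toffoli W) → Bits W → Bits W
  | [], x => x
  | T :: p, x => run p (T.act x)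

theorem run_append (p p' : List (Toffoli W)) (x : Bits W) : run (p ++ p') x = run p' (run p x) := by
  induction p generalizing x with
  | nil => rfl
  | cons T p ih => exact ih _

/-- The gates of a list of Toffoli gates. -/
def progOps (p : List (Toffoli W)) : List (Op M na ns W) := p.flatMap Toffoli.ops

theorem progOps_countP_gate (p : List (Toffoli W)) :
    (progOps p : List (Op M na ns W)).countP (fun op => !op.isQuery) = 5 * p.length := by
  induction p with
  | nil => rfl
  | cons T p ih =>
    simp only [progOps, List.flatMap_cons, List.countP_append, List.length_cons] at ih ⊢
    rw [ih]
    simp [Toffoli.ops]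
    ring

theorem progOps_countP_query (p : List (Toffoli W)) :
    (progOps p : List (Op M na ns W)).countP (fun op => op.isQuery) = 0 := by
  induction p with
  | nil => rfl
  | cons T p ih =>
    simp only [progOps, List.flatMap_cons, List.countP_append] at ih ⊢
    rw [ih]
    simp [Toffoli.ops]

theorem progOps_mulVec_run (O : OracleOp M na ns) (p : List (Toffoli W)) (Ψ : Bits W → ℂ)
    (x : Bits W) : (opsEval O (progOps p) *ᵥ Ψ) (run p x) = Ψ x := by
  induction p generalizing x Ψ with
  | nil => simp [progOps, run]
  | cons T p ih =>
    simp only [progOps, List.flatMap_cons, opsEval_append, ← mulVec_mulVec, run] at ih ⊢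
    rw [ih, Toffoli.ops_mulVec, Toffoli.act_act]

/-- Every Toffoli gate is an involution, so the reversed list inverts the program without inverse
gates. -/
theorem progOps_reverse_mulVec (O : OracleOp M na ns) (p : List (Toffoli W)) (Ψ : Bits W → ℂ)
    (x : Bits W) : (opsEval O (progOps p.reverse) *ᵥ Ψ) x = Ψ (run p x) := by
  induction p generalizing x with
  | nil => simp [progOps, run]
  | cons T p ih =>
    simp only [progOps, List.reverse_cons, List.flatMap_append, List.flatMap_cons, List.flatMap_nil,
      List.append_nil, opsEval_append, ← mulVec_mulVec, run] at ih ⊢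
    rw [Toffoli.ops_mulVec, ih]

/-- The program neither reads nor changes the wire `t`. -/
def Avoids (p : List (Toffoli W)) (t : W) : Prop := ∀ T ∈ p, T.u ≠ t ∧ T.v ≠ t ∧ T.t ≠ t

theorem Avoids.run_update {p : List (Toffoli W)} {t : W} (h : Avoids p t) (x : Bits W) (b : Bool) :
    run p (Function.update x t b) = Function.update (run p x) t b := by
  induction p generalizing x with
  | nil => rfl
  | cons T p ih =>
    obtain ⟨h1, h2, h3⟩ := h T (by simp)
    have : T.act (Function.update x t b) = Function.update (T.act x) t b := by
      simp only [Toffoli.act, Function.update_of_ne h1, Function.update_of_ne h2,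
        Function.update_of_ne h3]
      rw [Function.update_comm h3]
    simp only [run, this]
    exact ih (fun T hT => h T (by simp [hT])) _

theorem Avoids.run_apply {p : List (Toffoli W)} {t : W} (h : Avoids p t) (x : Bits W) :
    run p x t = x t := by
  have := congrFun (h.run_update x (x t)) t
  simpa using this

/-- The program ignores the target, so it commutes with changes of the target and the uncomputation
cancels it on both branches of the controlled gate. The ancillas need not be clean for this. -/
theorem compute_uncompute_mulVec (O : OracleOp M na ns) {p : List (Toffoli W)} {t out : W}
    (ht : Avoids p t) (hne : out ≠ t) (pol : Bool) (V : unitaryGroup Bool ℂ) (Ψ : Bits W → ℂ)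
    (x : Bits W) :
    (opsEval O (progOps p ++ [ctrlGate pol hne V] ++ progOps p.reverse) *ᵥ Ψ) x =
      if run p x out = pol then
        ∑ b, (V : Matrix Bool Bool ℂ) (x t) b * Ψ (Function.update x t b) else Ψ x := by
  simp only [opsEval_append, opsEval_cons, opsEval_nil, Matrix.one_mul, ← mulVec_mulVec]
  rw [progOps_reverse_mulVec, ctrlGate_mulVec, progOps_mulVec_run, ht.run_apply]
  simp only [← ht.run_update, progOps_mulVec_run]

/-- The permutation matrix that flips the wire `t` of the basis states satisfying `φ`. -/
def condFlip (φ : Bits L → Bool) (t : L) : QOp L := fun x y =>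
  if y = if φ x then Function.update x t (!x t) else x then 1 else 0

theorem condFlip_mulVec (φ : Bits L → Bool) (t : L) (Ψ : Bits L → ℂ) (x : Bits L) :
    (condFlip φ t *ᵥ Ψ) x = Ψ (if φ x then Function.update x t (!x t) else x) := by
  simp [mulVec, dotProduct, condFlip]

theorem elim_comp_of_zero {x : Bits (L ⊕ R)} (h : x ∘ Sum.inr = fun _ => false) :
    Sum.elim (x ∘ Sum.inl) (fun _ => false) = x := by
  rw [← h, Sum.elim_comp_inl_inr]

theorem countP_compute_uncompute (p : List (Toffoli W)) (op : Op M na ns W)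
    (h : op.isQuery = false) :
    (progOps p ++ [op] ++ progOps p.reverse).countP (fun op : Op M na ns W => !op.isQuery) =
      10 * p.length + 1 ∧
    (progOps p ++ [op] ++ progOps p.reverse).countP (fun op : Op M na ns W => op.isQuery) = 0 := by
  simp only [List.countP_append, progOps_countP_gate, progOps_countP_query, List.length_reverse]
  simp [h]
  ring

/-- Clean ancillas make the output wire carry φ. The cost is five gates for each Toffoli gate,
twice, and one controlled flip. -/
theorem implements_condFlip {p : List (Toffoli (L ⊕ R))} {t : L} {out : R}
    {φ : Bits L → Bool} (ht : Avoids p (Sum.inl t)) (pol : Bool)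
    (hφ : ∀ x : Bits L, φ x = true ↔ run p (Sum.elim x fun _ => false) (Sum.inr out) = pol) :
    Implements R (10 * p.length + 1) 0 (fun _ : OracleOp M na ns => condFlip φ t) := by
  have hne : (Sum.inr out : L ⊕ R) ≠ Sum.inl t := by simp
  obtain ⟨h1, h2⟩ := countP_compute_uncompute p (ctrlGate pol hne flip : Op M na ns (L ⊕ R)) rfl
  refine ⟨_, h1.le, h2.le, fun O _ => ext_mulVec fun Ψ => ?_⟩
  funext x
  rw [← mulVec_mulVec, ← mulVec_mulVec, compute_uncompute_mulVec _ ht]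
  have hu (b : Bool) : Function.update x (Sum.inl t) b ∘ Sum.inr = x ∘ Sum.inr := by
    funext w; simp
  have hu' (b : Bool) : Function.update x (Sum.inl t) b ∘ Sum.inl =
      Function.update (x ∘ Sum.inl) t b := Function.update_comp_eq_of_injective _
        Sum.inl_injective _ _
  simp only [adjoinZeros_mulVec, condFlip_mulVec, hu, hu']
  by_cases hx : x ∘ Sum.inr = fun _ => false
  · have := hφ (x ∘ Sum.inl)
    rw [elim_comp_of_zero hx] at this
    simp only [hx, if_true, ← this]
    split_ifs
    · rcases hb : x (Sum.inl t) <;> simp [flip, hb]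
    · rfl
  · simp [hx]

/-- A primitive gate needs two wires, so the sign is applied as a scalar phase on a spare ancilla
`r`, which it does not otherwise affect. -/
theorem implements_condSign {p : List (Toffoli (L ⊕ R))} {out r : R} (hr : out ≠ r)
    {φ : Bits L → Prop} [DecidablePred φ] (ht : Avoids p (Sum.inr r)) (pol : Bool)
    (hφ : ∀ x : Bits L, φ x ↔ run p (Sum.elim x fun _ => false) (Sum.inr out) = pol)
    {U : QOp L} (hU : ∀ Ψ x, (U *ᵥ Ψ) x = if φ x then - Ψ x else Ψ x) :
    Implements R (10 * p.length + 1) 0 (fun _ : OracleOp M na ns => U) := by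
  have hne : (Sum.inr out : L ⊕ R) ≠ Sum.inr r := by simpa
  obtain ⟨h1, h2⟩ := countP_compute_uncompute p
    (ctrlGate pol hne (phase (-1) (by simp)) : Op M na ns (L ⊕ R)) rfl
  refine ⟨_, h1.le, h2.le, fun O _ => ext_mulVec fun Ψ => ?_⟩
  funext x
  rw [← mulVec_mulVec, ← mulVec_mulVec, compute_uncompute_mulVec _ ht]
  have hs : ∑ b, ((phase (-1) (by simp) : unitaryGroup Bool ℂ) : Matrix Bool Bool ℂ)
      (x (Sum.inr r)) b * (adjoinZeros L R *ᵥ Ψ) (Function.update x (Sum.inr r) b) =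
      - (adjoinZeros L R *ᵥ Ψ) x := by
    rw [Finset.sum_eq_single (x (Sum.inr r))]
    · simp [phase]
    · intro b _ hb
      simp [phase, hb.symm]
    · simp
  rw [hs]
  simp only [adjoinZeros_mulVec, hU]
  by_cases hx : x ∘ Sum.inr = fun _ => false
  · have := hφ (x ∘ Sum.inl)
    rw [elim_comp_of_zero hx] at this
    simp only [hx, if_true, ← this]
  · simp [hx]

/-! ### Conjunctions -/

/-- The program that stores in the ancilla `i + |ℓ|` whether all literals in the list `ℓ` hold and
the ancilla `i` is `pol`. -/
def andProg {r : ℕ} : (l : List (L × Bool)) → (pol : Bool) → (i : ℕ) → (i + l.length < r) →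
    List (Toffoli (L ⊕ Fin r))
  | [], _, _, _ => []
  | l :: ls, pol, i, h =>
    { u := Sum.inl l.1
      v := Sum.inr ⟨i, by omega⟩
      t := Sum.inr ⟨i + 1, by simp at h; omega⟩
      pu := l.2
      pv := pol
      huv := by simp
      hut := by simp
      hvt := by simp } :: andProg ls true (i + 1) (by simp at h; omega)

theorem andProg_length {r : ℕ} (l : List (L × Bool)) (pol : Bool) (i : ℕ)
    (h : i + l.length < r) : (andProg l pol i h).length = l.length := by
  induction l generalizing pol i with
  | nil => rfl
  | cons l ls ih => simp [andProg, ih]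

theorem andProg_avoids_inl {r : ℕ} (l : List (L × Bool)) (pol : Bool) (i : ℕ)
    (h : i + l.length < r) {t : L} (ht : ∀ a ∈ l, a.1 ≠ t) :
    Avoids (andProg l pol i h) (Sum.inl t) := by
  induction l generalizing pol i with
  | nil => simp [andProg, Avoids]
  | cons l ls ih =>
    intro T hT
    rcases List.mem_cons.1 hT with rfl | hT
    · exact ⟨by simpa using ht l (by simp), by simp, by simp⟩
    · exact ih true (i + 1) _ (fun a ha => ht a (by simp [ha])) T hT

theorem andProg_avoids_inr {r : ℕ} (l : List (L × Bool)) (pol : Bool) (i : ℕ)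
    (h : i + l.length < r) {t : Fin r} (ht : i + l.length < t) :
    Avoids (andProg l pol i h) (Sum.inr t) := by
  induction l generalizing pol i with
  | nil => simp [andProg, Avoids]
  | cons l ls ih =>
    intro T hT
    simp only [List.length_cons] at ht
    rcases List.mem_cons.1 hT with rfl | hT
    · refine ⟨by simp, ?_, ?_⟩ <;> simp [Fin.ext_iff] <;> omega
    · exact ih true (i + 1) _ (by omega) T hT

theorem run_andProg_true {r : ℕ} (l : List (L × Bool)) (i : ℕ) (h : i + l.length < r)
    (z : Bits (L ⊕ Fin r)) (hz : ∀ j : Fin r, i < j → z (Sum.inr j) = false) :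
    run (andProg l true i h) z (Sum.inr ⟨i + l.length, h⟩) = true ↔
      z (Sum.inr ⟨i, by omega⟩) = true ∧ ∀ a ∈ l, z (Sum.inl a.1) = a.2 := by
  induction l generalizing i z with
  | nil => simp [andProg, run]
  | cons l ls ih =>
    have h' : i + 1 + ls.length < r := by simp at h; omega
    have hidx : (⟨i + (l :: ls).length, h⟩ : Fin r) = ⟨i + 1 + ls.length, h'⟩ := by
      simp; omega
    rw [hidx, andProg, run, ih]
    · simp only [Toffoli.act, Function.update_self]
      rw [hz _ (by simp)]
      simp
      tauto
    · intro j hj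
      rw [Toffoli.act, Function.update_of_ne]
      · exact hz j (by omega)
      · simp [Fin.ext_iff]; omega

/-- The chain starts at the ancilla 0, which is still `false`; hence the polarity `false` for the
first literal and `true` afterwards. For an empty list the output would be this ancilla itself, with
the wrong value. -/
theorem run_andProg_false {r : ℕ} (l : List (L × Bool)) (hl : l ≠ []) (h : 0 + l.length < r)
    (x : Bits L) :
    run (andProg l false 0 h) (Sum.elim x fun _ => false) (Sum.inr ⟨l.length, by omega⟩) = true ↔
      ∀ a ∈ l, x a.1 = a.2 := by
  obtain ⟨l, ls, rfl⟩ := List.exists_cons_of_ne_nil hl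
  have h' : 1 + ls.length < r := by simp at h; omega
  have hidx : (⟨(l :: ls).length, by omega⟩ : Fin r) = ⟨0 + 1 + ls.length, by omega⟩ := by
    simp; omega
  rw [hidx, andProg, run, run_andProg_true]
  · simp only [Toffoli.act, Function.update_self]
    simp
    exact fun _ => decide_eq_true_iff
  · intro j hj
    rw [Toffoli.act, Function.update_of_ne]
    · simp
    · simp [Fin.ext_iff]; omega

/-! ### Comparison -/

/-- The program that stores in the ancilla `n` whether the integer on the wires `a` is smaller than
the integer on the wires `b`. -/
def ltProg {r : ℕ} : (n : ℕ) → n < r → (a b : Fin n → L) → (∀ i, a i ≠ b i) →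
    List (Toffoli (L ⊕ Fin r))
  | 0, _, _, _, _ => []
  | n + 1, h, a, b, hab =>
    ltProg n (by omega) (fun i => a i.castSucc) (fun i => b i.castSucc) (fun i => hab _) ++
    -- The new comparison is the majority of ¬a_n, b_n and the comparison z of the lower bits. The
    -- three gates compute it as the sum modulo 2 of the products of pairs.
    [{ u := Sum.inl (a (Fin.last n))
       v := Sum.inl (b (Fin.last n))
       t := Sum.inr ⟨n + 1, h⟩
       pu := false
       pv := true
       huv := by simpa using hab _
       hut := by simp
       hvt := by simp },
     { u := Sum.inl (a (Fin.last n))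
       v := Sum.inr ⟨n, by omega⟩
       t := Sum.inr ⟨n + 1, h⟩
       pu := false
       pv := true
       huv := by simp
       hut := by simp
       hvt := by simp },
     { u := Sum.inl (b (Fin.last n))
       v := Sum.inr ⟨n, by omega⟩
       t := Sum.inr ⟨n + 1, h⟩
       pu := true
       pv := true
       huv := by simp
       hut := by simp
       hvt := by simp }]

theorem ltProg_length {r : ℕ} (n : ℕ) (h : n < r) (a b : Fin n → L) (hab : ∀ i, a i ≠ b i) :
    (ltProg n h a b hab).length = 3 * n := by
  induction n with
  | zero => rfl
  | succ n ih => simp [ltProg, ih]; ring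

theorem ltProg_avoids_inl {r : ℕ} (n : ℕ) (h : n < r) (a b : Fin n → L) (hab : ∀ i, a i ≠ b i)
    {t : L} (ha : ∀ i, a i ≠ t) (hb : ∀ i, b i ≠ t) :
    Avoids (ltProg n h a b hab) (Sum.inl t) := by
  induction n with
  | zero => simp [ltProg, Avoids]
  | succ n ih =>
    intro T hT
    rcases List.mem_append.1 hT with hT | hT
    · exact ih (by omega) _ _ _ (fun i => ha _) (fun i => hb _) T hT
    · simp only [List.mem_cons, List.not_mem_nil, or_false] at hT
      rcases hT with rfl | rfl | rfl <;> simp [ha, hb]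

theorem run_ltProg {r : ℕ} (n : ℕ) (h : n < r) (a b : Fin n → L) (hab : ∀ i, a i ≠ b i)
    (x : Bits L) :
    (∀ w, run (ltProg n h a b hab) (Sum.elim x fun _ => false) (Sum.inl w) = x w) ∧
    (∀ j : Fin r, n < j →
      run (ltProg n h a b hab) (Sum.elim x fun _ => false) (Sum.inr j) = false) ∧
    (run (ltProg n h a b hab) (Sum.elim x fun _ => false) (Sum.inr ⟨n, h⟩) = true ↔
      bitsVal (fun i => x (a i)) < bitsVal (fun i => x (b i))) := by
  induction n with
  | zero => simp [ltProg, run, bitsVal]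
  | succ n ih =>
    obtain ⟨h1, h2, h3⟩ :=
      ih (by omega) (fun i => a i.castSucc) (fun i => b i.castSucc) (fun i => hab _)
    simp only [ltProg, run_append]
    set z := run (ltProg n (by omega : n < r) (fun i => a i.castSucc) (fun i => b i.castSucc)
      (fun i => hab _)) (Sum.elim x fun _ => false) with hz
    have hn : (⟨n, by omega⟩ : Fin r) ≠ ⟨n + 1, h⟩ := by simp
    refine ⟨fun w => by simp [run, Toffoli.act, h1], fun j hj => ?_, ?_⟩
    · have : j ≠ ⟨n + 1, h⟩ := by rw [Ne, Fin.ext_iff]; simp; omega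
      simp [run, Toffoli.act, this, h2 j (by omega)]
    · have ha := bitsVal_lt (fun i : Fin n => x (a i.castSucc))
      have hb := bitsVal_lt (fun i : Fin n => x (b i.castSucc))
      have hz1 : z (Sum.inr ⟨n + 1, h⟩) = false := h2 _ (by simp)
      simp only [bitsVal, Fin.sum_univ_castSucc, Fin.val_castSucc, Fin.val_last] at ha hb h3 ⊢
      rcases hxa : x (a (Fin.last n)) <;> rcases hxb : x (b (Fin.last n)) <;>
        rcases hzn : z (Sum.inr ⟨n, by omega⟩) <;>
        simp [run, Toffoli.act, h1, hz1, hxa, hxb, hzn] at h3 ⊢ <;> omega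

end Programs

/-! ## Preparation of the uniform superposition over the time indices -/

section Preparation

variable {M na ns : ℕ}

theorem sum_bits_succ {n : ℕ} {E : Type*} [AddCommMonoid E] (f : Bits (Fin (n + 1)) → E) :
    ∑ x, f x = ∑ x : Bits (Fin n), ∑ b, f (Fin.snoc x b) := by
  rw [← (Fin.snocEquiv fun _ : Fin (n + 1) => Bool).sum_comp, Fintype.sum_prod_type,
    Finset.sum_comm]
  rfl

theorem bitsVal_snoc {n : ℕ} (x : Bits (Fin n)) (b : Bool) :
    bitsVal (Fin.snoc x b : Bits (Fin (n + 1))) = bitsVal x + if b then 2 ^ n else 0 := by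
  simp [bitsVal, Fin.sum_univ_castSucc]

theorem apply_eq_mulVec_single {W : Type} [Fintype W] [DecidableEq W] (A : QOp W) (x y : Bits W) :
    A x y = (A *ᵥ Pi.single y 1) x := by
  simp [Matrix.col]

/-- The wires of a time register: the time index and auxiliary wires. -/
abbrev TimeReg (n : ℕ) : Type := Fin n ⊕ Fin (n + 1)

/-- The inclusion of a time register into the next one. -/
def timeEmb (n : ℕ) : TimeReg n ↪ TimeReg (n + 1) :=
  Function.Embedding.sumMap Fin.castSuccEmb Fin.castSuccEmb

/-- The state of the time register in which all wires except the last are `0`. -/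
def timeInit (n : ℕ) (γ : Bool) : Bits (TimeReg n) :=
  Sum.elim (fun _ => false) (fun i => if i = Fin.last n then γ else false)

/-- The default rotation by 0 makes `splitRot` total, so gate lists can be written down without
conditions on the probabilities. -/
theorem rot_split (a b : ℝ) :
    (if 0 ≤ a ∧ 0 ≤ b ∧ a + b = 1 then Real.sqrt a else 1) ^ 2 +
      (if 0 ≤ a ∧ 0 ≤ b ∧ a + b = 1 then Real.sqrt b else 0) ^ 2 = 1 := by
  split_ifs with h
  · rw [Real.sq_sqrt h.1, Real.sq_sqrt h.2.1, h.2.2]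
  · norm_num

/-- The rotation that takes `|0⟩` to a state with probabilities `a` and `b`. -/
def splitRot (a b : ℝ) : unitaryGroup Bool ℂ := rot _ _ (rot_split a b)

theorem splitRot_false {a b : ℝ} (ha : 0 ≤ a) (hb : 0 ≤ b) (h : a + b = 1) (c : Bool) :
    (splitRot a b : Matrix Bool Bool ℂ) c false = (Real.sqrt (if c then b else a) : ℝ) := by
  cases c <;> simp [splitRot, rot, rotMat, ha, hb, h]

/-- The part of the preparation that acts on the leading bit. -/
def prepTop (n M' : ℕ) (p : Bool) : List (Op M na ns (TimeReg (n + 1))) :=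
  -- Among the integers below M', min(2^n, M') have leading bit 0 and M' - 2^n (truncated
  -- subtraction) have leading bit 1. Without a constraint both bits have probability 1/2.
  [ctrlGate p (u := Sum.inr (Fin.last (n + 1))) (t := Sum.inl (Fin.last n)) (by simp)
      (splitRot (min (2 ^ n) M' / M') ((M' - 2 ^ n : ℕ) / M')),
    ctrlGate (!p) (u := Sum.inr (Fin.last (n + 1))) (t := Sum.inl (Fin.last n)) (by simp)
      (splitRot (1 / 2) (1 / 2))] ++
  -- The next control wire records whether the lower bits are still constrained. If 2^n < M' this
  -- happens for leading bit 1, with the new bound M' - 2^n; otherwise for leading bit 0, with the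
  -- bound M'.
  Toffoli.ops
    { u := Sum.inr (Fin.last (n + 1))
      v := Sum.inl (Fin.last n)
      t := Sum.inr (Fin.last n).castSucc
      pu := p
      pv := decide (2 ^ n < M')
      huv := by simp
      hut := by simp [Fin.ext_iff]
      hvt := by simp }

/-- The preparation of the uniform superposition over the integers smaller than `M'`, if the last
wire is `p`, and over all integers with `n` bits otherwise. -/
def prep : (n M' : ℕ) → Bool → List (Op M na ns (TimeReg n))
  | 0, _, _ => []
  | n + 1, M', p => prepTop n M' p ++
      (prep n (if 2 ^ n < M' then M' - 2 ^ n else M') true).map (Op.map (timeEmb n))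

theorem prep_countP (n M' : ℕ) (p : Bool) :
    (prep n M' p : List (Op M na ns (TimeReg n))).countP (fun op => !op.isQuery) = 7 * n ∧
    (prep n M' p : List (Op M na ns (TimeReg n))).countP (fun op => op.isQuery) = 0 := by
  induction n generalizing M' p with
  | zero => simp [prep]
  | succ n ih =>
    simp only [prep, prepTop, List.countP_append, List.countP_map, Function.comp_def,
      Op.isQuery_map, ih]
    constructor
    · simp [Toffoli.ops]; ring
    · simp [Toffoli.ops]

/-- The probability of the leading bit `b`. -/
def topProb (n M' : ℕ) (t b : Bool) : ℝ :=
  if t then (if b then ((M' - 2 ^ n : ℕ) : ℝ) / M' else (min (2 ^ n) M' : ℝ) / M') else 1 / 2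

theorem topProb_nonneg (n M' : ℕ) (t b : Bool) : 0 ≤ topProb n M' t b := by
  unfold topProb
  split_ifs <;> positivity

theorem prepTop_mulVec (O : OracleOp M na ns) (n M' : ℕ) (hM : 0 < M') (p γ : Bool)
    (x : Bits (TimeReg (n + 1))) :
    (opsEval O (prepTop n M' p) *ᵥ Pi.single (timeInit (n + 1) γ) 1) x =
      if x (Sum.inr (Fin.last (n + 1))) = γ ∧ x ∘ timeEmb n = timeInit n
          (decide (γ = p) && decide (x (Sum.inl (Fin.last n)) = decide (2 ^ n < M'))) then
        (Real.sqrt (topProb n M' (decide (γ = p)) (x (Sum.inl (Fin.last n)))) : ℂ) else 0 := by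
  have hne : (Sum.inr (Fin.last (n + 1)) : TimeReg (n + 1)) ≠ Sum.inl (Fin.last n) := by simp
  have h1 : ∀ z : Bits (TimeReg (n + 1)),
      ((ctrlGate (M := M) (na := na) (ns := ns) (!p) hne (splitRot (1 / 2) (1 / 2))).eval O *ᵥ
        (ctrlGate p hne (splitRot (min (2 ^ n) M' / M') ((M' - 2 ^ n : ℕ) / M'))).eval O *ᵥ
          Pi.single (timeInit (n + 1) γ) 1) z =
      if Function.update z (Sum.inl (Fin.last n)) false = timeInit (n + 1) γ then
        (Real.sqrt (topProb n M' (decide (γ = p)) (z (Sum.inl (Fin.last n)))) : ℂ) else 0 := by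
    intro z
    have hb : ∀ V : unitaryGroup Bool ℂ, ∀ z : Bits (TimeReg (n + 1)),
        ∑ b, (V : Matrix Bool Bool ℂ) (z (Sum.inl (Fin.last n))) b *
          (Pi.single (timeInit (n + 1) γ) 1 : Bits (TimeReg (n + 1)) → ℂ)
            (Function.update z (Sum.inl (Fin.last n)) b) =
        if Function.update z (Sum.inl (Fin.last n)) false = timeInit (n + 1) γ then
          (V : Matrix Bool Bool ℂ) (z (Sum.inl (Fin.last n))) false else 0 := by
      intro V z
      have : Function.update z (Sum.inl (Fin.last n)) true ≠ timeInit (n + 1) γ := by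
        intro h
        have := congrFun h (Sum.inl (Fin.last n))
        simp [timeInit] at this
      simp [Pi.single_apply, this]
    have hg : Function.update z (Sum.inl (Fin.last n)) false = timeInit (n + 1) γ →
        z (Sum.inr (Fin.last (n + 1))) = γ := by
      intro h
      have := congrFun h (Sum.inr (Fin.last (n + 1)))
      simpa [timeInit] using this
    have hM' : (0 : ℝ) < M' := by exact_mod_cast hM
    have hsum : (min (2 ^ n) M' / M' : ℝ) + ((M' - 2 ^ n : ℕ) : ℝ) / M' = 1 := by
      rw [← add_div, div_eq_one_iff_eq hM'.ne']
      have : min (2 ^ n) M' + (M' - 2 ^ n) = M' := by omega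
      exact_mod_cast this
    simp only [ctrlGate_mulVec, hb, Function.update_of_ne hne, Function.update_idem,
      Function.update_self]
    by_cases hz : Function.update z (Sum.inl (Fin.last n)) false = timeInit (n + 1) γ
    · have hg := hg hz
      have hz1 : z (Sum.inl (Fin.last n)) = true → z ≠ timeInit (n + 1) γ := by
        rintro h1 rfl
        simp [timeInit] at h1
      have hz0 : z (Sum.inl (Fin.last n)) = false → z = timeInit (n + 1) γ := by
        intro h
        rw [← hz, ← h]; simp
      have e1 := splitRot_false (a := 1 / 2) (b := 1 / 2) (by norm_num) (by norm_num) (by norm_num)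
      have e2 := splitRot_false (a := min (2 ^ n) M' / M') (b := ((M' - 2 ^ n : ℕ) : ℝ) / M')
        (by positivity) (by positivity) hsum
      by_cases hp : γ = p
      · subst hp
        simp only [hz, hg, if_true, e2, topProb, decide_true]
        simp
      · have hp' : γ = !p := by cases γ <;> cases p <;> simp_all
        subst hp'
        simp only [hg, hp, if_true, if_false, hb, hz, e1, topProb]
        simp
    · have hz1 : ∀ b, Function.update z (Sum.inl (Fin.last n)) b ≠ timeInit (n + 1) γ := by
        intro b h
        apply hz
        rw [← Function.update_idem, h]
        simp [timeInit]
      have hz2 : z ≠ timeInit (n + 1) γ := by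
        have := hz1 (z (Sum.inl (Fin.last n)))
        simpa using this
      simp [hz, hz1, hz2]
  rw [prepTop, opsEval_append, ← mulVec_mulVec, Toffoli.ops_mulVec]
  simp only [opsEval_cons, opsEval_nil, Matrix.one_mul, ← mulVec_mulVec, h1]
  simp only [Toffoli.act]
  rw [Function.update_of_ne (by simp)]
  refine if_congr ?_ rfl rfl
  set δ := decide (x (Sum.inl (Fin.last n)) = decide (2 ^ n < M'))
  constructor
  · intro h
    have hg : x (Sum.inr (Fin.last (n + 1))) = γ := by
      have := congrFun h (Sum.inr (Fin.last (n + 1)))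
      simpa [timeInit, Fin.ext_iff] using this
    refine ⟨hg, ?_⟩
    funext w
    rcases w with i | i
    · have := congrFun h (Sum.inl i.castSucc)
      simpa [timeInit, timeEmb, Fin.ext_iff, i.2.ne] using this
    · have := congrFun h (Sum.inr i.castSucc)
      by_cases hi : i = Fin.last n
      · subst hi
        simpa [timeInit, timeEmb, Fin.ext_iff, hg] using this
      · have hi' : (i : ℕ) ≠ n := fun h => hi (Fin.ext h)
        simpa [timeInit, timeEmb, Fin.ext_iff, hi', i.2.ne] using this
  · rintro ⟨hg, h⟩
    funext w
    rcases w with i | i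
    · refine Fin.lastCases ?_ (fun i => ?_) i
      · simp [timeInit]
      · have := congrFun h (Sum.inl i)
        simpa [timeInit, timeEmb, Fin.ext_iff, i.2.ne] using this
    · refine Fin.lastCases ?_ (fun i => ?_) i
      · simpa [timeInit, Fin.ext_iff] using hg
      · have := congrFun h (Sum.inr i)
        by_cases hi : i = Fin.last n
        · subst hi
          have this : x (Sum.inr (Fin.last n).castSucc) = (decide (γ = p) && δ) := by
            simpa [timeInit, timeEmb, Fin.ext_iff] using this
          rw [Function.update_of_ne (by simp), Function.update_self, hg, this]
          simp [timeInit, Fin.ext_iff]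
        · have hi' : (i : ℕ) ≠ n := fun h => hi (Fin.ext h)
          simpa [timeInit, timeEmb, Fin.ext_iff, hi', i.2.ne] using this

/-- After the leading step the smaller register is in an initial state whose control wire is
determined by the leading bit, so amplitudes multiply along the recursion. -/
theorem prep_amplitude (O : OracleOp M na ns) (n M' : ℕ) (hM : 0 < M') (p γ : Bool)
    (x : Bits (TimeReg (n + 1))) :
    opsEval O (prep (n + 1) M' p) x (timeInit (n + 1) γ) =
      if x (Sum.inr (Fin.last (n + 1))) = γ then
        (Real.sqrt (topProb n M' (decide (γ = p)) (x (Sum.inl (Fin.last n)))) : ℂ) *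
        opsEval O (prep n (if 2 ^ n < M' then M' - 2 ^ n else M') true) (x ∘ timeEmb n)
          (timeInit n
            (decide (γ = p) && decide (x (Sum.inl (Fin.last n)) = decide (2 ^ n < M'))))
      else 0 := by
  have hl : ∀ r, setWires (timeEmb n) r x (Sum.inl (Fin.last n)) = x (Sum.inl (Fin.last n)) :=
    fun r => setWires_of_notMem _ _ _ (by simp [timeEmb, Fin.ext_iff, Fin.last]; omega)
  have hr : ∀ r, setWires (timeEmb n) r x (Sum.inr (Fin.last (n + 1))) =
      x (Sum.inr (Fin.last (n + 1))) :=
    fun r => setWires_of_notMem _ _ _ (by simp [timeEmb, Fin.ext_iff, Fin.last]; omega)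
  rw [apply_eq_mulVec_single (opsEval O (prep (n + 1) M' p)) x, prep, opsEval_append, ← mulVec_mulVec,
    opsEval_map, onWires_mulVec]
  simp only [prepTop_mulVec O n M' hM, setWires_comp, hl, hr]
  generalize (if 2 ^ n < M' then M' - 2 ^ n else M') = M''
  by_cases h : x (Sum.inr (Fin.last (n + 1))) = γ
  · rw [if_pos h, Finset.sum_eq_single (timeInit n
      (decide (γ = p) && decide (x (Sum.inl (Fin.last n)) = decide (2 ^ n < M'))))]
    · rw [if_pos ⟨h, rfl⟩, mul_comm]
    · intro r _ hr
      rw [if_neg fun h => hr h.2, mul_zero]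
    · simp
  · rw [if_neg h]
    refine Finset.sum_eq_zero fun r _ => ?_
    rw [if_neg fun h' => h h'.1, mul_zero]

/-- Only the distribution of the time index is ever needed: the auxiliary wires remain entangled
with it, but they enter later computations through squared amplitudes alone. The induction splits
the range at 2^n by the leading bit. -/
theorem prep_sum (O : OracleOp M na ns) (n M' : ℕ) (hM : 0 < M') (hn : M' ≤ 2 ^ n) (p γ : Bool)
    (f : ℕ → ℂ) :
    ∑ x, (‖opsEval O (prep n M' p) x (timeInit n γ)‖ ^ 2 : ℝ) * f (bitsVal fun i => x (Sum.inl i)) =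
      if γ = p then (1 / M' : ℂ) * ∑ m ∈ Finset.range M', f m
        else (1 / 2 ^ n : ℂ) * ∑ m ∈ Finset.range (2 ^ n), f m := by
  induction n generalizing M' p γ f with
  | zero =>
    obtain rfl : M' = 1 := by simp at hn; omega
    have (x : Bits (TimeReg 0)) : x = timeInit 0 (x (Sum.inr 0)) := by
      funext w
      rcases w with w | w
      · exact w.elim0
      · obtain rfl : w = 0 := Fin.fin_one_eq_zero w
        simp [timeInit]
    have h1 : ∀ x : Bits (TimeReg 0), (x = timeInit 0 γ) ↔ x (Sum.inr 0) = γ := by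
      intro x
      constructor
      · rintro rfl; simp [timeInit]
      · rintro rfl; exact this x
    rw [Finset.sum_eq_single (timeInit 0 γ)]
    · simp [prep, bitsVal]
    · intro x _ hx
      simp [prep, hx]
    · simp
  | succ n ih =>
    set M'' := if 2 ^ n < M' then M' - 2 ^ n else M' with hM''
    have hpos : 0 < M'' := by rw [hM'']; split_ifs <;> omega
    have hle : M'' ≤ 2 ^ n := by
      rw [pow_succ] at hn
      rw [hM'']; split_ifs <;> omega
    have key : ∑ x, (‖opsEval O (prep (n + 1) M' p) x (timeInit (n + 1) γ)‖ ^ 2 : ℝ) *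
        f (bitsVal fun i => x (Sum.inl i)) = ∑ b, (topProb n M' (decide (γ = p)) b : ℂ) *
        ∑ x, (‖opsEval O (prep n M'' true) x
          (timeInit n (decide (γ = p) && decide (b = decide (2 ^ n < M'))))‖ ^ 2 : ℝ) *
            f (bitsVal (fun i => x (Sum.inl i)) + if b then 2 ^ n else 0) := by
      rw [← (Equiv.sumArrowEquivProdArrow _ _ _).symm.sum_comp, Fintype.sum_prod_type,
        sum_bits_succ, Finset.sum_comm]
      refine Finset.sum_congr rfl fun b _ => ?_
      rw [← (Equiv.sumArrowEquivProdArrow _ _ _).symm.sum_comp, Fintype.sum_prod_type,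
        Finset.mul_sum]
      refine Finset.sum_congr rfl fun x _ => ?_
      rw [sum_bits_succ, Finset.mul_sum]
      refine Finset.sum_congr rfl fun y _ => ?_
      have hcomp : ∀ g : Bool, (Sum.elim (Fin.snoc x b : Bits (Fin (n + 1)))
          (Fin.snoc y g : Bits (Fin (n + 2)))) ∘ timeEmb n = Sum.elim x y := by
        intro g
        funext w
        rcases w with w | w <;> simp [timeEmb]
      simp only [Equiv.sumArrowEquivProdArrow, Equiv.coe_fn_symm_mk, prep_amplitude O n M' hM,
        Sum.elim_inl, Sum.elim_inr, hcomp]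
      rw [Finset.sum_eq_single γ]
      · have := topProb_nonneg n M' (decide (γ = p)) b
        simp only [Fin.snoc_last, if_true, norm_mul, mul_pow, Complex.norm_real, Real.norm_eq_abs,
          sq_abs, Real.sq_sqrt this, bitsVal_snoc, ← hM'']
        push_cast
        ring
      · intro g _ hg
        simp [hg]
      · simp
    rw [key]
    -- The leading bit shifts the argument of f, so the hypothesis is used for the shifted function.
    have ih' := fun γ (b : Bool) => ih M'' hpos hle true γ (fun m => f (m + if b then 2 ^ n else 0))
    simp only [ih']
    have hM' : (M' : ℂ) ≠ 0 := by exact_mod_cast hM.ne'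
    by_cases hγ : γ = p
    · by_cases hlt : 2 ^ n < M'
      · have hsplit : M' = 2 ^ n + (M' - 2 ^ n) := by omega
        have hne : ((M' - 2 ^ n : ℕ) : ℂ) ≠ 0 := by
          exact_mod_cast (by omega : M' - 2 ^ n ≠ 0)
        conv_rhs => rw [if_pos hγ, hsplit, Finset.sum_range_add, ← hsplit]
        have hmin : min ((2 : ℝ) ^ n) M' = 2 ^ n :=
          min_eq_left (by exact_mod_cast hlt.le)
        simp only [hγ, topProb, hlt, hM'', hmin]
        simp [add_comm (2 ^ n)]
        field_simp
        try ring
      · have hsub : M' - 2 ^ n = 0 := by omega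
        have hmin : min ((2 : ℝ) ^ n) M' = M' :=
          min_eq_right (by exact_mod_cast (not_lt.1 hlt))
        simp only [hγ, topProb, hlt, hM'', hmin, hsub]
        simp [hM']
    · have h2 : 2 ^ (n + 1) = 2 ^ n + 2 ^ n := by ring
      conv_rhs => rw [if_neg hγ, h2, Finset.sum_range_add]
      simp only [hγ, topProb]
      simp [add_comm (2 ^ n)]
      ring

end Preparation

/-! ## The clock -/

section Clock

variable {M na ns : ℕ}

/-- The preparation of the clock: as long as the wires are `1` (for the first wire: `pol`), the next
one is set to `1` with probability `p`. -/
def clock (p : ℝ) : (k : ℕ) → Bool → List (Op M na ns (Fin (k + 1)))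
  | 0, _ => []
  | k + 1, pol => ctrlGate pol (u := (0 : Fin (k + 2))) (t := 1) (by simp) (splitRot (1 - p) p) ::
      (clock p k true).map (Op.map (Fin.succEmb _))

theorem clock_countP (p : ℝ) (k : ℕ) (pol : Bool) :
    (clock p k pol : List (Op M na ns _)).countP (fun op => !op.isQuery) = k ∧
    (clock p k pol : List (Op M na ns _)).countP (fun op => op.isQuery) = 0 := by
  induction k generalizing pol with
  | zero => simp [clock]
  | succ k ih => simp [clock, List.countP_map, Function.comp_def, ih]

/-- The clock state with the first wire `γ` and the others `0`. -/
def clockInit (k : ℕ) (γ : Bool) : Bits (Fin (k + 1)) := Fin.cons γ fun _ => false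

theorem setWires_succ {k : ℕ} (r : Bits (Fin (k + 1))) (x : Bits (Fin (k + 2))) :
    setWires (Fin.succEmb (k + 1)) r x = Fin.cons (x 0) r := by
  funext i
  refine Fin.cases ?_ (fun i => ?_) i
  · exact setWires_of_notMem _ _ _ (by simp)
  · exact setWires_apply (Fin.succEmb (k + 1)) r x i

/-- The sum runs over the value b that the first gate gives to the wire 1. Later gates use this wire
only as a control, which afterwards leaves the single summand b = x 1. -/
theorem clock_amplitude_aux (O : OracleOp M na ns) {p : ℝ} (h0 : 0 ≤ p) (h1 : p ≤ 1) (k : ℕ)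
    (pol γ : Bool) (x : Bits (Fin (k + 2))) :
    opsEval O (clock p (k + 1) pol) x (clockInit (k + 1) γ) =
      ∑ b, if x 0 = γ then
        (if γ = pol then (Real.sqrt (if b then p else 1 - p) : ℂ)
          else if b = false then 1 else 0) *
        opsEval O (clock p k true) (Fin.tail x) (clockInit k b) else 0 := by
  have hne : (0 : Fin (k + 2)) ≠ 1 := by simp
  have hgate : ∀ z : Bits (Fin (k + 2)),
      ((ctrlGate (M := M) (na := na) (ns := ns) pol hne (splitRot (1 - p) p)).eval O *ᵥ
        Pi.single (clockInit (k + 1) γ) 1) z =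
      if z 0 = γ ∧ Fin.tail z = clockInit k (z 1) then
        (if γ = pol then (Real.sqrt (if z 1 then p else 1 - p) : ℂ)
          else if z 1 = false then 1 else 0) else 0 := by
    intro z
    have hiff : ∀ b, Function.update z 1 b = clockInit (k + 1) γ ↔
        b = false ∧ z 0 = γ ∧ Fin.tail z = clockInit k (z 1) := by
      intro b
      constructor
      · intro h
        refine ⟨by simpa [clockInit, Fin.cons_one] using congrFun h 1,
          by simpa [clockInit] using congrFun h 0, ?_⟩
        funext i
        refine Fin.cases ?_ (fun i => ?_) i
        · simp [Fin.tail, clockInit]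
        · have := congrFun h i.succ.succ
          rw [Function.update_of_ne (by simp [Fin.ext_iff])] at this
          simpa [clockInit, Fin.tail] using this
      · rintro ⟨rfl, h, h'⟩
        funext i
        refine Fin.cases ?_ (fun i => Fin.cases ?_ (fun i => ?_) i) i
        · simpa [clockInit] using h
        · simp [clockInit]
        · have := congrFun h' i.succ
          rw [Function.update_of_ne (by simp [Fin.ext_iff])]
          simpa [clockInit, Fin.tail] using this
    have hz := hiff (z 1)
    rw [Function.update_eq_self] at hz
    simp only [ctrlGate_mulVec, Pi.single_apply, hiff, hz]
    by_cases hc : z 0 = γ ∧ Fin.tail z = clockInit k (z 1)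
    · have hs := splitRot_false (a := 1 - p) (b := p) (by linarith) h0 (by ring)
      simp only [hc]
      simp [hs]
    · simp [hc]
  rw [apply_eq_mulVec_single (opsEval O (clock p (k + 1) pol)) x, clock, opsEval_cons,
    ← mulVec_mulVec, opsEval_map, onWires_mulVec]
  simp only [hgate, setWires_succ]
  have hcomp : x ∘ Fin.succEmb (k + 1) = Fin.tail x := rfl
  simp only [hcomp, Fin.cons_zero, Fin.tail_cons]
  by_cases hx : x 0 = γ
  · simp only [hx, true_and, if_true]
    symm
    refine Finset.sum_of_injOn (fun b => clockInit k b) ?_ (by simp) ?_ ?_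
    · intro b _ b' _ h
      simpa [clockInit] using congrFun h 0
    · intro r _ hr
      rw [if_neg, mul_zero]
      intro h
      exact hr ⟨_, by simp, h.symm⟩
    · intro b _
      have h1 : (Fin.cons γ (clockInit k b) : Bits (Fin (k + 2))) 1 = b := by
        simp [clockInit, Fin.cons_one]
      simp only [h1, if_true]
      rw [mul_comm]
  · simp [hx]

theorem clock_first (O : OracleOp M na ns) {p : ℝ} (h0 : 0 ≤ p) (h1 : p ≤ 1) (k : ℕ)
    (pol γ : Bool) (x : Bits (Fin (k + 1))) (hx : x 0 ≠ γ) :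
    opsEval O (clock p k pol) x (clockInit k γ) = 0 := by
  cases k with
  | zero =>
    have : x ≠ clockInit 0 γ := by rintro rfl; simp [clockInit] at hx
    simp [clock, this]
  | succ k =>
    rw [clock_amplitude_aux O h0 h1]
    simp [hx]

theorem clock_amplitude (O : OracleOp M na ns) {p : ℝ} (h0 : 0 ≤ p) (h1 : p ≤ 1) (k : ℕ)
    (pol γ : Bool) (x : Bits (Fin (k + 2))) :
    opsEval O (clock p (k + 1) pol) x (clockInit (k + 1) γ) =
      if x 0 = γ then
        (if γ = pol then (Real.sqrt (if x 1 then p else 1 - p) : ℂ)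
          else if x 1 = false then 1 else 0) *
        opsEval O (clock p k true) (Fin.tail x) (clockInit k (x 1)) else 0 := by
  rw [clock_amplitude_aux O h0 h1, Finset.sum_eq_single (x 1)]
  · intro b _ hb
    have : Fin.tail x 0 ≠ b := fun h => hb h.symm
    simp [clock_first O h0 h1 k true b _ this]
  · simp

/-- A wire in the state 0 stops the whole chain of controlled rotations. -/
theorem clock_false (O : OracleOp M na ns) {p : ℝ} (h0 : 0 ≤ p) (h1 : p ≤ 1) (k : ℕ)
    (x : Bits (Fin (k + 1))) :
    opsEval O (clock p k true) x (clockInit k false) = if x = clockInit k false then 1 else 0 := by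
  induction k with
  | zero => simp [clock, Matrix.one_apply]
  | succ k ih =>
    have hiff : x = clockInit (k + 1) false ↔
        x 0 = false ∧ x 1 = false ∧ Fin.tail x = clockInit k false := by
      constructor
      · rintro rfl
        refine ⟨rfl, rfl, ?_⟩
        funext i
        refine Fin.cases rfl (fun i => rfl) i
      · rintro ⟨h, -, h'⟩
        rw [← Fin.cons_self_tail x, h, h']
        funext i
        refine Fin.cases rfl (fun i => ?_) i
        refine Fin.cases rfl (fun i => rfl) i
    rw [clock_amplitude O h0 h1]
    rcases hx0 : x 0 <;> rcases hx1 : x 1 <;> simp [hiff, hx0, hx1, ih]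

theorem clock_sum_step (O : OracleOp M na ns) {p : ℝ} (h0 : 0 ≤ p) (h1 : p ≤ 1) (k : ℕ)
    (pol : Bool) (F : Bits (Fin (k + 2)) → ℂ) :
    ∑ x, (‖opsEval O (clock p (k + 1) pol) x (clockInit (k + 1) pol)‖ ^ 2 : ℝ) * F x =
      (1 - p) * F (Fin.cons pol (clockInit k false)) +
      p * ∑ y, (‖opsEval O (clock p k true) y (clockInit k true)‖ ^ 2 : ℝ) * F (Fin.cons pol y) := by
  rw [← (Fin.consEquiv fun _ : Fin (k + 2) => Bool).sum_comp, Fintype.sum_prod_type,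
    Finset.sum_eq_single pol]
  · have hstep : ∀ y : Bits (Fin (k + 1)),
        (‖opsEval O (clock p (k + 1) pol) (Fin.cons pol y) (clockInit (k + 1) pol)‖ ^ 2 : ℝ) =
        (if y = clockInit k false then 1 - p else 0) +
          p * ‖opsEval O (clock p k true) y (clockInit k true)‖ ^ 2 := by
      intro y
      rw [clock_amplitude O h0 h1]
      simp only [Fin.cons_zero, if_true, Fin.tail_cons, Fin.cons_one]
      rw [norm_mul, mul_pow, Complex.norm_real, Real.norm_eq_abs, sq_abs]
      rcases hy : y 0
      · rw [clock_first O h0 h1 k true true y (by simp [hy]), clock_false O h0 h1,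
          Real.sq_sqrt (by simpa using h1)]
        by_cases h : y = clockInit k false <;> simp [h]
      · have : y ≠ clockInit k false := by rintro rfl; simp [clockInit] at hy
        simp [this, Real.sq_sqrt h0]
    have hcons : ∀ y : Bits (Fin (k + 1)), ((‖opsEval O (clock p (k + 1) pol)
        ((Fin.consEquiv fun _ : Fin (k + 2) => Bool) (pol, y)) (clockInit (k + 1) pol)‖ ^ 2 : ℝ) : ℂ) *
          F ((Fin.consEquiv fun _ : Fin (k + 2) => Bool) (pol, y)) =
        (((if y = clockInit k false then 1 - p else 0) +
          p * ‖opsEval O (clock p k true) y (clockInit k true)‖ ^ 2 : ℝ) : ℂ) *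
            F (Fin.cons pol y) := by
      intro y
      rw [← hstep y]
      rfl
    rw [Finset.sum_congr rfl fun y _ => hcons y]
    push_cast
    simp only [add_mul, Finset.sum_add_distrib, Finset.mul_sum, mul_assoc]
    congr 1
    rw [Finset.sum_eq_single (clockInit k false)]
    · simp
    · intro y _ hy
      simp [hy]
    · simp
  · intro b _ hb
    refine Finset.sum_eq_zero fun y _ => ?_
    rw [clock_first O h0 h1]
    · simp
    · simpa [Fin.consEquiv] using hb
  · simp

/-- The clock state `1 ⋯ 1 0 ⋯ 0` with `j` ones. -/
def clockWord (k j : ℕ) : Bits (Fin k) := fun i => decide ((i : ℕ) < j)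

theorem clockInit_false (k : ℕ) : clockInit k false = clockWord (k + 1) 0 := by
  funext i
  refine Fin.cases ?_ (fun i => ?_) i <;> simp [clockInit, clockWord]

theorem cons_true_clockWord (k j : ℕ) :
    (Fin.cons true (clockWord k j) : Bits (Fin (k + 1))) = clockWord (k + 1) (j + 1) := by
  funext i
  refine Fin.cases ?_ (fun i => ?_) i <;> simp [clockWord]

/-- The number of ones follows a truncated geometric law. The full word has weight p^k without the
factor 1 - p, because no further rotation can stop the chain. -/
theorem clock_sum_true (O : OracleOp M na ns) {p : ℝ} (h0 : 0 ≤ p) (h1 : p ≤ 1) (k : ℕ)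
    (F : Bits (Fin (k + 1)) → ℂ) :
    ∑ x, (‖opsEval O (clock p k true) x (clockInit k true)‖ ^ 2 : ℝ) * F x =
      ∑ j ∈ Finset.range k, (1 - p) * p ^ j * F (clockWord _ (j + 1)) +
        p ^ k * F (clockWord _ (k + 1)) := by
  induction k with
  | zero =>
    rw [Finset.sum_eq_single (clockInit 0 true)]
    · have : clockInit 0 true = clockWord 1 1 := by
        funext i
        rw [Fin.fin_one_eq_zero i]
        rfl
      simp [clock, this]
    · intro x _ hx
      simp [clock, hx]
    · simp
  | succ k ih =>
    rw [clock_sum_step O h0 h1, ih (fun y => F (Fin.cons true y)), clockInit_false,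
      Finset.sum_range_succ']
    simp only [cons_true_clockWord, mul_add, Finset.mul_sum]
    ring_nf

/-- The wire 0 stays 0 and, with polarity `false`, is a control that is always satisfied. It is
there because primitive gates act on two wires. -/
theorem clock_sum (O : OracleOp M na ns) {p : ℝ} (h0 : 0 ≤ p) (h1 : p ≤ 1) (k : ℕ)
    (F : Bits (Fin (k + 1)) → ℂ) :
    ∑ x, (‖opsEval O (clock p k false) x (clockInit k false)‖ ^ 2 : ℝ) * F x =
      ∑ j ∈ Finset.range k, (1 - p) * p ^ j * F (Fin.cons false (clockWord _ j)) +
        p ^ k * F (Fin.cons false (clockWord _ k)) := by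
  cases k with
  | zero =>
    rw [Finset.sum_eq_single (clockInit 0 false)]
    · have : clockInit 0 false = Fin.cons false (clockWord 0 0) := by
        funext i
        rw [Fin.fin_one_eq_zero i]
        rfl
      simp [clock, this]
    · intro x _ hx
      simp [clock, hx]
    · simp
  | succ k =>
    rw [clock_sum_step O h0 h1, clock_sum_true O h0 h1 k (fun y => F (Fin.cons false y)),
      clockInit_false, Finset.sum_range_succ']
    simp only [mul_add, Finset.mul_sum]
    ring_nf

end Clock

/-! ## The wires of the simulation circuit -/

/-- The auxiliary wires: a clock in unary, two time registers, the ancillas of the oracle, a wire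
for a violated time order, and one wire for each test of the other wires. -/
inductive Aux (na n K : ℕ) : Type
  | clk (j : Fin (K + 2))
  | tm (s : Bool) (w : TimeReg n)
  | anc (i : Fin na)
  | bad
  | flag (j : Fin K)
  deriving DecidableEq

namespace Aux

variable {na n K : ℕ}

/-- The auxiliary wires as a sum of finite types. -/
def equivSum (na n K : ℕ) :
    Aux na n K ≃ Fin (K + 2) ⊕ (Bool × TimeReg n) ⊕ Fin na ⊕ Unit ⊕ Fin K where
  toFun
    | clk j => .inl j
    | tm s w => .inr (.inl (s, w))
    | anc i => .inr (.inr (.inl i))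
    | bad => .inr (.inr (.inr (.inl ())))
    | flag j => .inr (.inr (.inr (.inr j)))
  invFun
    | .inl j => clk j
    | .inr (.inl (s, w)) => tm s w
    | .inr (.inr (.inl i)) => anc i
    | .inr (.inr (.inr (.inl ()))) => bad
    | .inr (.inr (.inr (.inr j))) => flag j
  left_inv x := by cases x <;> rfl
  right_inv x := by rcases x with _ | ⟨_, _⟩ | _ | _ | _ <;> rfl

instance : Fintype (Aux na n K) := Fintype.ofEquiv _ (equivSum na n K).symm

theorem card_aux : Fintype.card (Aux na n K) = 2 * K + 4 * n + na + 5 := by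
  rw [Fintype.card_congr (equivSum na n K)]
  simp
  ring

end Aux

/-- All wires. -/
abbrev Wire (ns na n K : ℕ) : Type := Fin ns ⊕ Aux na n K

section Wires

variable {M ns na n K : ℕ}

/-- The clock. -/
def clkEmb : Fin (K + 2) ↪ Wire ns na n K := ⟨fun j => .inr (.clk j), fun _ _ h => by simpa using h⟩

/-- The time registers. -/
def tmEmb (s : Bool) : TimeReg n ↪ Wire ns na n K :=
  ⟨fun w => .inr (.tm s w), fun _ _ h => by simpa using h⟩

/-- The wires of a query to the oracle at the time in the register `s`. -/
def queryEmb (s : Bool) : OracleReg M na ns ↪ Wire ns na (Nat.clog 2 M) K where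
  toFun
    | .inl i => .inr (.tm s (.inl i))
    | .inr (.inl i) => .inr (.anc i)
    | .inr (.inr i) => .inl i
  inj' := by
    rintro (i | i | i) (j | j | j) h <;> simp_all

@[simp] theorem queryEmb_time (s : Bool) (i : Fin (Nat.clog 2 M)) :
    queryEmb (ns := ns) (na := na) (K := K) s (.inl i) = .inr (.tm s (.inl i)) := rfl

@[simp] theorem queryEmb_anc (s : Bool) (i : Fin na) :
    queryEmb (M := M) (ns := ns) (K := K) s (.inr (.inl i)) = .inr (.anc i) := rfl

@[simp] theorem queryEmb_sys (s : Bool) (i : Fin ns) :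
    queryEmb (M := M) (na := na) (K := K) s (.inr (.inr i)) = .inl i := rfl

/-- The wires of a controlled query. -/
def ctrlQueryEmb (s : Bool) (j : Fin (K + 2)) :
    Option (OracleReg M na ns) ↪ Wire ns na (Nat.clog 2 M) K where
  toFun
    | none => .inr (.clk j)
    | some w => queryEmb s w
  inj' := by
    rintro (_ | i | i | i) (_ | j | j | j) h <;> simp_all

/-- The time in the register `s`. -/
def timeVal (s : Bool) (x : Bits (Wire ns na n K)) : ℕ := bitsVal fun i => x (.inr (.tm s (.inl i)))

/-- The wires that have to be `0` in the test of the register `s`. -/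
def testWires (s : Bool) : Finset (Wire ns na n K) :=
  Finset.univ.map (tmEmb s) ∪
    (Finset.univ.image (fun i : Fin na => (.inr (.anc i) : Wire ns na n K)) ∪ {.inr .bad})

theorem forall_testWires (s : Bool) (x : Bits (Wire ns na n K)) :
    (∀ w ∈ testWires s, x w = false) ↔
      (x ∘ tmEmb s = fun _ => false) ∧ (∀ i, x (.inr (.anc i)) = false) ∧
        x (.inr .bad) = false := by
  constructor
  · intro h
    refine ⟨funext fun w => h _ ?_, fun i => h _ ?_, h _ ?_⟩ <;> simp [testWires]
  · rintro ⟨h1, h2, h3⟩ w hw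
    simp only [testWires, Finset.mem_union, Finset.mem_map, Finset.mem_univ, true_and,
      Finset.mem_image, Finset.mem_singleton] at hw
    rcases hw with ⟨w, rfl⟩ | ⟨i, rfl⟩ | rfl
    · exact congrFun h1 w
    · exact h2 i
    · exact h3

theorem card_testWires (s : Bool) :
    (testWires s : Finset (Wire ns na n K)).card ≤ 2 * n + na + 2 := by
  refine (Finset.card_union_le _ _).trans ?_
  have h1 := Finset.card_union_le
    (Finset.univ.image (fun i : Fin na => (.inr (.anc i) : Wire ns na n K))) {.inr .bad}
  have h2 := Finset.card_image_le (s := Finset.univ)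
    (f := fun i : Fin na => (.inr (.anc i) : Wire ns na n K))
  simp at h1 h2 ⊢
  omega

end Wires

/-! ## Tests of wires -/

section Tests

variable {M na ns r : ℕ} {L : Type} [Fintype L] [DecidableEq L]

/-- The program that tests whether all wires in `S` are `0`. -/
def zeroProg (S : Finset L) (hr : S.card < r) : List (Toffoli (L ⊕ Fin r)) :=
  andProg (S.toList.map fun w => (w, false)) false 0 (by simpa)

theorem run_zeroProg (S : Finset L) (hS : S.Nonempty) (hr : S.card < r) (x : Bits L) :
    run (zeroProg S hr) (Sum.elim x fun _ => false) (Sum.inr ⟨S.card, hr⟩) = true ↔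
      ∀ w ∈ S, x w = false := by
  have h := run_andProg_false (r := r) (S.toList.map fun w => (w, false))
    (by simpa using hS.ne_empty) (by simpa) x
  have hidx : (⟨(S.toList.map fun w => (w, false)).length, by simpa⟩ : Fin r) = ⟨S.card, hr⟩ := by
    simp
  rw [hidx] at h
  rw [zeroProg, h]
  simp

theorem zeroProg_length (S : Finset L) (hr : S.card < r) : (zeroProg S hr).length = S.card := by
  simp [zeroProg, andProg_length]

/-- Flip `t` unless all wires in `S` are `0`. -/
def testFlip (S : Finset L) (t : L) : QOp L := condFlip (fun x => !decide (∀ w ∈ S, x w = false)) t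

theorem implements_testFlip (S : Finset L) (hS : S.Nonempty) (hr : S.card < r) {t : L}
    (ht : t ∉ S) :
    Implements (Fin r) (10 * S.card + 1) 0 (fun _ : OracleOp M na ns => testFlip S t) := by
  have := implements_condFlip (M := M) (na := na) (ns := ns) (p := zeroProg S hr) (t := t)
    (out := ⟨S.card, hr⟩) (φ := fun x => !decide (∀ w ∈ S, x w = false))
    (andProg_avoids_inl _ _ _ _ (by
      intro a ha
      obtain ⟨w, hw, rfl⟩ := List.mem_map.1 ha
      rintro rfl
      exact ht (by simpa using hw))) false (fun x => by
        rw [← Bool.not_eq_true, run_zeroProg S hS hr]; simp)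
  rwa [zeroProg_length] at this

theorem implements_reflection (S : Finset L) (hS : S.Nonempty) (hr : S.card + 1 < r) {U : QOp L}
    (hU : ∀ Ψ x, (U *ᵥ Ψ) x = if ∀ w ∈ S, x w = false then - Ψ x else Ψ x) :
    Implements (Fin r) (10 * S.card + 1) 0 (fun _ : OracleOp M na ns => U) := by
  have hr' : S.card < r := by omega
  have := implements_condSign (M := M) (na := na) (ns := ns) (p := zeroProg S hr')
    (out := ⟨S.card, hr'⟩) (r := ⟨S.card + 1, hr⟩) (by simp)
    (φ := fun x => ∀ w ∈ S, x w = false)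
    (andProg_avoids_inr _ _ _ _ (by simp)) true (fun x => by rw [run_zeroProg S hS hr']) hU
  rwa [zeroProg_length] at this

/-- The condition on the times in two registers that is violated if `c` is `1` and the time on the
wires `a` is not smaller than the time on the wires `b`. -/
def orderViolated {n : ℕ} (a b : Fin n → L) (c : L) (x : Bits L) : Bool :=
  x c && !decide (bitsVal (fun i => x (a i)) < bitsVal (fun i => x (b i)))

theorem implements_orderFlip {n : ℕ} (hr : n + 1 < r) (a b : Fin n → L) (c t : L)
    (hab : ∀ i, a i ≠ b i) (hat : ∀ i, a i ≠ t) (hbt : ∀ i, b i ≠ t) (hct : c ≠ t) :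
    Implements (Fin r) (30 * n + 11) 0
      (fun _ : OracleOp M na ns => condFlip (orderViolated a b c) t) := by
  -- The last gate combines the wire c with the negated comparison.
  let T : Toffoli (L ⊕ Fin r) :=
    { u := Sum.inl c
      v := Sum.inr ⟨n, by omega⟩
      t := Sum.inr ⟨n + 1, hr⟩
      pu := true
      pv := false
      huv := by simp
      hut := by simp
      hvt := by simp }
  have hlen : (ltProg n (by omega : n < r) a b hab ++ [T]).length = 3 * n + 1 := by
    simp [ltProg_length]
  have := implements_condFlip (M := M) (na := na) (ns := ns)
    (p := ltProg n (by omega : n < r) a b hab ++ [T]) (t := t)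
    (out := ⟨n + 1, hr⟩) (φ := orderViolated a b c) (by
      intro T' hT'
      rcases List.mem_append.1 hT' with h | h
      · exact ltProg_avoids_inl n _ a b hab hat hbt T' h
      · obtain rfl := List.mem_singleton.1 h
        simp [T, hct]) true (fun x => by
      obtain ⟨h1, h2, h3⟩ := run_ltProg n (by omega : n < r) a b hab x
      rw [run_append]
      simp only [run, Toffoli.act, T, Function.update_self, h1, h2 ⟨n + 1, hr⟩ (by simp)]
      rw [orderViolated]
      simp only [Bool.false_xor, Bool.and_eq_true, Bool.not_eq_true', decide_eq_true_eq,
        decide_eq_false_iff_not]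
      rw [← h3]
      simp)
  rw [hlen] at this
  exact this.mono (by omega) le_rfl

end Tests

/-! ## The state of the simulation circuit -/

section States

variable {M ns na n K : ℕ}

/-- No test has failed. -/
def Passed (x : Bits (Wire ns na n K)) : Prop := ∀ i, x (.inr (.flag i)) = false

/-- The product of the amplitudes of the clock and of the time registers. -/
def prodAmp (κ : Bits (Fin (K + 2)) → ℂ) (u : Bits (TimeReg n) → ℂ) (s : Bool)
    (x : Bits (Wire ns na n K)) : ℂ :=
  κ (x ∘ clkEmb) * (u (x ∘ tmEmb s) * u (x ∘ tmEmb !s))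

/-- On the branch where all tests have been passed and the ancillas are `0`, the state is the
product of the amplitudes of the clock and of the time registers and of a system state `F` that
depends on the clock and on the time in the register `s`; the tests from the `j`-th on have not
been made. -/
structure Tracks (κ : Bits (Fin (K + 2)) → ℂ) (u : Bits (TimeReg n) → ℂ)
    (F : Bits (Fin (K + 2)) → ℕ → Bits (Fin ns) → ℂ) (s : Bool) (j : ℕ)
    (Ψ : Bits (Wire ns na n K) → ℂ) : Prop where
  unused : ∀ (x : Bits (Wire ns na n K)) (i : Fin K), j ≤ i → x (.inr (.flag i)) = true → Ψ x = 0
  bad : ∀ x, Passed x → x (.inr .bad) = true → Ψ x = 0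
  val : ∀ x, Passed x → x (.inr .bad) = false → (∀ i, x (.inr (.anc i)) = false) →
    Ψ x = prodAmp κ u s x * F (x ∘ clkEmb) (timeVal s x) (x ∘ Sum.inl)

/-- As `Tracks`, and the ancillas are `0` if all tests have been passed. -/
structure TracksClean (κ : Bits (Fin (K + 2)) → ℂ) (u : Bits (TimeReg n) → ℂ)
    (F : Bits (Fin (K + 2)) → ℕ → Bits (Fin ns) → ℂ) (s : Bool) (j : ℕ)
    (Ψ : Bits (Wire ns na n K) → ℂ) : Prop extends Tracks κ u F s j Ψ where
  anc : ∀ x, Passed x → ∀ i, x (.inr (.anc i)) = true → Ψ x = 0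

end States

/-! ### Queries -/

section Query

variable {M ns na K : ℕ}

theorem onWires_controlled_mulVec {R W : Type} [Fintype R] [DecidableEq R] [Fintype W]
    [DecidableEq W] (e : Option R ↪ W) (A : QOp R) (Ψ : Bits W → ℂ) (x : Bits W) :
    (onWires e (controlled A) *ᵥ Ψ) x =
      if x (e none) then (onWires (Function.Embedding.some.trans e) A *ᵥ Ψ) x else Ψ x := by
  rw [onWires_mulVec, ← (Equiv.piOptionEquivProd (β := fun _ => Bool)).symm.sum_comp,
    Fintype.sum_prod_type, Finset.sum_eq_single (x (e none))]
  · have hset : ∀ r : Bits R, setWires e ((Equiv.piOptionEquivProd (β := fun _ => Bool)).symm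
        (x (e none), r)) x = setWires (Function.Embedding.some.trans e) r x := by
      intro r
      funext w
      by_cases h : w ∈ Set.range e
      · obtain ⟨i, rfl⟩ := h
        rw [setWires_apply]
        rcases i with _ | i
        · rw [setWires_of_ne]
          · rfl
          · intro i h
            simpa using e.injective h
        · exact (setWires_apply (Function.Embedding.some.trans e) r x i).symm
      · rw [setWires_of_notMem _ _ _ h, setWires_of_notMem]
        rintro ⟨i, hi⟩
        exact h ⟨_, hi⟩
    have hcomp : ∀ r : Bits R, ((Equiv.piOptionEquivProd (β := fun _ => Bool)).symm
        (x (e none), r)) ∘ some = r := fun r => rfl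
    have hnone : ∀ r : Bits R, ((Equiv.piOptionEquivProd (β := fun _ => Bool)).symm
        (x (e none), r)) none = x (e none) := fun r => rfl
    simp only [hset, controlled, hcomp, hnone, Function.comp_apply, if_true]
    split_ifs with h
    · rw [onWires_mulVec]
      rfl
    · rw [Finset.sum_eq_single ((x ∘ e) ∘ some)]
      · have : setWires (Function.Embedding.some.trans e) ((x ∘ e) ∘ some) x = x :=
          setWires_comp_self (Function.Embedding.some.trans e) x
        rw [this]
        simp
      · intro r _ hr
        simp [hr.symm]
      · simp
  · intro b _ hb
    refine Finset.sum_eq_zero fun r _ => ?_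
    have hnone : ((Equiv.piOptionEquivProd (β := fun _ => Bool)).symm
        (b, r)) none = b := rfl
    simp [controlled, hnone, hb.symm]
  · simp

/-- A controlled query at the time in the register `s`, with the phase `-i`. -/
def queryOp (O : OracleOp M na ns) (s : Bool) (j : Fin (K + 2)) :
    QOp (Wire ns na (Nat.clog 2 M) K) :=
  -- The phase is a scalar on its target, so `bad` is merely the second wire of the gate.
  (ctrlGate (M := M) (na := na) (ns := ns) true (u := .inr (.clk j)) (t := .inr .bad) (by simp)
    (phase (-Complex.I) (by simp))).eval O *
  (Op.ctrlQuery (ctrlQueryEmb s j) false).eval O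

/-- The operator by which a query acts at the time index `m`. -/
def stepGen (H : ℝ → QOp (Fin ns)) (M : ℕ) (t α : ℝ) (m : ℕ) : QOp (Fin ns) :=
  (-Complex.I / α) • H (m * t / M)

theorem toQubits_apply_of_lt (O : OracleOp M na ns) {x : Bits (OracleReg M na ns)}
    (hx : bitsVal (fun i => x (.inl i)) < M) (y : Bits (OracleReg M na ns)) :
    O.toQubits x y = if hy : bitsVal (fun i => y (.inl i)) < M then
        O (⟨_, hx⟩, fun i => x (.inr (.inl i)), fun i => x (.inr (.inr i)))
          (⟨_, hy⟩, fun i => y (.inr (.inl i)), fun i => y (.inr (.inr i))) else 0 := by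
  rw [OracleOp.toQubits, dif_pos hx]

theorem toQubits_mulVec_of_not_lt (O : OracleOp M na ns) {x : Bits (OracleReg M na ns)}
    (hx : ¬ bitsVal (fun i => x (.inl i)) < M) (Φ : Bits (OracleReg M na ns) → ℂ) :
    ∑ y, O.toQubits x y * Φ y = Φ x := by
  simp [OracleOp.toQubits, hx]

/-- If the ancillas are 0 before the query, the component with ancillas 0 afterwards is given by the
encoded block. The other components are not controlled, so the conclusion is only `Tracks`; the next
test removes them from the branch that matters. -/
theorem TracksClean.query {O : OracleOp M na ns} {H : ℝ → QOp (Fin ns)} {t α : ℝ}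
    (hO : IsHamT O H t α) {κ : Bits (Fin (K + 2)) → ℂ}
    {u : Bits (TimeReg (Nat.clog 2 M)) → ℂ}
    (hu : ∀ z, M ≤ bitsVal (fun i => z (.inl i)) → u z = 0)
    {F : Bits (Fin (K + 2)) → ℕ → Bits (Fin ns) → ℂ} {s : Bool} {j : ℕ}
    {Ψ : Bits (Wire ns na (Nat.clog 2 M) K) → ℂ} (h : TracksClean κ u F s j Ψ)
    (i : Fin (K + 2)) :
    Tracks κ u (fun c m => if c i then stepGen H M t α m *ᵥ F c m else F c m) s j
      (queryOp O s i *ᵥ Ψ) := by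
  have hsome : Function.Embedding.some.trans (ctrlQueryEmb (M := M) (ns := ns) (na := na) s i) =
      queryEmb s := rfl
  have hform : ∀ x, (queryOp O s i *ᵥ Ψ) x = if x (.inr (.clk i)) then
      -Complex.I * ∑ r, O.toQubits (x ∘ queryEmb s) r * Ψ (setWires (queryEmb s) r x) else Ψ x := by
    intro x
    rw [queryOp, ← mulVec_mulVec, ctrlGate_phase_mulVec]
    simp only [Op.eval, Bool.false_eq_true, if_false]
    rw [onWires_controlled_mulVec, hsome, onWires_mulVec]
    have : ctrlQueryEmb (M := M) (ns := ns) (na := na) s i none = .inr (.clk i) := rfl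
    rw [this]
    split_ifs <;> rfl
  have hflag : ∀ r x (k : Fin K), setWires (queryEmb (M := M) (ns := ns) (na := na) s) r x
      (.inr (.flag k)) = x (.inr (.flag k)) := by
    intro r x k
    refine setWires_of_ne _ _ _ ?_
    rintro (i | i | i) <;> simp
  have hbad : ∀ r x, setWires (queryEmb (M := M) (ns := ns) (na := na) (K := K) s) r x
      (.inr .bad) = x (.inr .bad) := by
    intro r x
    refine setWires_of_ne _ _ _ ?_
    rintro (i | i | i) <;> simp
  have hpass : ∀ r x, Passed x → Passed (setWires (queryEmb (M := M) (ns := ns) (na := na)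
      (K := K) s) r x) := fun r x hx k => by rw [hflag, hx k]
  refine ⟨fun x k hk hx => ?_, fun x hx hb => ?_, fun x hx hb ha => ?_⟩
  · have h0 : ∀ r, Ψ (setWires (queryEmb s) r x) = 0 :=
      fun r => h.unused _ k hk (by rw [hflag, hx])
    rw [hform, h.unused x k hk hx]
    simp [h0]
  · have h0 : ∀ r, Ψ (setWires (queryEmb s) r x) = 0 :=
      fun r => h.bad _ (hpass _ x hx) (by rw [hbad, hb])
    rw [hform, h.bad x hx hb]
    simp [h0]
  · rw [hform, h.val x hx hb ha]
    have hcl : (x ∘ clkEmb) i = x (.inr (.clk i)) := rfl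
    rw [hcl]
    by_cases hc : x (.inr (.clk i)) = true
    swap
    · simp [hc]
    simp only [hc, if_true]
    have htv : bitsVal (fun k => (x ∘ queryEmb s) (.inl k)) = timeVal s x := rfl
    by_cases hm : timeVal s x < M
    swap
    -- Where the time index is not below M the oracle is the identity, but the prepared register has
    -- no amplitude there.
    · have hu0 : u (x ∘ tmEmb s) = 0 := hu _ (not_lt.1 hm)
      rw [toQubits_mulVec_of_not_lt _ (by rwa [htv]) (fun r => Ψ (setWires (queryEmb s) r x)),
        setWires_comp_self, h.val x hx hb ha]
      simp [prodAmp, hu0]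
    · let e : Bits (Fin ns) → Bits (OracleReg M na ns) := fun y =>
        Sum.elim (fun k => x (.inr (.tm s (.inl k)))) (Sum.elim (fun _ => false) y)
      -- Only words with the same time index and ancillas 0 contribute: a different index has block
      -- entry 0 (or lies outside the range of the oracle), and nonzero ancillas have amplitude 0 in
      -- Ψ.
      have hsum : ∑ r, O.toQubits (x ∘ queryEmb s) r * Ψ (setWires (queryEmb s) r x) =
          ∑ y, O.toQubits (x ∘ queryEmb s) (e y) * Ψ (setWires (queryEmb s) (e y) x) := by
        symm
        refine Finset.sum_of_injOn e ?_ (by simp) ?_ (fun _ _ => rfl)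
        · intro y _ y' _ hy
          funext k
          exact congrFun hy (.inr (.inr k))
        · intro r _ hr
          by_cases hanc : ∀ k, r (.inr (.inl k)) = false
          · rw [toQubits_apply_of_lt O (by rwa [htv])]
            split_ifs with hlt
            · have e1 : (fun k => (x ∘ queryEmb s) (.inr (.inl k))) = fun _ => false :=
                funext fun k => ha k
              have e2 : (fun k => r (.inr (.inl k))) = fun _ => false := funext hanc
              rw [e1, e2, hO.block, if_neg, zero_mul]
              intro heq
              have heq := bitsVal_injective (Fin.mk.inj heq)
              refine hr ⟨fun k => r (.inr (.inr k)), by simp, ?_⟩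
              funext w
              rcases w with w | w | w
              · exact congrFun heq w
              · exact (hanc w).symm
              · rfl
            · rw [zero_mul]
          · push Not at hanc
            obtain ⟨k, hk⟩ := hanc
            rw [h.anc _ (hpass _ x hx) k, mul_zero]
            have := setWires_apply (queryEmb (M := M) (ns := ns) (na := na) (K := K) s) r x
              (.inr (.inl k))
            rw [queryEmb_anc] at this
            rw [this]
            simpa using hk
      have hset : ∀ y, setWires (queryEmb s) (e y) x ∘ Sum.inl = y := by
        intro y
        funext k
        exact setWires_apply (queryEmb (M := M) (ns := ns) (na := na) (K := K) s) (e y) x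
          (.inr (.inr k))
      have hset' : ∀ y w, setWires (queryEmb s) (e y) x (.inr w) = x (.inr w) := by
        intro y w
        by_cases hw : (.inr w) ∈ Set.range (queryEmb (M := M) (ns := ns) (na := na) (K := K) s)
        · obtain ⟨r, hr⟩ := hw
          rw [← hr, setWires_apply]
          rcases r with r | r | r
          · rfl
          · exact (ha r).symm
          · simp at hr
        · exact setWires_of_notMem _ _ _ hw
      have hterm : ∀ y, O.toQubits (x ∘ queryEmb s) (e y) * Ψ (setWires (queryEmb s) (e y) x) =
          H ((timeVal s x : ℕ) * t / M) (x ∘ Sum.inl) y / α *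
            (prodAmp κ u s x * F (x ∘ clkEmb) (timeVal s x) y) := by
        intro y
        have e1 : (fun k => (x ∘ queryEmb s) (.inr (.inl k))) = fun _ => false :=
          funext fun k => ha k
        have htv' : bitsVal (fun k => e y (.inl k)) = timeVal s x := rfl
        rw [toQubits_apply_of_lt O (by rwa [htv]), dif_pos (by rwa [htv']), e1]
        have e2 : (fun k => e y (.inr (.inl k))) = fun _ => false := rfl
        rw [e2, hO.block, if_pos (Fin.ext (htv.trans htv'.symm))]
        rw [h.val _ (hpass _ x hx) (by rw [hset', hb]) (fun k => by rw [hset', ha])]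
        rw [hset]
        have e6 : ∀ s', setWires (queryEmb s) (e y) x ∘ tmEmb s' = x ∘ tmEmb s' := by
          intro s'
          funext w
          exact hset' _ _
        have e5 : setWires (queryEmb s) (e y) x ∘ clkEmb = x ∘ clkEmb := by
          funext w
          exact hset' _ _
        have e3 : prodAmp κ u s (setWires (queryEmb s) (e y) x) = prodAmp κ u s x := by
          simp only [prodAmp, e5, e6]
        have e4 : timeVal s (setWires (queryEmb s) (e y) x) = timeVal s x := by
          unfold timeVal
          congr 1
          funext w
          exact hset' _ _
        rw [e3, e4, e5]
        rfl
      rw [hsum]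
      simp only [hterm]
      simp only [mulVec, dotProduct, Finset.mul_sum]
      refine Finset.sum_congr rfl fun y _ => ?_
      have hgen : stepGen H M t α (timeVal s x) (x ∘ Sum.inl) y =
          -Complex.I / α * H ((timeVal s x : ℕ) * t / M) (x ∘ Sum.inl) y := rfl
      rw [hgen]
      ring

end Query

/-! ### Tests -/

section Test

variable {M ns na n K : ℕ}

/-- The flip that records a violated time order. -/
def orderOp (s : Bool) (i : Fin (K + 2)) : QOp (Wire ns na n K) :=
  condFlip (orderViolated (fun k => .inr (.tm s (.inl k))) (fun k => .inr (.tm (!s) (.inl k)))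
    (.inr (.clk i))) (.inr .bad)

/-- The test of the time order, of the ancillas and of the register `s`, which is prepared by `P`. -/
def testOp (P : QOp (TimeReg n)) (s : Bool) (i : Fin (K + 2)) (j : Fin K) :
    QOp (Wire ns na n K) :=
  onWires (tmEmb s) P * (testFlip (testWires s) (.inr (.flag j)) *
    (onWires (tmEmb s) Pᴴ * orderOp s i))

/-- On the branch without failure the test sandwiches the state between the prepared register state
u and its adjoint. The overlap with u weights the older times by |u|², which is their average; the
order flip has moved the pairs violating the order to `bad`, so they contribute 0. The register is
left freshly prepared, and the register `!s` now carries the current time. -/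
theorem Tracks.test {κ : Bits (Fin (K + 2)) → ℂ} {P : QOp (TimeReg n)}
    (hu : ∀ f : ℕ → ℂ, ∑ z, (‖P z fun _ => false‖ ^ 2 : ℝ) * f (bitsVal fun i => z (.inl i)) =
      (1 / M : ℂ) * ∑ m ∈ Finset.range M, f m)
    {F : Bits (Fin (K + 2)) → ℕ → Bits (Fin ns) → ℂ} {s : Bool} {j : Fin K}
    {Ψ : Bits (Wire ns na n K) → ℂ}
    (h : Tracks κ (fun z => P z fun _ => false) F s j Ψ) (i : Fin (K + 2)) :
    TracksClean κ (fun z => P z fun _ => false)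
      (fun c m => (1 / M : ℂ) • ∑ m' ∈ Finset.range M, if c i && !decide (m' < m) then 0 else F c m')
      (!s) (j + 1) (testOp P s i j *ᵥ Ψ) := by
  set u : Bits (TimeReg n) → ℂ := fun z => P z fun _ => false with hu_def
  set Φ₁ := orderOp (ns := ns) (na := na) s i *ᵥ Ψ with hΦ₁
  set Φ₂ := onWires (tmEmb s) Pᴴ *ᵥ Φ₁ with hΦ₂
  set Φ₃ := testFlip (testWires s) (.inr (.flag j)) *ᵥ Φ₂ with hΦ₃
  have hΦ₄ : testOp P s i j *ᵥ Ψ = onWires (tmEmb s) P *ᵥ Φ₃ := by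
    simp only [testOp, ← mulVec_mulVec, hΦ₁, hΦ₂, hΦ₃]
  have hset : ∀ a (x : Bits (Wire ns na n K)) w, (∀ v, w ≠ .inr (.tm s v)) →
      setWires (tmEmb s) a x w = x w :=
    fun a x w hw => setWires_of_ne _ _ _ fun v hv => hw v hv.symm
  have h1 : ∀ x (k : Fin K), j ≤ k → x (.inr (.flag k)) = true → Φ₁ x = 0 := by
    intro x k hk hx
    rw [hΦ₁, orderOp, condFlip_mulVec]
    refine h.unused _ k hk ?_
    split_ifs
    · rw [Function.update_of_ne (by simp), hx]
    · exact hx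
  have h2 : ∀ x (k : Fin K), j ≤ k → x (.inr (.flag k)) = true → Φ₂ x = 0 := by
    intro x k hk hx
    rw [hΦ₂, onWires_mulVec]
    refine Finset.sum_eq_zero fun a _ => ?_
    rw [h1 _ k hk (by rw [hset _ _ _ (by simp), hx]), mul_zero]
  have h3 : ∀ x, Passed x → Φ₃ x = if ∀ w ∈ testWires s, x w = false then Φ₂ x else 0 := by
    intro x hx
    rw [hΦ₃, testFlip, condFlip_mulVec]
    by_cases hw : ∀ w ∈ testWires s, x w = false
    · rw [if_neg (by simpa only [Bool.not_eq_true', decide_eq_false_iff_not, not_not] using hw),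
        if_pos hw]
    · rw [if_pos (by simpa only [Bool.not_eq_true', decide_eq_false_iff_not] using hw), if_neg hw]
      -- If the test fails, flag j is flipped. A component with flag 0 would then come from flag 1,
      -- which has amplitude 0 since this flag is unused so far.
      exact h2 _ j le_rfl (by simp [hx j])
  have hpass : ∀ a x, Passed x → Passed (setWires (tmEmb (ns := ns) (na := na) (K := K) s) a x) :=
    fun a x hx k => by rw [hset _ _ _ (by simp), hx k]
  have h4 : ∀ x, Passed x → (testOp P s i j *ᵥ Ψ) x =
      if (∀ k, x (.inr (.anc k)) = false) ∧ x (.inr .bad) = false then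
        u (x ∘ tmEmb s) * Φ₂ (setWires (tmEmb s) (fun _ => false) x) else 0 := by
    intro x hx
    rw [hΦ₄, onWires_mulVec, Finset.sum_eq_single (fun _ => false)]
    · rw [h3 _ (hpass _ x hx)]
      simp only [forall_testWires, setWires_comp, true_and, ne_eq, reduceCtorEq, not_false_iff,
        implies_true, hset, Sum.inr.injEq]
      split_ifs
      · rfl
      · rw [mul_zero]
    · intro a _ ha
      rw [h3 _ (hpass _ x hx), if_neg, mul_zero]
      rw [forall_testWires, setWires_comp]
      exact fun h => ha h.1
    · simp
  refine ⟨⟨fun x k hk hx => ?_, fun x hx hb => ?_, fun x hx hb ha => ?_⟩, fun x hx k hk => ?_⟩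
  · rw [hΦ₄, onWires_mulVec]
    refine Finset.sum_eq_zero fun a _ => ?_
    rw [hΦ₃, testFlip, condFlip_mulVec, h2 _ k (by omega), mul_zero]
    have hkj : k ≠ j := by rintro rfl; omega
    split_ifs
    · rw [Function.update_of_ne (by simpa using hkj), hset _ _ _ (by simp), hx]
    · rw [hset _ _ _ (by simp), hx]
  · rw [h4 x hx, if_neg]
    simp [hb]
  · rw [h4 x hx, if_pos ⟨ha, hb⟩, hΦ₂, onWires_mulVec]
    have hterm : ∀ a, Pᴴ (setWires (tmEmb s) (fun _ => false) x ∘ tmEmb s) a *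
        Φ₁ (setWires (tmEmb s) a (setWires (tmEmb s) (fun _ => false) x)) =
        κ (x ∘ clkEmb) * u (x ∘ tmEmb !s) * ((‖u a‖ ^ 2 : ℝ) *
          (fun m' => if x (.inr (.clk i)) && !decide (m' < timeVal (!s) x) then 0
            else F (x ∘ clkEmb) m' (x ∘ Sum.inl)) (bitsVal fun i => a (.inl i))) := by
      intro a
      rw [setWires_setWires, setWires_comp, hΦ₁, orderOp, condFlip_mulVec]
      have e1 : bitsVal (fun k => setWires (tmEmb s) a x (.inr (.tm s (.inl k)))) =
          bitsVal fun i => a (.inl i) := by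
        congr 1
        funext k
        exact setWires_apply (tmEmb s) a x (.inl k)
      have e2 : bitsVal (fun k => setWires (tmEmb s) a x (.inr (.tm (!s) (.inl k)))) =
          timeVal (!s) x := by
        unfold timeVal
        congr 1
        funext k
        exact hset _ _ _ (by simp)
      have e3 : setWires (tmEmb s) a x (.inr (.clk i)) = x (.inr (.clk i)) := hset _ _ _ (by simp)
      have e4 : setWires (tmEmb s) a x (.inr .bad) = false := by rw [hset _ _ _ (by simp), hb]
      simp only [orderViolated, e1, e2, e3]
      by_cases hv : (x (.inr (.clk i)) && !decide ((bitsVal fun i => a (.inl i)) < timeVal (!s) x))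
          = true
      -- For a violated order the flip makes the value 0 of `bad` come from the value 1, where the
      -- amplitude vanishes.
      · rw [if_pos hv, if_pos hv, h.bad]
        · simp
        · intro k
          rw [Function.update_of_ne (by simp)]
          exact hpass _ x hx k
        · simp [e4]
      · rw [if_neg hv, if_neg hv, h.val _ (hpass _ x hx) e4
          (fun k => by rw [hset _ _ _ (by simp), ha])]
        have e5 : setWires (tmEmb s) a x ∘ clkEmb = x ∘ clkEmb :=
          funext fun k => hset a x (.inr (.clk k)) (by simp)
        have e6 : setWires (tmEmb s) a x ∘ tmEmb (!s) = x ∘ tmEmb (!s) :=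
          funext fun k => hset a x (.inr (.tm (!s) k)) (by simp)
        have e7 : setWires (tmEmb s) a x ∘ Sum.inl = x ∘ Sum.inl := by
          funext k
          exact hset _ _ _ (by simp)
        have e8 : timeVal s (setWires (tmEmb s) a x) = bitsVal fun i => a (.inl i) := e1
        rw [prodAmp, e5, e6, e7, e8, setWires_comp]
        have e9 : ((‖u a‖ ^ 2 : ℝ) : ℂ) = star (u a) * u a := by
          rw [Complex.ofReal_pow, ← Complex.conj_mul']
          rfl
        rw [e9]
        simp only [conjTranspose_apply, hu_def]
        ring
    simp only [hterm, ← Finset.mul_sum]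
    rw [hu (fun m' => if x (.inr (.clk i)) && !decide (m' < timeVal (!s) x) then 0
            else F (x ∘ clkEmb) m' (x ∘ Sum.inl))]
    have e10 : (x ∘ clkEmb) i = x (.inr (.clk i)) := rfl
    simp only [prodAmp, Bool.not_not, e10, Pi.smul_apply, Finset.sum_apply, smul_eq_mul]
    have e11 : ∀ m', (if x (.inr (.clk i)) && !decide (m' < timeVal (!s) x) then 0
            else F (x ∘ clkEmb) m') (x ∘ Sum.inl) =
        if x (.inr (.clk i)) && !decide (m' < timeVal (!s) x) then 0
            else F (x ∘ clkEmb) m' (x ∘ Sum.inl) := by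
      intro m'
      split_ifs <;> rfl
    simp only [e11]
    ring
  · rw [h4 x hx, if_neg]
    intro h'
    simp [h'.1 k] at hk

end Test

/-! ## The circuit that encodes the truncated series -/

section OrderedSums

/-- The sum of `g m_k ⋯ g m_1` over `m_1 < ⋯ < m_k < m`. -/
def orderedSum {A : Type*} [Semiring A] (g : ℕ → A) : ℕ → ℕ → A
  | 0, _ => 1
  | k + 1, m => ∑ m' ∈ Finset.range m, g m' * orderedSum g k m'

theorem orderedSum_smul {A : Type*} [Ring A] [Algebra ℂ A] (c : ℂ) (g : ℕ → A) (k m : ℕ) :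
    orderedSum (fun m => c • g m) k m = c ^ k • orderedSum g k m := by
  induction k generalizing m with
  | zero => simp [orderedSum]
  | succ k ih =>
    simp only [orderedSum, Finset.smul_sum, ih, smul_mul_smul_comm, pow_succ']

variable {ns : ℕ}

/-- The system state after `j + 1` queries, of which those with `w` are performed, if the last of
them is made at the time `m`. -/
def queryState (g : ℕ → QOp (Fin ns)) (M : ℕ) (w : ℕ → Bool) (ψ : Bits (Fin ns) → ℂ) :
    ℕ → ℕ → Bits (Fin ns) → ℂ
  | 0, m => if w 1 then g m *ᵥ ψ else ψ
  | j + 1, m =>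
    if w (j + 2) then g m *ᵥ ((1 / M : ℂ) • ∑ m' ∈ Finset.range M,
        if w (j + 2) && !decide (m' < m) then 0 else queryState g M w ψ j m')
      else (1 / M : ℂ) • ∑ m' ∈ Finset.range M,
        if w (j + 2) && !decide (m' < m) then 0 else queryState g M w ψ j m'

theorem avg_const {E : Type*} [AddCommGroup E] [Module ℂ E] {M : ℕ} (hM : 0 < M) (v : E) :
    (1 / M : ℂ) • ∑ _m ∈ Finset.range M, v = v := by
  have : (M : ℂ) ≠ 0 := by exact_mod_cast hM.ne'
  rw [Finset.sum_const, Finset.card_range, ← Nat.cast_smul_eq_nsmul ℂ, smul_smul]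
  simp [this]

/-- While queries are performed, the order test cuts each average down to m' < m, which is the
recursion of the ordered sum. The first query switched off makes no order test, so the average over
all m' < M completes the sum of order k; all later averages are of a constant. -/
theorem queryState_word (g : ℕ → QOp (Fin ns)) {M : ℕ} (hM : 0 < M) {w : ℕ → Bool}
    (ψ : Bits (Fin ns) → ℂ) {k K : ℕ} (hw : ∀ i ≤ K, w (i + 1) = decide (i < k)) {j : ℕ} (hj : j ≤ K)
    {m : ℕ} (hm : m ≤ M) :
    queryState g M w ψ j m =
      if j < k then (1 / M : ℂ) ^ j • (g m * orderedSum g j m) *ᵥ ψ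
        else (1 / M : ℂ) ^ k • orderedSum g k M *ᵥ ψ := by
  induction j generalizing m with
  | zero =>
    rcases Nat.eq_zero_or_pos k with rfl | hk
    · simp [queryState, hw 0 hj, orderedSum]
    · simp [queryState, hw 0 hj, orderedSum, hk]
  | succ j ih =>
    have ih' : ∀ m' ∈ Finset.range M, queryState g M w ψ j m' =
        if j < k then (1 / M : ℂ) ^ j • (g m' * orderedSum g j m') *ᵥ ψ
          else (1 / M : ℂ) ^ k • orderedSum g k M *ᵥ ψ :=
      fun m' hm' => ih (by omega) (Finset.mem_range.1 hm').le
    have hsum : ∀ m ≤ M, ∑ m' ∈ Finset.range M,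
        (if !decide (m' < m) then 0 else (1 / M : ℂ) ^ j • (g m' * orderedSum g j m') *ᵥ ψ) =
        (1 / M : ℂ) ^ j • orderedSum g (j + 1) m *ᵥ ψ := by
      intro m hm
      rw [orderedSum, Matrix.sum_mulVec, Finset.smul_sum,
        ← Finset.sum_subset (Finset.range_subset_range.2 hm)]
      · refine Finset.sum_congr rfl fun m' hm' => ?_
        rw [Finset.mem_range] at hm'
        simp [hm']
      · intro m' _ hm'
        rw [Finset.mem_range] at hm'
        simp [hm']
    simp only [queryState, hw (j + 1) hj]
    by_cases hk : j + 1 < k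
    · have hk' : j < k := by omega
      simp only [hk, decide_true, if_true, Bool.true_and]
      rw [(Finset.sum_congr rfl fun m' hm' => by rw [ih' m' hm', if_pos hk']).trans (hsum m hm),
        smul_smul, mulVec_smul, mulVec_mulVec, ← pow_succ']
    · simp only [hk, decide_false, Bool.false_eq_true, if_false, Bool.false_and]
      rw [Finset.sum_congr rfl ih']
      by_cases hk' : j < k
      · obtain rfl : k = j + 1 := by omega
        have := hsum M le_rfl
        simp only [hk', if_true]
        rw [(Finset.sum_congr rfl fun m' hm' => by simp [Finset.mem_range.1 hm']).trans this,
          smul_smul, ← pow_succ']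
      · simp only [hk', if_false]
        exact avg_const hM _

/-- The final unpreparation supplies the average over the last time, which has no test of its own.
-/
theorem avg_queryState_word (g : ℕ → QOp (Fin ns)) {M : ℕ} (hM : 0 < M) {w : ℕ → Bool}
    (ψ : Bits (Fin ns) → ℂ) {k K : ℕ} (hw : ∀ i ≤ K, w (i + 1) = decide (i < k))
    (hk : k ≤ K + 1) :
    (1 / M : ℂ) • ∑ m ∈ Finset.range M, queryState g M w ψ K m =
      (1 / M : ℂ) ^ k • orderedSum g k M *ᵥ ψ := by
  rw [Finset.sum_congr rfl fun m hm =>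
    queryState_word g hM ψ hw le_rfl (Finset.mem_range.1 hm).le]
  by_cases h : K < k
  · obtain rfl : k = K + 1 := by omega
    simp only [h, if_true, ← Finset.smul_sum, ← Matrix.sum_mulVec]
    rw [smul_smul, ← pow_succ']
    rfl
  · simp only [h, if_false]
    exact avg_const hM _

end OrderedSums

/-! ### Evolution of the tracked branch from the preparation to the final overlap -/

section Simulation

variable {M ns na n K : ℕ}

theorem onWires_mulVec_of_support {R W : Type} [Fintype R] [DecidableEq R] [Fintype W]
    [DecidableEq W] (e : R ↪ W) (A : QOp R) {Φ : Bits W → ℂ} (b : Bits R)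
    (h : ∀ x, x ∘ e ≠ b → Φ x = 0) (x : Bits W) :
    (onWires e A *ᵥ Φ) x = A (x ∘ e) b * Φ (setWires e b x) := by
  rw [onWires_mulVec, Finset.sum_eq_single b]
  · intro a _ ha
    rw [h _ (by rwa [setWires_comp]), mul_zero]
  · simp

/-- The preparation of the clock and of the time registers. -/
def prepareOp (C : QOp (Fin (K + 2))) (P : QOp (TimeReg n)) : QOp (Wire ns na n K) :=
  onWires clkEmb C * (onWires (tmEmb false) P * onWires (tmEmb true) P)

/-- The three preparations act on disjoint wires, all of them 0, so the amplitudes form a product.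
-/
theorem TracksClean.prepare (C : QOp (Fin (K + 2))) (P : QOp (TimeReg n))
    (ψ : Bits (Fin ns) → ℂ) :
    TracksClean (na := na) (fun c => C c fun _ => false) (fun z => P z fun _ => false)
      (fun _ _ => ψ) false 0 (prepareOp C P *ᵥ (adjoinZeros (Fin ns) (Aux na n K) *ᵥ ψ)) := by
  set Φ : Bits (Wire ns na n K) → ℂ := adjoinZeros (Fin ns) (Aux na n K) *ᵥ ψ with hΦ
  have h0 : ∀ x, Φ x = if x ∘ Sum.inr = fun _ => false then ψ (x ∘ Sum.inl) else 0 :=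
    adjoinZeros_mulVec ψ
  have hzero : ∀ x w, x (Sum.inr w) = true → Φ x = 0 := by
    intro x w hw
    rw [h0, if_neg]
    intro h
    have := congrFun h w
    simp [hw] at this
  have hsupp : ∀ (R : Type) (e : R ↪ Wire ns na n K), (∀ i, ∃ w, e i = .inr w) → ∀ x,
      (x ∘ e ≠ fun _ => false) → Φ x = 0 := by
    intro R e he x hx
    obtain ⟨i, hi⟩ := Function.ne_iff.1 hx
    obtain ⟨w, hw⟩ := he i
    exact hzero x w (by simpa [hw] using hi)
  have hset : ∀ b (s : Bool) (x : Bits (Wire ns na n K)) w, (∀ v, w ≠ .inr (.tm s v)) →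
      setWires (tmEmb s) b x w = x w :=
    fun b s x w hw => setWires_of_ne _ _ _ fun v hv => hw v hv.symm
  have hsetc : ∀ b (x : Bits (Wire ns na n K)) w, (∀ v, w ≠ .inr (.clk v)) →
      setWires clkEmb b x w = x w :=
    fun b x w hw => setWires_of_ne _ _ _ fun v hv => hw v hv.symm
  have h1 : ∀ x, (onWires (tmEmb true) P *ᵥ Φ) x = P (x ∘ tmEmb true) (fun _ => false) *
      Φ (setWires (tmEmb true) (fun _ => false) x) :=
    onWires_mulVec_of_support _ _ _ (hsupp _ _ fun i => ⟨_, rfl⟩)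
  have h2 : ∀ x, (onWires (tmEmb false) P *ᵥ (onWires (tmEmb true) P *ᵥ Φ)) x =
      P (x ∘ tmEmb false) (fun _ => false) * (P (x ∘ tmEmb true) (fun _ => false) *
      Φ (setWires (tmEmb true) (fun _ => false) (setWires (tmEmb false) (fun _ => false) x))) := by
    intro x
    rw [onWires_mulVec_of_support _ _ (fun _ => false), h1]
    · congr 3
      exact funext fun k => hset _ _ x (.inr (.tm true k)) (by simp)
    · intro x hx
      rw [h1, hsupp _ (tmEmb false) (fun i => ⟨_, rfl⟩), mul_zero]
      intro h
      refine hx (h ▸ ?_)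
      exact funext fun k => (hset _ _ x (.inr (.tm false k)) (by simp)).symm
  have h3 : ∀ x, (prepareOp C P *ᵥ Φ) x = C (x ∘ clkEmb) (fun _ => false) *
      (P (x ∘ tmEmb false) (fun _ => false) * (P (x ∘ tmEmb true) (fun _ => false) *
      Φ (setWires (tmEmb true) (fun _ => false) (setWires (tmEmb false) (fun _ => false)
        (setWires clkEmb (fun _ => false) x))))) := by
    intro x
    rw [prepareOp, ← mulVec_mulVec, ← mulVec_mulVec,
      onWires_mulVec_of_support _ _ (fun _ => false), h2]
    · congr 3
      · exact funext fun k => hsetc _ x (.inr (.tm false k)) (by simp)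
      · congr 1
        exact funext fun k => hsetc _ x (.inr (.tm true k)) (by simp)
    · intro x hx
      rw [h2, hsupp _ clkEmb (fun i => ⟨_, rfl⟩), mul_zero, mul_zero]
      intro h
      refine hx (h ▸ ?_)
      refine funext fun k => ?_
      exact ((hset _ _ _ (.inr (.clk k)) (by simp)).trans
        (hset _ _ x (.inr (.clk k)) (by simp))).symm
  have h4 : ∀ x w, (∀ v, w ≠ .clk v) → (∀ s v, w ≠ .tm s v) → x (Sum.inr w) = true →
      (prepareOp C P *ᵥ Φ) x = 0 := by
    intro x w hw hw' hx
    rw [h3, hzero _ w, mul_zero, mul_zero, mul_zero]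
    rw [hset _ _ _ _ (by simpa using hw' true), hset _ _ _ _ (by simpa using hw' false),
      hsetc _ _ _ (by simpa using hw), hx]
  refine ⟨⟨fun x i _ hx => h4 x _ (by simp) (by simp) hx,
    fun x _ hx => h4 x _ (by simp) (by simp) hx, fun x hx hb ha => ?_⟩,
    fun x _ i hx => h4 x _ (by simp) (by simp) hx⟩
  rw [h3, h0, if_pos]
  · have : setWires (tmEmb true) (fun _ => false) (setWires (tmEmb false) (fun _ => false)
        (setWires clkEmb (fun _ => false) x)) ∘ Sum.inl = x ∘ Sum.inl := by
      funext k
      simp only [Function.comp_apply]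
      rw [hset _ _ _ _ (by simp), hset _ _ _ _ (by simp), hsetc _ _ _ (by simp)]
    rw [this, prodAmp]
    simp only [Bool.not_false]
    ring
  · funext w
    simp only [Function.comp_apply]
    rcases w with j | ⟨s, w⟩ | i | _ | j
    · rw [hset _ _ _ _ (by simp), hset _ _ _ _ (by simp)]
      exact setWires_apply clkEmb _ x j
    · cases s
      · rw [hset _ _ _ _ (by simp)]
        exact setWires_apply (tmEmb false) _ _ w
      · exact setWires_apply (tmEmb true) _ _ w
    · rw [hset _ _ _ _ (by simp), hset _ _ _ _ (by simp), hsetc _ _ _ (by simp), ha i]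
    · rw [hset _ _ _ _ (by simp), hset _ _ _ _ (by simp), hsetc _ _ _ (by simp), hb]
    · rw [hset _ _ _ _ (by simp), hset _ _ _ _ (by simp), hsetc _ _ _ (by simp), hx j]

/-- The queries up to the `j`-th, and the tests between them. -/
def stepsOp (O : OracleOp M na ns) (P : QOp (TimeReg (Nat.clog 2 M))) :
    (j : ℕ) → j ≤ K → QOp (Wire ns na (Nat.clog 2 M) K)
  -- The wire 0 of the clock is reserved for its preparation, so step j is controlled by the wire j
  -- + 1. The registers alternate with the parity of j.
  | 0, _ => queryOp O false ⟨1, by omega⟩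
  | j + 1, h => queryOp O (j + 1).bodd ⟨j + 2, by omega⟩ *
      (testOp P j.bodd ⟨j + 2, by omega⟩ ⟨j, by omega⟩ * stepsOp O P j (by omega))

/-- The wires of the clock, numbered by all natural numbers. -/
def clockBit (c : Bits (Fin (K + 2))) (i : ℕ) : Bool := if h : i < K + 2 then c ⟨i, h⟩ else false

/-- Queries and tests alternate: each test restores the clean ancillas that the next query
presupposes. -/
theorem TracksClean.steps {O : OracleOp M na ns} {H : ℝ → QOp (Fin ns)} {t α : ℝ}
    (hO : IsHamT O H t α) {κ : Bits (Fin (K + 2)) → ℂ} {P : QOp (TimeReg (Nat.clog 2 M))}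
    (hu : ∀ f : ℕ → ℂ, ∑ z, (‖P z fun _ => false‖ ^ 2 : ℝ) * f (bitsVal fun i => z (.inl i)) =
      (1 / M : ℂ) * ∑ m ∈ Finset.range M, f m)
    (hu' : ∀ z, M ≤ bitsVal (fun i => z (.inl i)) → P z (fun _ => false) = 0)
    {ψ : Bits (Fin ns) → ℂ} {Ψ : Bits (Wire ns na (Nat.clog 2 M) K) → ℂ}
    (h : TracksClean κ (fun z => P z fun _ => false) (fun _ _ => ψ) false 0 Ψ) (j : ℕ)
    (hj : j ≤ K) :
    Tracks κ (fun z => P z fun _ => false)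
      (fun c => queryState (stepGen H M t α) M (clockBit c) ψ j) j.bodd j
      (stepsOp O P j hj *ᵥ Ψ) := by
  induction j with
  | zero =>
    have h1 := h.query hO hu' ⟨1, by omega⟩
    have e : (fun c m => queryState (stepGen H M t α) M (clockBit (K := K) c) ψ 0 m) =
        fun c m => if c ⟨1, by omega⟩ then stepGen H M t α m *ᵥ ψ else ψ := by
      funext c m
      have : clockBit c 1 = c ⟨1, by omega⟩ := dif_pos (by omega)
      rw [queryState, this]
    rw [← e] at h1
    exact h1
  | succ j ih =>
    have h1 := (ih (by omega)).test (j := ⟨j, by omega⟩) hu ⟨j + 2, by omega⟩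
    rw [← Nat.bodd_succ] at h1
    have h2 := h1.query hO hu' ⟨j + 2, by omega⟩
    rw [stepsOp, ← mulVec_mulVec, ← mulVec_mulVec]
    have e : (fun c m => queryState (stepGen H M t α) M (clockBit (K := K) c) ψ (j + 1) m) =
        fun c m => if c ⟨j + 2, by omega⟩ then
          stepGen H M t α m *ᵥ ((1 / M : ℂ) • ∑ m' ∈ Finset.range M,
            if c ⟨j + 2, by omega⟩ && !decide (m' < m) then 0
              else queryState (stepGen H M t α) M (clockBit c) ψ j m')
          else (1 / M : ℂ) • ∑ m' ∈ Finset.range M,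
            if c ⟨j + 2, by omega⟩ && !decide (m' < m) then 0
              else queryState (stepGen H M t α) M (clockBit c) ψ j m' := by
      funext c m
      have : clockBit c (j + 2) = c ⟨j + 2, by omega⟩ := dif_pos (by omega)
      rw [queryState, this]
    rw [← e] at h2
    exact h2

/-- The rotation of the wire `bad`. -/
def badOps (a b : ℝ) (h : a ^ 2 + b ^ 2 = 1) : List (Op M na ns (Wire ns na n K)) :=
  -- Both polarities of a dummy control together give an uncontrolled rotation.
  [ctrlGate true (u := .inr (.clk 0)) (t := .inr .bad) (by simp) (rot a b h),
    ctrlGate false (u := .inr (.clk 0)) (t := .inr .bad) (by simp) (rot a b h)]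

/-- On the tracked branch `bad` is 0, so rotating it and later asking for 0 multiplies the amplitude
by `a`. -/
theorem Tracks.badOps {O : OracleOp M na ns} {κ : Bits (Fin (K + 2)) → ℂ}
    {u : Bits (TimeReg n) → ℂ} {F : Bits (Fin (K + 2)) → ℕ → Bits (Fin ns) → ℂ} {s : Bool} {j : ℕ}
    {Ψ : Bits (Wire ns na n K) → ℂ} (h : Tracks κ u F s j Ψ) (a b : ℝ) (hab : a ^ 2 + b ^ 2 = 1)
    (x : Bits (Wire ns na n K)) (hx : Passed x) (hb : x (.inr .bad) = false)
    (ha : ∀ i, x (.inr (.anc i)) = false) :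
    (opsEval O (DysonSim.badOps a b hab) *ᵥ Ψ) x =
      a * (prodAmp κ u s x * F (x ∘ clkEmb) (timeVal s x) (x ∘ Sum.inl)) := by
  have h1 : (opsEval O (DysonSim.badOps a b hab) *ᵥ Ψ) x =
      ∑ c, (rot a b hab : Matrix Bool Bool ℂ) (x (.inr .bad)) c *
        Ψ (Function.update x (.inr .bad) c) := by
    simp only [DysonSim.badOps, opsEval_cons, opsEval_nil, Matrix.one_mul, ← mulVec_mulVec]
    rw [ctrlGate_mulVec]
    simp only [ctrlGate_mulVec, ne_eq, Sum.inr.injEq, reduceCtorEq, not_false_iff,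
      Function.update_of_ne]
    cases x (.inr (.clk 0)) <;> simp
  have h2 : Ψ (Function.update x (.inr .bad) true) = 0 :=
    h.bad _ (fun k => by rw [Function.update_of_ne (by simp), hx k]) (by simp)
  have h3 : Function.update x (.inr .bad) false = x := by
    rw [← hb, Function.update_eq_self]
  rw [h1, Fintype.sum_bool, h2, h3, h.val x hx hb ha, hb]
  simp [rot, rotMat]

/-- The overlap with the prepared states weights the clock words by |κ|² and averages over the
current time. -/
theorem unprepare_apply {κ : Bits (Fin (K + 2)) → ℂ} {C : QOp (Fin (K + 2))}
    {P : QOp (TimeReg n)} (hκ : κ = fun c => C c fun _ => false)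
    (hu : ∀ f : ℕ → ℂ, ∑ z, (‖P z fun _ => false‖ ^ 2 : ℝ) * f (bitsVal fun i => z (.inl i)) =
      (1 / M : ℂ) * ∑ m ∈ Finset.range M, f m) (hM : 0 < M)
    {F : Bits (Fin (K + 2)) → ℕ → Bits (Fin ns) → ℂ} {s : Bool} {Ψ : Bits (Wire ns na n K) → ℂ}
    {a : ℂ} (h : ∀ x, Passed x → x (.inr .bad) = false → (∀ i, x (.inr (.anc i)) = false) →
      Ψ x = a * (prodAmp κ (fun z => P z fun _ => false) s x *
        F (x ∘ clkEmb) (timeVal s x) (x ∘ Sum.inl))) (y : Bits (Fin ns)) :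
    (onWires clkEmb Cᴴ *ᵥ (onWires (tmEmb !s) Pᴴ *ᵥ (onWires (tmEmb s) Pᴴ *ᵥ Ψ)))
      (Sum.elim y fun _ => false) =
      a * ∑ c, (‖κ c‖ ^ 2 : ℝ) * ((1 / M : ℂ) • ∑ m ∈ Finset.range M, F c m) y := by
  have hset : ∀ b (s : Bool) (x : Bits (Wire ns na n K)) w, (∀ v, w ≠ .inr (.tm s v)) →
      setWires (tmEmb s) b x w = x w :=
    fun b s x w hw => setWires_of_ne _ _ _ fun v hv => hw v hv.symm
  have hsetc : ∀ b (x : Bits (Wire ns na n K)) w, (∀ v, w ≠ .inr (.clk v)) →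
      setWires clkEmb b x w = x w :=
    fun b x w hw => setWires_of_ne _ _ _ fun v hv => hw v hv.symm
  have hsq : ∀ z : ℂ, ((‖z‖ ^ 2 : ℝ) : ℂ) = star z * z := by
    intro z
    rw [Complex.ofReal_pow, ← Complex.conj_mul']
    rfl
  set x₀ : Bits (Wire ns na n K) := Sum.elim y fun _ => false with hx₀
  have hterm : ∀ c b₁ b₀, Ψ (setWires (tmEmb s) b₀ (setWires (tmEmb !s) b₁
      (setWires clkEmb c x₀))) = a * (κ c * ((P b₀ fun _ => false) * (P b₁ fun _ => false)) *
        F c (bitsVal fun i => b₀ (.inl i)) y) := by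
    intro c b₁ b₀
    set x := setWires (tmEmb s) b₀ (setWires (tmEmb !s) b₁ (setWires clkEmb c x₀)) with hx
    have h0 : ∀ w, (∀ v, w ≠ .clk v) → (∀ s v, w ≠ .tm s v) → x (.inr w) = false := by
      intro w hw hw'
      rw [hx, hset _ _ _ _ (by simpa using hw' s), hset _ _ _ _ (by simpa using hw' !s),
        hsetc _ _ _ (by simpa using hw)]
      rfl
    have e1 : x ∘ clkEmb = c := by
      funext k
      refine (hset _ _ _ (.inr (.clk k)) (by simp)).trans
        ((hset _ _ _ (.inr (.clk k)) (by simp)).trans ?_)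
      exact setWires_apply clkEmb c x₀ k
    have e2 : x ∘ tmEmb s = b₀ := setWires_comp _ _ _
    have e3 : x ∘ tmEmb (!s) = b₁ := by
      funext k
      exact (hset _ _ _ (.inr (.tm (!s) k)) (by simp)).trans
        (setWires_apply (tmEmb (!s)) b₁ _ k)
    have e4 : x ∘ Sum.inl = y := by
      funext k
      rw [Function.comp_apply, hx, hset _ _ _ _ (by simp), hset _ _ _ _ (by simp),
        hsetc _ _ _ (by simp)]
      rfl
    have e5 : timeVal s x = bitsVal fun i => b₀ (.inl i) := by
      rw [← e2]
      rfl
    rw [h x (fun k => h0 _ (by simp) (by simp)) (h0 _ (by simp) (by simp))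
      (fun k => h0 _ (by simp) (by simp)), prodAmp, e1, e2, e3, e4, e5]
  have hclk : x₀ ∘ clkEmb = fun _ => false := rfl
  have htm1 : ∀ c, setWires clkEmb c x₀ ∘ tmEmb (!s) = fun _ => false := fun c =>
    funext fun k => hsetc _ _ (.inr (.tm (!s) k)) (by simp)
  have htm0 : ∀ c b, setWires (tmEmb !s) b (setWires clkEmb c x₀) ∘ tmEmb s = fun _ => false :=
    fun c b => funext fun k => (hset _ _ _ (.inr (.tm s k)) (by simp)).trans
      (hsetc _ _ (.inr (.tm s k)) (by simp))
  -- The register that does not carry the current time contributes its squared norm, which is 1.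
  have hone := hu fun _ => 1
  rw [← smul_eq_mul, avg_const hM] at hone
  simp only [mul_one] at hone
  have hF : ∀ c, ∑ b, (‖P b fun _ => false‖ ^ 2 : ℝ) * F c (bitsVal fun i => b (.inl i)) y =
      ((1 / M : ℂ) • ∑ m ∈ Finset.range M, F c m) y := by
    intro c
    rw [hu fun m => F c m y]
    simp
  rw [onWires_mulVec, hclk, Finset.mul_sum]
  refine Finset.sum_congr rfl fun c _ => ?_
  rw [onWires_mulVec, htm1]
  have hinner : ∀ b₁, (onWires (tmEmb s) Pᴴ *ᵥ Ψ) (setWires (tmEmb !s) b₁ (setWires clkEmb c x₀)) =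
      a * κ c * (P b₁ fun _ => false) * ((1 / M : ℂ) • ∑ m ∈ Finset.range M, F c m) y := by
    intro b₁
    rw [onWires_mulVec, htm0, ← hF, Finset.mul_sum]
    refine Finset.sum_congr rfl fun b₀ _ => ?_
    rw [hterm, hsq, conjTranspose_apply]
    ring
  generalize ((1 / M : ℂ) • ∑ m ∈ Finset.range M, F c m) y = X at hinner
  rw [← one_mul X, ← hone, Finset.sum_mul,
    Finset.mul_sum, Finset.mul_sum, Finset.mul_sum]
  refine Finset.sum_congr rfl fun b₁ _ => ?_
  rw [hinner, hsq, hsq, conjTranspose_apply, conjTranspose_apply, hκ]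
  ring

end Simulation

/-! ## The block of the simulation circuit -/

section Block

variable {M ns na K : ℕ}

theorem adjoinZeros_conjTranspose_mulVec {L R : Type} [Fintype L] [DecidableEq L] [Fintype R]
    [DecidableEq R] (Φ : Bits (L ⊕ R) → ℂ) (y : Bits L) :
    ((adjoinZeros L R)ᴴ *ᵥ Φ) y = Φ (Sum.elim y fun _ => false) := by
  simp [mulVec, dotProduct, adjoinZeros]

theorem adjoinZeros_conj_apply {L R : Type} [Fintype L] [DecidableEq L] [Fintype R]
    [DecidableEq R] (A : QOp (L ⊕ R)) (y y' : Bits L) :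
    ((adjoinZeros L R)ᴴ * (A * adjoinZeros L R)) y y' =
      A (Sum.elim y fun _ => false) (Sum.elim y' fun _ => false) := by
  simp [Matrix.mul_apply, adjoinZeros]

/-- The preparation of a time register. -/
def timeOp (O : OracleOp M na ns) : QOp (TimeReg (Nat.clog 2 M)) :=
  opsEval O (prep (Nat.clog 2 M) M false)

/-- The preparation of the clock. -/
def clockOp (O : OracleOp M na ns) (K : ℕ) (p : ℝ) : QOp (Fin (K + 2)) :=
  opsEval O (clock p (K + 1) false)

theorem timeOp_sum (O : OracleOp M na ns) (hM : 0 < M) (f : ℕ → ℂ) :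
    ∑ z, (‖timeOp O z fun _ => false‖ ^ 2 : ℝ) * f (bitsVal fun i => z (.inl i)) =
      (1 / M : ℂ) * ∑ m ∈ Finset.range M, f m := by
  have h := prep_sum O (Nat.clog 2 M) M hM (Nat.le_pow_clog one_lt_two M) false false f
  rw [if_pos rfl] at h
  rw [← h]
  have : timeInit (Nat.clog 2 M) false = fun _ => false := by
    funext i
    rcases i with i | i <;> simp [timeInit]
  rw [this]
  rfl

/-- The distribution of the time index, applied to the indicator of M ≤ m, is a sum of nonnegative
terms equal to 0. -/
theorem timeOp_eq_zero (O : OracleOp M na ns) (hM : 0 < M) (z : Bits (TimeReg (Nat.clog 2 M)))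
    (hz : M ≤ bitsVal fun i => z (.inl i)) : timeOp O z (fun _ => false) = 0 := by
  have h := timeOp_sum O hM fun m => if M ≤ m then 1 else 0
  rw [Finset.sum_eq_zero fun m hm => if_neg (by simpa using hm), mul_zero] at h
  have h' : ∑ z, ‖timeOp O z fun _ => false‖ ^ 2 *
      (if M ≤ bitsVal fun i => z (.inl i) then (1 : ℝ) else 0) = 0 := by
    apply Complex.ofReal_injective
    rw [Complex.ofReal_zero, ← h]
    push_cast
    refine Finset.sum_congr rfl fun z _ => ?_
    split_ifs <;> rfl
  have := (Finset.sum_eq_zero_iff_of_nonneg fun z _ => by positivity).1 h' z (Finset.mem_univ z)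
  simpa [hz] using this

/-- The circuit whose block is proportional to the truncated series. -/
def walkOp (O : OracleOp M na ns) (K : ℕ) (p a b : ℝ) (hab : a ^ 2 + b ^ 2 = 1) :
    QOp (Wire ns na (Nat.clog 2 M) K) :=
  onWires clkEmb (clockOp O K p)ᴴ * (onWires (tmEmb !K.bodd) (timeOp O)ᴴ *
    (onWires (tmEmb K.bodd) (timeOp O)ᴴ * (opsEval O (badOps a b hab) *
      (stepsOp O (timeOp O) K le_rfl * prepareOp (clockOp O K p) (timeOp O)))))

/-- The Dyson series truncated at the order `k`, in discrete time, with a weight on its last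
term. -/
def truncatedSeries (G : ℕ → QOp (Fin ns)) (M k : ℕ) (p : ℝ) : QOp (Fin ns) :=
  -- The full clock word has probability p^k instead of (1 - p)p^k, hence the factor on the last
  -- term.
  ∑ j ∈ Finset.range k, orderedSum G j M + ((1 - p : ℝ) : ℂ)⁻¹ • orderedSum G k M

/-- The choice p = tα turns p^k(αM)^{-k} into (t/M)^k, and the rotation by -1/(2(1 - p)) replaces
the common factor 1 - p by -1/2. The sign is chosen so that amplification returns +A. -/
theorem walkOp_block {O : OracleOp M na ns} {H : ℝ → QOp (Fin ns)} {t α : ℝ}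
    (hO : IsHamT O H t α) (hM : 0 < M) (hα : α ≠ 0) {p : ℝ} (hp : p = t * α) (h0 : 0 ≤ p)
    (h1 : p ≤ 1 / 2) (b : ℝ) (hab : (-(1 / (2 * (1 - p)))) ^ 2 + b ^ 2 = 1) :
    (adjoinZeros (Fin ns) (Aux na (Nat.clog 2 M) K))ᴴ *
        (walkOp O K p (-(1 / (2 * (1 - p)))) b hab * adjoinZeros (Fin ns) (Aux na (Nat.clog 2 M) K)) =
      (-(1 / 2) : ℂ) •
        truncatedSeries (fun m => (-Complex.I * t / M) • H (m * t / M)) M (K + 1) p := by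
  refine ext_mulVec fun ψ => funext fun y => ?_
  set κ : Bits (Fin (K + 2)) → ℂ := fun c => clockOp O K p c fun _ => false with hκ
  have hu := timeOp_sum O hM
  have h := (TracksClean.prepare (na := na) (clockOp O K p) (timeOp O) ψ).steps hO hu
    (timeOp_eq_zero O hM) K le_rfl
  have hblock := unprepare_apply (F := fun c => queryState (stepGen H M t α) M (clockBit c) ψ K)
    (s := K.bodd) (a := ((-(1 / (2 * (1 - p))) : ℝ) : ℂ)) hκ hu hM (fun x hx hb ha =>
    h.badOps (O := O) (-(1 / (2 * (1 - p)))) b hab x hx hb ha) y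
  rw [← mulVec_mulVec, ← mulVec_mulVec, adjoinZeros_conjTranspose_mulVec, walkOp]
  simp only [← mulVec_mulVec]
  refine hblock.trans ?_
  have hsum := clock_sum O h0 (by linarith) (K + 1) fun c => ((1 / M : ℂ) • ∑ m ∈ Finset.range M,
    queryState (stepGen H M t α) M (clockBit c) ψ K m) y
  have hinit : clockInit (K + 1) false = fun _ => false := by
    rw [clockInit_false]
    funext i
    simp [clockWord]
  rw [hinit] at hsum
  have hword : ∀ k ≤ K + 1, ∀ i ≤ K,
      clockBit (Fin.cons false (clockWord (K + 1) k) : Bits (Fin (K + 2))) (i + 1) =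
        decide (i < k) := by
    intro k _ i hi
    rw [clockBit, dif_pos (by omega)]
    exact Fin.cons_succ (α := fun _ => Bool) false (clockWord (K + 1) k) ⟨i, by omega⟩
  have hscale : ∀ k, ((p : ℂ) ^ k) • ((1 / M : ℂ) ^ k • orderedSum (stepGen H M t α) k M) =
      orderedSum (fun m => (-Complex.I * t / M) • H (m * t / M)) k M := by
    intro k
    rw [smul_smul, ← mul_pow, ← orderedSum_smul]
    congr 1
    funext m
    rw [stepGen, smul_smul]
    congr 1
    rw [hp]
    have : (α : ℂ) ≠ 0 := by exact_mod_cast hα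
    push_cast
    field_simp
  have hterm : ∀ k ≤ K + 1, (p : ℂ) ^ k * ((1 / M : ℂ) • ∑ m ∈ Finset.range M,
      queryState (stepGen H M t α) M
        (clockBit (Fin.cons false (clockWord (K + 1) k) : Bits (Fin (K + 2)))) ψ K m) y =
      (orderedSum (fun m => (-Complex.I * t / M) • H (m * t / M)) k M *ᵥ ψ) y := by
    intro k hk
    rw [avg_queryState_word _ hM ψ (hword k hk) hk, ← hscale, smul_mulVec, smul_mulVec]
    rfl
  have hp1 : ((1 - p : ℝ) : ℂ) ≠ 0 := by
    exact_mod_cast (by linarith : 1 - p ≠ 0)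
  rw [hterm (K + 1) le_rfl, Finset.sum_congr rfl fun k hk =>
    (mul_assoc _ _ _).trans (congrArg _ (hterm k (Finset.mem_range.1 hk).le)), ← Finset.mul_sum]
    at hsum
  refine (congrArg _ hsum).trans ?_
  rw [truncatedSeries, smul_mulVec, add_mulVec, sum_mulVec, smul_mulVec]
  simp only [Pi.smul_apply, Pi.add_apply, Finset.sum_apply, smul_eq_mul]
  generalize ∑ k ∈ Finset.range (K + 1), (orderedSum _ k M *ᵥ ψ) y = S₁
  generalize (orderedSum _ (K + 1) M *ᵥ ψ) y = S₂
  push_cast at hp1 ⊢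
  field_simp

end Block

/-! ### Amplification -/

section Amplification

/-- One round of oblivious amplitude amplification. -/
theorem amplification_block {m n : Type*} [Fintype m] [DecidableEq m] [Fintype n] [DecidableEq n]
    {ι : Matrix m n ℂ} (hι : ιᴴ * ι = 1) {W : Matrix m m ℂ} (hW : W ∈ unitaryGroup m ℂ)
    {A : Matrix n n ℂ} (hA : ιᴴ * (W * ι) = (-(1 / 2) : ℂ) • A) :
    ιᴴ * ((W * ((1 - (2 : ℂ) • (ι * ιᴴ)) * (Wᴴ * ((1 - (2 : ℂ) • (ι * ιᴴ)) * W)))) * ι) =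
      (1 / 2 : ℂ) • ((3 : ℂ) • A - A * (Aᴴ * A)) := by
  have hW1 : Wᴴ * W = 1 := mem_unitaryGroup_iff'.1 hW
  have hW2 : W * Wᴴ = 1 := mem_unitaryGroup_iff.1 hW
  set B := ιᴴ * (W * ι) with hB
  have hBH : ιᴴ * (Wᴴ * ι) = Bᴴ := by
    simp only [hB, conjTranspose_mul, conjTranspose_conjTranspose, Matrix.mul_assoc]
  have hR : ∀ X : Matrix m n ℂ,
      (1 - (2 : ℂ) • (ι * ιᴴ)) * X = X - (2 : ℂ) • (ι * (ιᴴ * X)) := by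
    intro X
    rw [Matrix.sub_mul, Matrix.one_mul, Matrix.smul_mul, Matrix.mul_assoc]
  have h1 : (W * ((1 - (2 : ℂ) • (ι * ιᴴ)) * (Wᴴ * ((1 - (2 : ℂ) • (ι * ιᴴ)) * W)))) * ι =
      W * ((1 - (2 : ℂ) • (ι * ιᴴ)) * (Wᴴ * ((1 - (2 : ℂ) • (ι * ιᴴ)) * (W * ι)))) := by
    simp only [Matrix.mul_assoc]
  have h2 : Wᴴ * ((1 - (2 : ℂ) • (ι * ιᴴ)) * (W * ι)) = ι - (2 : ℂ) • (Wᴴ * (ι * B)) := by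
    rw [hR, ← hB, Matrix.mul_sub, ← Matrix.mul_assoc, hW1, Matrix.one_mul, Matrix.mul_smul]
  have h3 : ιᴴ * (ι - (2 : ℂ) • (Wᴴ * (ι * B))) = 1 - (2 : ℂ) • (Bᴴ * B) := by
    rw [Matrix.mul_sub, hι, Matrix.mul_smul, ← hBH]
    simp only [Matrix.mul_assoc]
  rw [h1, h2, hR, h3]
  -- The block of the amplified operator is -3B + 4BB*B, where B is the block of W. Substituting B =
  -- -A/2 gives the claim.
  have h4 : ιᴴ * (W * (ι - (2 : ℂ) • (Wᴴ * (ι * B)) -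
      (2 : ℂ) • (ι * (1 - (2 : ℂ) • (Bᴴ * B))))) =
      B - (2 : ℂ) • B - ((2 : ℂ) • B - (4 : ℂ) • (B * (Bᴴ * B))) := by
    have e1 : W * (Wᴴ * (ι * B)) = ι * B := by rw [← Matrix.mul_assoc, hW2, Matrix.one_mul]
    have e2 : ιᴴ * (ι * B) = B := by rw [← Matrix.mul_assoc, hι, Matrix.one_mul]
    have e3 : ιᴴ * (W * (ι * (Bᴴ * B))) = B * (Bᴴ * B) := by
      rw [hB]
      simp only [Matrix.mul_assoc]
    simp only [Matrix.mul_sub, Matrix.mul_smul, e1, e2, e3, Matrix.mul_one, ← hB, smul_sub,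
      smul_smul]
    norm_num
  rw [h4, hA]
  simp only [conjTranspose_smul, Matrix.smul_mul, Matrix.mul_smul, smul_smul, smul_sub]
  have : star (-(1 / 2) : ℂ) = -(1 / 2) := by
    rw [Complex.star_def, map_neg, map_div₀, map_one, map_ofNat]
  rw [this]
  module

variable {L R : Type} [Fintype L] [DecidableEq L] [Fintype R] [DecidableEq R]

theorem reflection_mulVec (Ψ : Bits (L ⊕ R) → ℂ) (x : Bits (L ⊕ R)) :
    ((1 - (2 : ℂ) • (adjoinZeros L R * (adjoinZeros L R)ᴴ)) *ᵥ Ψ) x =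
      if ∀ w ∈ Finset.univ.map (Function.Embedding.inr : R ↪ L ⊕ R), x w = false then -Ψ x
        else Ψ x := by
  have hiff : (∀ w ∈ Finset.univ.map (Function.Embedding.inr : R ↪ L ⊕ R), x w = false) ↔
      x ∘ Sum.inr = fun _ => false := by
    simp [funext_iff]
  rw [sub_mulVec, one_mulVec, smul_mulVec, ← mulVec_mulVec]
  simp only [Pi.sub_apply, Pi.smul_apply, adjoinZeros_mulVec, adjoinZeros_conjTranspose_mulVec, hiff,
    smul_eq_mul]
  split_ifs with h
  · rw [elim_comp_of_zero h]
    ring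
  · ring

end Amplification

/-! ### The circuit -/

section Resources

variable {M ns na K r : ℕ}

theorem implements_queryOp (s : Bool) (j : Fin (K + 2)) :
    Implements (Fin r) 2 1 (fun O : OracleOp M na ns => queryOp O s j) := by
  have h1 := Implements.gate (R := Fin r) (ctrlGate (M := M) (na := na) (ns := ns) true
    (u := (.inr (.clk j) : Wire ns na (Nat.clog 2 M) K)) (t := .inr .bad) (by simp)
    (phase (-Complex.I) (by simp))) rfl
  have h2 := Implements.op (R := Fin r) (Op.ctrlQuery (M := M) (na := na) (ns := ns)
    (ctrlQueryEmb (K := K) s j) false)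
  exact h1.mul h2

theorem implements_timeOp (s : Bool) :
    Implements (Fin r) (7 * Nat.clog 2 M) 0 (fun O : OracleOp M na ns =>
      (onWires (tmEmb s) (timeOp O) : QOp (Wire ns na (Nat.clog 2 M) K))) := by
  have h := prep_countP (M := M) (na := na) (ns := ns) (Nat.clog 2 M) M false
  have := Implements.ops (R := Fin r) (M := M) (na := na) (ns := ns)
    ((prep (Nat.clog 2 M) M false).map
      (Op.map (tmEmb (ns := ns) (na := na) (n := Nat.clog 2 M) (K := K) s)))
    (g := 7 * Nat.clog 2 M) (k := 0) (by simpa [List.countP_map, Function.comp_def] using h.1.le)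
    (by simpa [List.countP_map, Function.comp_def] using h.2)
  simp only [opsEval_map] at this
  exact this

theorem implements_clockOp (p : ℝ) :
    Implements (Fin r) (K + 1) 0 (fun O : OracleOp M na ns =>
      (onWires clkEmb (clockOp O K p) : QOp (Wire ns na (Nat.clog 2 M) K))) := by
  have h := clock_countP (M := M) (na := na) (ns := ns) p (K + 1) false
  have := Implements.ops (R := Fin r) (M := M) (na := na) (ns := ns)
    ((clock p (K + 1) false).map
      (Op.map (clkEmb (ns := ns) (na := na) (n := Nat.clog 2 M) (K := K))))
    (g := K + 1) (k := 0) (by simpa [List.countP_map, Function.comp_def] using h.1.le)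
    (by simpa [List.countP_map, Function.comp_def] using h.2)
  simp only [opsEval_map] at this
  exact this

theorem implements_prepareOp (p : ℝ) :
    Implements (Fin r) (K + 1 + (7 * Nat.clog 2 M + 7 * Nat.clog 2 M)) 0
      (fun O : OracleOp M na ns =>
        (prepareOp (clockOp O K p) (timeOp O) : QOp (Wire ns na (Nat.clog 2 M) K))) :=
  (implements_clockOp p).mul ((implements_timeOp false).mul (implements_timeOp true))

theorem implements_testOp (hr : 2 * Nat.clog 2 M + na + 2 < r) (s : Bool) (i : Fin (K + 2))
    (j : Fin K) :
    Implements (Fin r) (64 * Nat.clog 2 M + 10 * na + 32) 0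
      (fun O : OracleOp M na ns => (testOp (timeOp O) s i j : QOp (Wire ns na _ K))) := by
  have hcard := card_testWires (ns := ns) (na := na) (n := Nat.clog 2 M) (K := K) s
  have hmem : (.inr .bad : Wire ns na (Nat.clog 2 M) K) ∈ testWires s := by simp [testWires]
  have hne : ∀ w, tmEmb (ns := ns) (na := na) (n := Nat.clog 2 M) (K := K) s w ≠ .inr (.flag j) :=
    fun w h => nomatch Sum.inr_injective h
  have h1 := implements_testFlip (M := M) (na := na) (ns := ns) (r := r)
    (testWires s : Finset (Wire ns na (Nat.clog 2 M) K)) ⟨_, hmem⟩ (by omega)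
    (t := .inr (.flag j)) (by simpa [testWires, -Sum.exists, -Sum.forall] using hne)
  have h2 := implements_orderFlip (M := M) (na := na) (ns := ns) (r := r) (n := Nat.clog 2 M)
    (by omega) (fun k => (.inr (.tm s (.inl k)) : Wire ns na (Nat.clog 2 M) K))
    (fun k => .inr (.tm (!s) (.inl k))) (.inr (.clk i)) (.inr .bad)
    (by simp) (by simp) (by simp) (by simp)
  have h3 := implements_timeOp (M := M) (na := na) (ns := ns) (K := K) (r := r) s
  have h4 := h3.mul (h1.mul (h3.conjTranspose.mul h2))
  simp only [← onWires_conjTranspose] at h4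
  exact h4.mono (by omega) (by omega)

theorem implements_stepsOp (hr : 2 * Nat.clog 2 M + na + 2 < r) (j : ℕ) (hj : j ≤ K) :
    Implements (Fin r) (j * (64 * Nat.clog 2 M + 10 * na + 34) + 2) (j + 1)
      (fun O : OracleOp M na ns => stepsOp O (timeOp O) j hj) := by
  induction j with
  | zero => exact (implements_queryOp _ _).mono (by omega) (by omega)
  | succ j ih =>
    refine ((implements_queryOp _ _).mul ((implements_testOp hr _ _ _).mul
      (ih (by omega)))).mono ?_ ?_
    · ring_nf
      omega
    · omega

theorem implements_walkOp (hr : 2 * Nat.clog 2 M + na + 2 < r) (p a b : ℝ)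
    (hab : a ^ 2 + b ^ 2 = 1) :
    Implements (Fin r) (K * (64 * Nat.clog 2 M + 10 * na + 36) + 28 * Nat.clog 2 M + 6) (K + 1)
      (fun O : OracleOp M na ns => walkOp O K p a b hab) := by
  have h1 := Implements.ops (R := Fin r) (M := M) (na := na) (ns := ns)
    (badOps (n := Nat.clog 2 M) (K := K) a b hab) (g := 2) (k := 0) List.countP_le_length
    (by simp [badOps])
  have h2 := (implements_clockOp (M := M) (na := na) (ns := ns) (K := K) (r := r) p).conjTranspose
  have h3 (s : Bool) := (implements_timeOp (M := M) (na := na) (ns := ns) (K := K) (r := r)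
    s).conjTranspose
  have h4 := h2.mul ((h3 !K.bodd).mul ((h3 K.bodd).mul (h1.mul ((implements_stepsOp hr K le_rfl).mul
    (implements_prepareOp p)))))
  simp only [← onWires_conjTranspose] at h4
  refine h4.mono ?_ (by omega)
  ring_nf
  omega

/-- The walk after one round of amplification. -/
def amplifiedOp (O : OracleOp M na ns) (K : ℕ) (p a b : ℝ) (hab : a ^ 2 + b ^ 2 = 1) :
    QOp (Wire ns na (Nat.clog 2 M) K) :=
  let ι := adjoinZeros (Fin ns) (Aux na (Nat.clog 2 M) K)
  let W := walkOp O K p a b hab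
  W * ((1 - (2 : ℂ) • (ι * ιᴴ)) * (Wᴴ * ((1 - (2 : ℂ) • (ι * ιᴴ)) * W)))

theorem implements_amplifiedOp (hr : 2 * K + 4 * Nat.clog 2 M + na + 6 < r) (p a b : ℝ)
    (hab : a ^ 2 + b ^ 2 = 1) :
    Implements (Fin r) (300 * ((K + 1) * (Nat.clog 2 M + na + 1))) (3 * (K + 1))
      (fun O : OracleOp M na ns => amplifiedOp O K p a b hab) := by
  have h1 := implements_walkOp (M := M) (na := na) (ns := ns) (K := K) (r := r) (by omega) p a b hab
  have hcard : (Finset.univ.map (Function.Embedding.inr :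
      Aux na (Nat.clog 2 M) K ↪ Wire ns na (Nat.clog 2 M) K)).card =
      2 * K + 4 * Nat.clog 2 M + na + 5 := by
    rw [Finset.card_map, Finset.card_univ, Aux.card_aux]
  have h2 := implements_reflection (M := M) (na := na) (ns := ns) (r := r)
    (Finset.univ.map (Function.Embedding.inr :
      Aux na (Nat.clog 2 M) K ↪ Wire ns na (Nat.clog 2 M) K))
    ⟨_, Finset.mem_map_of_mem _ (Finset.mem_univ .bad)⟩ (by omega) reflection_mulVec
  rw [hcard] at h2
  refine (h1.mul (h2.mul (h1.conjTranspose.mul (h2.mul h1)))).mono ?_ (by omega)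
  ring_nf
  omega

/-! ### Numbered circuits and their failure probability -/

theorem Circuit.eval_eq_opsEval {q : ℕ} (O : OracleOp M na ns) (c : Circuit M na ns q) :
    c.eval O = opsEval O c := by
  induction c with
  | nil => rfl
  | cons op c ih => rw [Circuit.eval, ih, opsEval]

theorem Implements.exists_circuit {A : Type} [Fintype A] [DecidableEq A] {g k : ℕ}
    {U : OracleOp M na ns → QOp (Fin ns ⊕ A)} (h : Implements (Fin r) g k U) :
    ∃ c : Circuit M na ns (Fintype.card A + r), c.gateCount ≤ g ∧ c.queryCount ≤ k ∧
      ∀ O ∈ unitaryGroup (Fin M × Bits (Fin na) × Bits (Fin ns)) ℂ,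
        c.implemented O = (adjoinZeros (Fin ns) A)ᴴ * (U O * adjoinZeros (Fin ns) A) := by
  obtain ⟨c, h1, h2, hc⟩ := h
  let e' : A ⊕ Fin r ≃ Fin (Fintype.card A + r) := Fintype.equivFinOfCardEq (by simp)
  let e : (Fin ns ⊕ A) ⊕ Fin r ≃ Fin ns ⊕ Fin (Fintype.card A + r) :=
    (Equiv.sumAssoc _ _ _).trans ((Equiv.refl _).sumCongr e')
  refine ⟨c.map (Op.map e.toEmbedding), ?_, ?_, fun O hO => ?_⟩
  · simpa [Circuit.gateCount, List.countP_map, Function.comp_def] using h1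
  · simpa [Circuit.queryCount, List.countP_map, Function.comp_def] using h2
  · have hcomp : ∀ y : Bits (Fin ns), (Sum.elim y fun _ => false :
        Bits (Fin ns ⊕ Fin (Fintype.card A + r))) ∘ e =
        Sum.elim (Sum.elim y fun _ => false) fun _ => false := by
      intro y
      funext w
      rcases w with (w | w) | w <;> rfl
    have h3 : U O = (adjoinZeros (Fin ns ⊕ A) (Fin r))ᴴ *
        (opsEval O c * adjoinZeros (Fin ns ⊕ A) (Fin r)) := by
      rw [hc O hO, ← Matrix.mul_assoc, adjoinZeros_isometry, Matrix.one_mul]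
    ext y y'
    rw [Circuit.implemented, Circuit.eval_eq_opsEval, opsEval_map, onWires_equiv, hcomp, hcomp,
      adjoinZeros_conj_apply, h3, adjoinZeros_conj_apply]

theorem Circuit.eval_mem_unitary {q : ℕ} {O : OracleOp M na ns}
    (hO : O ∈ unitaryGroup (Fin M × Bits (Fin na) × Bits (Fin ns)) ℂ) (c : Circuit M na ns q) :
    c.eval O ∈ unitaryGroup (Bits (Fin ns ⊕ Fin q)) ℂ := by
  rw [Circuit.eval_eq_opsEval]
  exact opsEval_mem_unitary hO c

theorem sum_norm_sq_mulVec {m n : Type*} [Fintype m] [Fintype n] [DecidableEq n] {A : Matrix m n ℂ}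
    (h : Aᴴ * A = 1) (v : n → ℂ) : ∑ i, ‖(A *ᵥ v) i‖ ^ 2 = ∑ i, ‖v i‖ ^ 2 := by
  have hsq : ∀ z : ℂ, ((‖z‖ ^ 2 : ℝ) : ℂ) = star z * z := by
    intro z
    rw [Complex.ofReal_pow, ← Complex.conj_mul']
    rfl
  apply Complex.ofReal_injective
  simp only [Complex.ofReal_sum, hsq]
  change star (A *ᵥ v) ⬝ᵥ (A *ᵥ v) = star v ⬝ᵥ v
  rw [star_mulVec, dotProduct_mulVec, vecMul_vecMul, h, vecMul_one]

/-- The probabilities of all outcomes add up to ‖ψ‖² by unitarity, and the outcome 0⋯0 has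
probability ‖Wψ‖². -/
theorem Circuit.failureProb_eq {q : ℕ} {O : OracleOp M na ns}
    (hO : O ∈ unitaryGroup (Fin M × Bits (Fin na) × Bits (Fin ns)) ℂ) (c : Circuit M na ns q)
    (ψ : Bits (Fin ns) → ℂ) :
    c.failureProb O ψ = ∑ y, ‖ψ y‖ ^ 2 - ∑ y, ‖(c.implemented O *ᵥ ψ) y‖ ^ 2 := by
  have hV := mem_unitaryGroup_iff'.1 (c.eval_mem_unitary hO)
  have hVι : (c.eval O * adjoinZeros (Fin ns) (Fin q))ᴴ * (c.eval O * adjoinZeros (Fin ns) (Fin q)) =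
      1 := by
    rw [conjTranspose_mul, Matrix.mul_assoc, ← Matrix.mul_assoc _ (c.eval O),
      ← star_eq_conjTranspose (c.eval O), hV, Matrix.one_mul, adjoinZeros_isometry]
  rw [← sum_norm_sq_mulVec hVι ψ, ← (Equiv.sumArrowEquivProdArrow _ _ Bool).symm.sum_comp,
    Fintype.sum_prod_type_right]
  have happ : ∀ y z, ((c.eval O * adjoinZeros (Fin ns) (Fin q)) *ᵥ ψ) (Sum.elim y z) =
      ∑ y', c.eval O (Sum.elim y z) (Sum.elim y' fun _ => false) * ψ y' := by
    intro y z
    simp [mulVec, dotProduct, Matrix.mul_apply, adjoinZeros]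
  have h1 : ∀ z, ∑ y, ‖((c.eval O * adjoinZeros (Fin ns) (Fin q)) *ᵥ ψ)
      ((Equiv.sumArrowEquivProdArrow _ _ Bool).symm (y, z))‖ ^ 2 = ∑ y,
      ‖∑ y', c.eval O (Sum.elim y z) (Sum.elim y' fun _ => false) * ψ y'‖ ^ 2 := by
    intro z
    refine Finset.sum_congr rfl fun y _ => ?_
    rw [← happ]
    rfl
  have h2 : ∑ y, ‖(c.implemented O *ᵥ ψ) y‖ ^ 2 = ∑ y,
      ‖∑ y', c.eval O (Sum.elim y fun _ => false) (Sum.elim y' fun _ => false) * ψ y'‖ ^ 2 := rfl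
  have h3 : ∀ g : Bits (Fin q) → ℝ, (∑ z, if z = fun _ => false then 0 else g z) =
      ∑ z, g z - g fun _ => false := by
    intro g
    rw [← Finset.add_sum_erase _ g (Finset.mem_univ fun _ => false), add_sub_cancel_left,
      ← Finset.add_sum_erase _ _ (Finset.mem_univ fun _ => false), if_pos rfl, zero_add]
    exact Finset.sum_congr rfl fun z hz => if_neg (Finset.ne_of_mem_erase hz)
  rw [Finset.sum_congr rfl fun z _ => h1 z, h2]
  exact h3 fun z => ∑ y, ‖∑ y', c.eval O (Sum.elim y z) (Sum.elim y' fun _ => false) * ψ y'‖ ^ 2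

/-- There is a circuit that performs one round of amplification of the truncated series. -/
theorem exists_series_circuit (hM : 0 < M) (ns na K : ℕ) {t α : ℝ} (hα : 0 < α) (ht : 0 ≤ t)
    (htα : t * α ≤ 1 / 2) :
    ∃ (q : ℕ) (V : Circuit M na ns q),
      V.queryCount ≤ 3 * (K + 1) ∧
      q ≤ 4 * K + 8 * Nat.clog 2 M + 2 * na + 12 ∧
      V.gateCount ≤ 300 * ((K + 1) * (Nat.clog 2 M + na + 1)) ∧
      ∀ (H : ℝ → QOp (Fin ns)) (O : OracleOp M na ns), IsHamT O H t α →
        V.implemented O = (1 / 2 : ℂ) • ((3 : ℂ) •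
          truncatedSeries (fun m => (-Complex.I * t / M) • H (m * t / M)) M (K + 1) (t * α) -
          truncatedSeries (fun m => (-Complex.I * t / M) • H (m * t / M)) M (K + 1) (t * α) *
          ((truncatedSeries (fun m => (-Complex.I * t / M) • H (m * t / M)) M (K + 1) (t * α))ᴴ *
          truncatedSeries (fun m => (-Complex.I * t / M) • H (m * t / M)) M (K + 1) (t * α))) := by
  have hp0 : 0 ≤ t * α := by positivity
  set p := t * α with hp
  -- p ≤ 1/2 gives 1/(2(1 - p)) ≤ 1, so this number is an entry of a rotation.
  have hab : (-(1 / (2 * (1 - p)))) ^ 2 + Real.sqrt (1 - (-(1 / (2 * (1 - p)))) ^ 2) ^ 2 = 1 := by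
    rw [Real.sq_sqrt, add_sub_cancel]
    have h1 : 1 / (2 * (1 - p)) ≤ 1 := by
      rw [div_le_one (by linarith)]
      linarith
    have h2 : 0 ≤ 1 / (2 * (1 - p)) := by
      have : 0 < 1 - p := by linarith
      positivity
    nlinarith
  -- The reflection tests all 2K + 4⌈log₂ M⌉ + na + 5 auxiliary wires. Its chain of conjunctions
  -- needs one ancilla more than that, and the phase one spare ancilla.
  have himp := implements_amplifiedOp (M := M) (na := na) (ns := ns) (K := K)
    (r := 2 * K + 4 * Nat.clog 2 M + na + 7) (by omega) p _ _ hab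
  obtain ⟨V, h1, h2, h3⟩ := himp.exists_circuit
  refine ⟨_, V, h2, ?_, h1, fun H O hO => ?_⟩
  · rw [Aux.card_aux]
    omega
  · rw [h3 O hO.unitary]
    refine amplification_block adjoinZeros_isometry ?_
      (walkOp_block hO hM hα.ne' hp hp0 htα _ hab)
    exact (implements_walkOp (r := 2 * K + 4 * Nat.clog 2 M + na + 7) (by omega) _ _ _ hab).unitary
      hO.unitary

end Resources

/-! ## Truncation of the series in discrete time -/

section Truncation

variable {A : Type*} [NormedRing A]

theorem one_add_pow_le_two {b : ℝ} {M m : ℕ} (hb : 0 ≤ b) (hbM : b * M ≤ 1 / 2) (hm : m ≤ M) :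
    (1 + b) ^ m ≤ 2 := by
  have h1 : (1 + b) ^ m ≤ Real.exp (b * M) := by
    rw [mul_comm, Real.exp_nat_mul]
    refine (pow_le_pow_right₀ (by linarith) hm).trans ?_
    exact pow_le_pow_left₀ (by linarith) (by linarith [Real.add_one_le_exp b]) M
  have h2 : Real.exp (b * M) * Real.exp (b * M) ≤ 4 := by
    rw [← Real.exp_add]
    have := Real.exp_le_exp.2 (by linarith : b * M + b * M ≤ 1)
    linarith [Real.exp_one_lt_d9]
  nlinarith [Real.exp_pos (b * M)]

/-- The product `(1 + G (m - 1)) ⋯ (1 + G 0)`. -/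
def eulerProduct (G : ℕ → A) : ℕ → A
  | 0 => 1
  | m + 1 => (1 + G m) * eulerProduct G m

theorem eulerProduct_eq (G : ℕ → A) (m : ℕ) :
    eulerProduct G m = 1 + ∑ m' ∈ Finset.range m, G m' * eulerProduct G m' := by
  induction m with
  | zero => simp [eulerProduct]
  | succ m ih =>
    rw [Finset.sum_range_succ, ← add_assoc, ← ih, eulerProduct, add_mul, one_mul]

/-- The remainders of the expansion obey the recursion of the ordered sums, so each order gains a
factor in the estimates below. -/
theorem eulerProduct_sub_succ (G : ℕ → A) (k m : ℕ) :
    eulerProduct G m - ∑ j ∈ Finset.range (k + 1), orderedSum G j m =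
      ∑ m' ∈ Finset.range m,
        G m' * (eulerProduct G m' - ∑ j ∈ Finset.range k, orderedSum G j m') := by
  rw [Finset.sum_range_succ', eulerProduct_eq]
  simp only [orderedSum, mul_sub, Finset.sum_sub_distrib, Finset.mul_sum]
  rw [Finset.sum_comm]
  abel

/-- This is the identity Σ_{m'<m} C(m', k) = C(m, k+1), proved by Pascal's rule. -/
theorem norm_sum_mul_le {G F : ℕ → A} {b c : ℝ} {M k m : ℕ} (hm : m ≤ M)
    (hG : ∀ m < M, ‖G m‖ ≤ b) (hF : ∀ m ≤ M, ‖F m‖ ≤ c * (b ^ k * m.choose k)) :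
    ‖∑ m' ∈ Finset.range m, G m' * F m'‖ ≤ c * (b ^ (k + 1) * m.choose (k + 1)) := by
  induction m with
  | zero => simp
  | succ m ih =>
    rw [Finset.sum_range_succ, Nat.choose_succ_succ]
    have hb : 0 ≤ b := (norm_nonneg _).trans (hG m hm)
    have h1 : ‖G m * F m‖ ≤ b * (c * (b ^ k * m.choose k)) :=
      (norm_mul_le _ _).trans (mul_le_mul (hG m hm) (hF m (by omega)) (norm_nonneg _) hb)
    refine (norm_add_le _ _).trans ((add_le_add (ih (by omega)) h1).trans (le_of_eq ?_))
    push_cast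
    ring

theorem norm_orderedSum_le [NormOneClass A] {G : ℕ → A} {b : ℝ} {M : ℕ} (hG : ∀ m < M, ‖G m‖ ≤ b) (k : ℕ) {m : ℕ}
    (hm : m ≤ M) : ‖orderedSum G k m‖ ≤ b ^ k * m.choose k := by
  induction k generalizing m with
  | zero => simp [orderedSum]
  | succ k ih =>
    have := norm_sum_mul_le (c := 1) hm hG (fun m hm => by simpa using ih hm)
    simpa [orderedSum] using this

theorem norm_eulerProduct_le [NormOneClass A] {G : ℕ → A} {b : ℝ} {M : ℕ} (hb : 0 ≤ b) (hG : ∀ m < M, ‖G m‖ ≤ b)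
    (hbM : b * M ≤ 1 / 2) {m : ℕ} (hm : m ≤ M) : ‖eulerProduct G m‖ ≤ 2 := by
  have h1 : ‖eulerProduct G m‖ ≤ (1 + b) ^ m := by
    induction m with
    | zero => simp [eulerProduct]
    | succ m ih =>
      rw [eulerProduct, pow_succ']
      refine (norm_mul_le _ _).trans (mul_le_mul ?_ (ih (by omega)) (norm_nonneg _) (by linarith))
      exact (norm_add_le _ _).trans (by rw [norm_one]; linarith [hG m hm])
  exact h1.trans (one_add_pow_le_two hb hbM hm)

theorem norm_eulerProduct_sub_le [NormOneClass A] {G : ℕ → A} {b : ℝ} {M : ℕ} (hb : 0 ≤ b)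
    (hG : ∀ m < M, ‖G m‖ ≤ b) (hbM : b * M ≤ 1 / 2) (k : ℕ) {m : ℕ} (hm : m ≤ M) :
    ‖eulerProduct G m - ∑ j ∈ Finset.range k, orderedSum G j m‖ ≤ 2 * (b ^ k * m.choose k) := by
  induction k generalizing m with
  | zero => simpa using norm_eulerProduct_le hb hG hbM hm
  | succ k ih =>
    rw [eulerProduct_sub_succ]
    exact norm_sum_mul_le hm hG fun m hm => ih hm

/-- Two units come from the last term, whose weight 1/(1 - p) is at most 2, and two from the
remainder of the Euler product. Finally C(M, k) ≤ M^k/k!. -/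
theorem norm_truncatedSeries_sub_le {ns : ℕ} {G : ℕ → QOp (Fin ns)} {b p : ℝ} {M : ℕ} (hb : 0 ≤ b)
    (hG : ∀ m < M, ‖G m‖ ≤ b) (hbM : b * M ≤ 1 / 2) (hp : p ≤ 1 / 2) (k : ℕ) :
    ‖truncatedSeries G M k p - eulerProduct G M‖ ≤ 4 * ((b * M) ^ k / k.factorial) := by
  have h1 := norm_eulerProduct_sub_le hb hG hbM k le_rfl
  have h2 := norm_orderedSum_le hG k le_rfl
  have h3 : ‖((1 - p : ℝ) : ℂ)⁻¹‖ ≤ 2 := by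
    rw [norm_inv, Complex.norm_real, Real.norm_eq_abs, abs_of_nonneg (by linarith)]
    rw [inv_le_comm₀ (by linarith) (by norm_num)]
    linarith
  have h4 : b ^ k * M.choose k ≤ (b * M) ^ k / k.factorial := by
    rw [mul_pow, mul_div_assoc]
    exact mul_le_mul_of_nonneg_left (Nat.choose_le_pow_div k M) (by positivity)
  have h5 : truncatedSeries G M k p - eulerProduct G M =
      ((1 - p : ℝ) : ℂ)⁻¹ • orderedSum G k M -
        (eulerProduct G M - ∑ j ∈ Finset.range k, orderedSum G j M) := by
    rw [truncatedSeries]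
    abel
  have h6 : ‖((1 - p : ℝ) : ℂ)⁻¹ • orderedSum G k M‖ ≤ 2 * (b ^ k * M.choose k) := by
    rw [norm_smul]
    exact mul_le_mul h3 h2 (norm_nonneg _) (by norm_num)
  rw [h5]
  linarith [norm_sub_le (((1 - p : ℝ) : ℂ)⁻¹ • orderedSum G k M)
    (eulerProduct G M - ∑ j ∈ Finset.range k, orderedSum G j M)]

end Truncation

/-! ## Stability of the amplification -/

/-- The map fixes U. For A = U + E the error is half of a combination of E and five products
containing E or E*, six terms of norm at most δ because δ ≤ 1. -/
theorem norm_amplified_sub_le {ns : ℕ} {A U : QOp (Fin ns)} (hU : U ∈ unitaryGroup (Bits (Fin ns)) ℂ)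
    {δ : ℝ} (h : ‖A - U‖ ≤ δ) (hδ : δ ≤ 1) :
    ‖(1 / 2 : ℂ) • ((3 : ℂ) • A - A * (Aᴴ * A)) - U‖ ≤ 3 * δ := by
  obtain ⟨E, rfl⟩ : ∃ E, A = U + E := ⟨A - U, by abel⟩
  rw [add_sub_cancel_left] at h
  have hU1 : Uᴴ * U = 1 := mem_unitaryGroup_iff'.1 hU
  have hU2 : U * Uᴴ = 1 := mem_unitaryGroup_iff.1 hU
  have hn : ‖U‖ ≤ 1 := (CStarRing.norm_of_mem_unitary hU).le
  have hn' : ‖Uᴴ‖ ≤ 1 := by rwa [l2_opNorm_conjTranspose]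
  have h' : ‖Eᴴ‖ ≤ δ := by rwa [l2_opNorm_conjTranspose]
  have h0 : 0 ≤ δ := (norm_nonneg _).trans h
  have hmul : ∀ {X Y : QOp (Fin ns)} {a b : ℝ}, ‖X‖ ≤ a → ‖Y‖ ≤ b → ‖X * Y‖ ≤ a * b :=
    fun hX hY => (norm_mul_le _ _).trans
      (mul_le_mul hX hY (norm_nonneg _) ((norm_nonneg _).trans hX))
  have e : (1 / 2 : ℂ) • ((3 : ℂ) • (U + E) - (U + E) * ((U + E)ᴴ * (U + E))) - U =
      (1 / 2 : ℂ) • (E - (U * (Eᴴ * U) + (U * (Eᴴ * E) + (E * (Uᴴ * E) + (E * (Eᴴ * U) +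
        E * (Eᴴ * E)))))) := by
    have e1 : (U + E) * ((U + E)ᴴ * (U + E)) = U + (2 : ℂ) • E + (U * (Eᴴ * U) + (U * (Eᴴ * E) +
        (E * (Uᴴ * E) + (E * (Eᴴ * U) + E * (Eᴴ * E))))) := by
      have e2 : U * (Uᴴ * E) = E := by rw [← Matrix.mul_assoc, hU2, Matrix.one_mul]
      simp only [conjTranspose_add, Matrix.add_mul, Matrix.mul_add, hU1, Matrix.mul_one, e2,
        two_smul]
      abel
    rw [e1]
    module
  rw [e, norm_smul]
  have hb1 := hmul hn (hmul h' hn)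
  have hb2 := hmul hn (hmul h' h)
  have hb3 := hmul h (hmul hn' h)
  have hb4 := hmul h (hmul h' hn)
  have hb5 := hmul h (hmul h' h)
  have hsum : ‖E - (U * (Eᴴ * U) + (U * (Eᴴ * E) + (E * (Uᴴ * E) + (E * (Eᴴ * U) +
        E * (Eᴴ * E)))))‖ ≤ 6 * δ := by
    refine (norm_sub_le _ _).trans ?_
    have n1 := norm_add_le (U * (Eᴴ * U)) (U * (Eᴴ * E) + (E * (Uᴴ * E) + (E * (Eᴴ * U) +
        E * (Eᴴ * E))))
    have n2 := norm_add_le (U * (Eᴴ * E)) (E * (Uᴴ * E) + (E * (Eᴴ * U) + E * (Eᴴ * E)))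
    have n3 := norm_add_le (E * (Uᴴ * E)) (E * (Eᴴ * U) + E * (Eᴴ * E))
    have n4 := norm_add_le (E * (Eᴴ * U)) (E * (Eᴴ * E))
    have d2 : δ * δ ≤ δ := by nlinarith
    have d3 : δ * (δ * δ) ≤ δ := by nlinarith
    linarith
  have hhalf : ‖(1 / 2 : ℂ)‖ = 1 / 2 := by norm_num
  rw [hhalf]
  linarith

/-! ## The order of truncation -/

/-- The number 2.77 lies between e and log 16, so the double logarithm is at least 1 for ε' ≤ 1/16.
-/
theorem log_sixteen_gt : (2.77 : ℝ) < Real.log 16 := by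
  have : Real.log 16 = 4 * Real.log 2 := by
    rw [show (16 : ℝ) = 2 ^ 4 by norm_num, Real.log_pow]
    norm_num
  linarith [Real.log_two_gt_d9]

theorem one_le_log {y : ℝ} (hy : 2.77 ≤ y) : 1 ≤ Real.log y := by
  rw [Real.le_log_iff_exp_le (by linarith)]
  linarith [Real.exp_one_lt_d9]

theorem log_sixteen_le_log_inv_min {ε : ℝ} (hε : 0 < ε) :
    Real.log 16 ≤ Real.log (1 / min ε (1 / 16)) := by
  apply Real.log_le_log (by norm_num)
  rw [le_div_iff₀ (by positivity)]
  linarith [min_le_right ε (1 / 16)]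

theorem one_le_logOverLogLog {ε : ℝ} (hε : 0 < ε) : 1 ≤ logOverLogLog ε := by
  have h := log_sixteen_le_log_inv_min hε
  have h' := log_sixteen_gt
  have h1 := one_le_log (h'.le.trans h)
  rw [logOverLogLog, one_le_div (by linarith)]
  exact (Real.log_le_sub_one_of_pos (by linarith)).trans (by linarith)

/-- Since k! ≥ (k/e)^k, it is enough that (2k/e)^k ≥ e^{4y}. From log y ≤ 2√y one gets k ≥ 4√y,
hence 2k/e ≥ √y, and then k·(log y)/2 ≥ 4y. -/
theorem half_pow_div_factorial_le {y : ℝ} (hy : 2.77 ≤ y) {k : ℕ}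
    (hk : 8 * (y / Real.log y) ≤ k) :
    (1 / 2 : ℝ) ^ k / k.factorial ≤ Real.exp (-(4 * y)) := by
  have h1 := one_le_log hy
  have hy0 : 0 < y := by linarith
  have hk0 : (0 : ℝ) < k := lt_of_lt_of_le (by positivity) hk
  have hfac : (k : ℝ) ^ k / k.factorial ≤ Real.exp k := Real.pow_div_factorial_le_exp _ hk0.le k
  have hsqrt : 0 < Real.sqrt y := Real.sqrt_pos.2 hy0
  have hlog : Real.log y ≤ 2 * Real.sqrt y := by
    have := Real.log_le_sub_one_of_pos hsqrt
    rw [Real.log_sqrt hy0.le] at this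
    linarith
  have hbase : Real.exp (1 + Real.log y / 2) ≤ 2 * k := by
    rw [Real.exp_add, ← Real.log_sqrt hy0.le, Real.exp_log hsqrt]
    have h2 : 4 * Real.sqrt y ≤ k := by
      refine le_trans ?_ hk
      rw [mul_div_assoc', le_div_iff₀ (by linarith)]
      nlinarith [Real.mul_self_sqrt hy0.le]
    nlinarith [Real.exp_one_lt_d9]
  have hpow : Real.exp (k * (1 + Real.log y / 2)) ≤ (2 * k) ^ k := by
    rw [Real.exp_nat_mul]
    exact pow_le_pow_left₀ (Real.exp_pos _).le hbase k
  have h3 : Real.exp (4 * y) * Real.exp k ≤ (2 * k) ^ k := by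
    rw [← Real.exp_add]
    refine (Real.exp_le_exp.2 ?_).trans hpow
    rw [mul_div_assoc', div_le_iff₀ (by linarith)] at hk
    linarith
  have hf : (0 : ℝ) < k.factorial := by positivity
  rw [Real.exp_neg, div_le_iff₀ hf, one_div, inv_pow, ← div_eq_inv_mul, ← one_div,
    div_le_div_iff₀ (by positivity) (Real.exp_pos _), one_mul]
  rw [div_le_iff₀ hf] at hfac
  have h4 : Real.exp (4 * y) * (k : ℝ) ^ k ≤ (2 * k) ^ k * k.factorial :=
    calc Real.exp (4 * y) * (k : ℝ) ^ k ≤ Real.exp (4 * y) * (Real.exp k * k.factorial) := by gcongr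
      _ = Real.exp (4 * y) * Real.exp k * k.factorial := by ring
      _ ≤ _ := by gcongr
  rw [mul_pow] at h4
  have hkk : (0 : ℝ) < (k : ℝ) ^ k := by positivity
  refine le_of_mul_le_mul_right ?_ hkk
  linarith

/-- The order of truncation for the error `ε` with `M` time steps. -/
def truncationOrder (ε : ℝ) (M : ℕ) : ℕ :=
  -- For εM² < 1 the order ⌈8L(ε)⌉ might exceed every multiple of log M + 1, which the number of
  -- qubits does not allow; there order 4 is enough.
  if 1 ≤ ε * M ^ 2 then ⌈8 * logOverLogLog ε⌉₊ else 4

theorem truncationOrder_pos {ε : ℝ} (hε : 0 < ε) (M : ℕ) : 0 < truncationOrder ε M := by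
  have := one_le_logOverLogLog hε
  rw [truncationOrder]
  split_ifs
  · exact Nat.ceil_pos.2 (by linarith)
  · norm_num

theorem truncationOrder_le {ε : ℝ} (hε : 0 < ε) (M : ℕ) :
    (truncationOrder ε M : ℝ) ≤ 9 * logOverLogLog ε := by
  have := one_le_logOverLogLog hε
  rw [truncationOrder]
  split_ifs
  · linarith [Nat.ceil_lt_add_one (a := 8 * logOverLogLog ε) (by linarith)]
  · push_cast
    linarith

/-- In the first case 1/ε ≤ M², so L(ε) ≤ log(1/ε') ≤ 2 log M + 3. This keeps the clock and the
flags within O(log M + 1) qubits. -/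
theorem truncationOrder_le_log {ε : ℝ} (hε : 0 < ε) {M : ℕ} (hM : 0 < M) :
    (truncationOrder ε M : ℝ) ≤ 16 * Real.log M + 25 := by
  have hM' : (1 : ℝ) ≤ M := by exact_mod_cast hM
  have hlogM := Real.log_nonneg hM'
  rw [truncationOrder]
  split_ifs with h
  · have hL := one_le_logOverLogLog hε
    have h1 := Nat.ceil_lt_add_one (a := 8 * logOverLogLog ε) (by linarith)
    have h2 := log_sixteen_le_log_inv_min hε
    have h3 := log_sixteen_gt
    have h4 : logOverLogLog ε ≤ Real.log (1 / min ε (1 / 16)) :=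
      div_le_self (by linarith) (one_le_log (by linarith))
    have h5 : Real.log (1 / min ε (1 / 16)) ≤ 2 * Real.log M + 3 := by
      have h16 : Real.log 16 ≤ 3 := by
        have : Real.log 16 = 4 * Real.log 2 := by
          rw [show (16 : ℝ) = 2 ^ 4 by norm_num, Real.log_pow]
          norm_num
        linarith [Real.log_two_lt_d9]
      rcases min_cases ε (1 / 16) with ⟨h6, -⟩ | ⟨h6, -⟩
      · rw [h6]
        have : Real.log (1 / ε) ≤ Real.log (M ^ 2) := by
          apply Real.log_le_log (by positivity)
          rwa [div_le_iff₀ hε, mul_comm]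
        rw [Real.log_pow] at this
        push_cast at this
        linarith
      · rw [h6, one_div_one_div]
        linarith
    linarith
  · push_cast
    linarith

/-- For εM² ≥ 1 the factorial bound with y = log(1/ε') gives ε'^4. Otherwise x^4 ≤ (εM/32)² =
ε·εM²/1024 ≤ ε/1024. -/
theorem truncation_error_le {ε x : ℝ} {M : ℕ} (hε : 0 < ε) (hx0 : 0 ≤ x) (hx : x ≤ 1 / 2)
    (hxM : x ^ 2 ≤ ε * M / 32) :
    x ^ truncationOrder ε M / (truncationOrder ε M).factorial ≤ ε / 32 := by
  rw [truncationOrder]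
  split_ifs with h
  · have hmin : 0 < min ε (1 / 16) := by positivity
    have h1 : x ^ ⌈8 * logOverLogLog ε⌉₊ ≤ (1 / 2 : ℝ) ^ ⌈8 * logOverLogLog ε⌉₊ :=
      pow_le_pow_left₀ hx0 hx _
    have h2 := half_pow_div_factorial_le (log_sixteen_gt.le.trans (log_sixteen_le_log_inv_min hε))
      (Nat.le_ceil (8 * logOverLogLog ε))
    have h3 : Real.exp (-(4 * Real.log (1 / min ε (1 / 16)))) = min ε (1 / 16) ^ 4 := by
      rw [one_div, Real.log_inv, mul_neg, neg_neg]
      have := Real.exp_nat_mul (Real.log (min ε (1 / 16))) 4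
      push_cast at this
      rw [this, Real.exp_log hmin]
    rw [h3] at h2
    have h4 : min ε (1 / 16) ^ 4 ≤ ε / 32 := by
      have a1 := min_le_left ε (1 / 16)
      have a2 := min_le_right ε (1 / 16)
      have a3 : min ε (1 / 16) ^ 2 ≤ (1 / 16) ^ 2 := pow_le_pow_left₀ hmin.le a2 2
      calc min ε (1 / 16) ^ 4 = min ε (1 / 16) ^ 2 * min ε (1 / 16) * min ε (1 / 16) := by ring
        _ ≤ (1 / 16) ^ 2 * (1 / 16) * ε := by gcongr
        _ ≤ ε / 32 := by linarith
    refine le_trans ?_ (h2.trans h4)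
    gcongr
  · have h1 : x ^ 4 ≤ (ε * M / 32) ^ 2 := by
      rw [show x ^ 4 = (x ^ 2) ^ 2 by ring]
      exact pow_le_pow_left₀ (by positivity) hxM 2
    have h2 : (ε * M / 32) ^ 2 ≤ ε / 1024 := by
      rw [show (ε * M / 32) ^ 2 = ε * (ε * M ^ 2) / 1024 by ring]
      nlinarith
    norm_num [Nat.factorial]
    linarith

/-! ## The time-ordered exponential -/

section Propagator

open Set MeasureTheory

variable {ns : ℕ}

instance : CompleteSpace (QOp (Fin ns)) := FiniteDimensional.complete ℂ _

theorem dysonTerm_congr {H H' : ℝ → QOp (Fin ns)} {t : ℝ} (h : EqOn H H' (Icc 0 t)) (k : ℕ) :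
    EqOn (dysonTerm H k) (dysonTerm H' k) (Icc 0 t) := by
  induction k with
  | zero => exact fun _ _ => rfl
  | succ k ih =>
    intro s hs
    refine intervalIntegral.integral_congr fun u hu => ?_
    rw [uIcc_of_le hs.1] at hu
    have hu' : u ∈ Icc 0 t := ⟨hu.1, hu.2.trans hs.2⟩
    simp only [h hu', ih hu']

theorem continuous_dysonTerm {H : ℝ → QOp (Fin ns)} (hH : Continuous H) (k : ℕ) :
    Continuous (dysonTerm H k) := by
  induction k with
  | zero => exact continuous_const
  | succ k ih =>
    exact intervalIntegral.continuous_primitive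
      (fun a b => (hH.mul ih).intervalIntegrable a b) 0

theorem norm_dysonTerm_le {H : ℝ → QOp (Fin ns)} {h : ℝ} (hb : ∀ s, ‖H s‖ ≤ h) (k : ℕ) {s : ℝ}
    (hs : 0 ≤ s) : ‖dysonTerm H k s‖ ≤ (h * s) ^ k / k.factorial := by
  induction k generalizing s with
  | zero => simp [dysonTerm]
  | succ k ih =>
    have h0 : 0 ≤ h := (norm_nonneg _).trans (hb 0)
    have h1 : ‖dysonTerm H (k + 1) s‖ ≤ ∫ u in (0 : ℝ)..s, h ^ (k + 1) / k.factorial * u ^ k := by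
      refine intervalIntegral.norm_integral_le_of_norm_le hs (Filter.Eventually.of_forall ?_)
        ((continuous_const.mul (continuous_pow k)).intervalIntegrable 0 s)
      intro u hu
      refine (norm_mul_le _ _).trans ((mul_le_mul (hb u) (ih hu.1.le) (norm_nonneg _) h0).trans
        (le_of_eq ?_))
      ring
    refine h1.trans (le_of_eq ?_)
    rw [intervalIntegral.integral_const_mul, integral_pow, Nat.factorial_succ]
    have : (k.factorial : ℝ) ≠ 0 := by positivity
    push_cast
    field_simp
    simp [mul_pow]

/-- H is extended constantly beyond [0, t], which makes it continuous on ℝ and gives two-sided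
derivatives also at the endpoints. Integrating the series V termwise against -iH shifts its index by
one, so V = 1 - i∫HV on [0, t]. -/
theorem exists_propagator {H : ℝ → QOp (Fin ns)} {t h : ℝ} (ht : 0 ≤ t)
    (hH : ContinuousOn H (Icc 0 t)) (hb : ∀ s ∈ Icc 0 t, ‖H s‖ ≤ h) :
    ∃ U : ℝ → QOp (Fin ns), U 0 = 1 ∧ U t = timeOrderedExp H t ∧
      ∀ s ∈ Icc 0 t, HasDerivAt U (-Complex.I • (H s * U s)) s := by
  set pr : ℝ → ℝ := fun s => projIcc 0 t ht s with hpr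
  have hprc : Continuous pr := continuous_subtype_val.comp continuous_projIcc
  have hprm : ∀ s, pr s ∈ Icc 0 t := fun s => (projIcc 0 t ht s).2
  have hpre : ∀ s ∈ Icc 0 t, pr s = s := fun s hs => by simp [hpr, projIcc_of_mem ht hs]
  set H' : ℝ → QOp (Fin ns) := fun s => H (pr s) with hH'
  have hc : Continuous H' := hH.comp_continuous hprc hprm
  have hb' : ∀ s, ‖H' s‖ ≤ h := fun s => hb _ (hprm s)
  have h0 : 0 ≤ h := (norm_nonneg _).trans (hb' 0)
  have heq : EqOn H H' (Icc 0 t) := fun s hs => by simp only [hH', hpre s hs]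
  set f : ℕ → ℝ → QOp (Fin ns) := fun k s => (-Complex.I) ^ k • dysonTerm H' k s with hf
  have hfc : ∀ k, Continuous (f k) := fun k =>
    (continuous_dysonTerm hc k).const_smul ((-Complex.I) ^ k)
  have hfb : ∀ k, ∀ s ∈ Icc 0 t, ‖f k s‖ ≤ (h * t) ^ k / k.factorial := by
    intro k s hs
    rw [hf, norm_smul, norm_pow, norm_neg, Complex.norm_I, one_pow, one_mul]
    refine (norm_dysonTerm_le hb' k hs.1).trans ?_
    have := hs.1
    have := hs.2
    gcongr
  have hsum := Real.summable_pow_div_factorial (h * t)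
  have hfs : ∀ s ∈ Icc 0 t, Summable fun k => f k s := fun s hs =>
    Summable.of_norm_bounded hsum fun k => hfb k s hs
  set V : ℝ → QOp (Fin ns) := fun s => ∑' k, f k (pr s) with hV
  have hVc : Continuous V :=
    continuous_tsum (fun k => (hfc k).comp hprc) hsum fun k s => hfb k _ (hprm s)
  -- Taking the integral rather than the series as U makes the derivative a case of the fundamental
  -- theorem of calculus.
  set U : ℝ → QOp (Fin ns) := fun s => 1 + ∫ u in (0 : ℝ)..s, -Complex.I • (H' u * V u) with hU
  have hUV : ∀ s ∈ Icc 0 t, U s = V s := by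
    intro s hs
    have h1 : HasSum (fun k => ∫ u in (0 : ℝ)..s, -Complex.I • (H' u * f k u))
        (∫ u in (0 : ℝ)..s, -Complex.I • (H' u * V u)) := by
      refine intervalIntegral.hasSum_integral_of_dominated_convergence
        (fun k _ => h * ((h * t) ^ k / k.factorial)) ?_ ?_ ?_ ?_ ?_
      · intro k
        exact ((hc.mul (hfc k)).const_smul (-Complex.I)).aestronglyMeasurable
      · intro k
        refine Filter.Eventually.of_forall fun u hu => ?_
        rw [uIoc_of_le hs.1] at hu
        rw [norm_smul, norm_neg, Complex.norm_I, one_mul]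
        exact (norm_mul_le _ _).trans (mul_le_mul (hb' u)
          (hfb k u ⟨hu.1.le, hu.2.trans hs.2⟩) (norm_nonneg _) h0)
      · exact Filter.Eventually.of_forall fun u _ => hsum.mul_left h
      · exact intervalIntegrable_const
      · refine Filter.Eventually.of_forall fun u hu => ?_
        rw [uIoc_of_le hs.1] at hu
        have hu' : u ∈ Icc 0 t := ⟨hu.1.le, hu.2.trans hs.2⟩
        have := (hfs u hu').hasSum
        simp only [hV, hpre u hu']
        exact (this.mul_left _).const_smul _
    have h2 : ∀ k, ∫ u in (0 : ℝ)..s, -Complex.I • (H' u * f k u) = f (k + 1) s := by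
      intro k
      simp only [hf, mul_smul_comm, smul_smul, ← pow_succ']
      rw [intervalIntegral.integral_smul]
      rfl
    simp only [h2] at h1
    have h3 := (hfs s hs).tsum_eq_zero_add
    have h4 : V s = ∑' k, f k s := by simp only [hV, hpre s hs]
    rw [h4, h3, h1.tsum_eq]
    simp [hf, hU, dysonTerm]
  refine ⟨U, by simp [hU], ?_, fun s hs => ?_⟩
  · rw [hUV t ⟨ht, le_rfl⟩]
    simp only [hV, hpre t ⟨ht, le_rfl⟩, timeOrderedExp, hf]
    exact tsum_congr fun k => by rw [dysonTerm_congr heq k ⟨ht, le_rfl⟩]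
  · have h1 : Continuous fun u => -Complex.I • (H' u * V u) :=
      (hc.mul hVc).const_smul (-Complex.I)
    have h2 := (intervalIntegral.integral_hasDerivAt_right (h1.intervalIntegrable 0 s)
      h1.aestronglyMeasurable.stronglyMeasurableAtFilter h1.continuousAt).const_add 1
    rw [heq hs, hUV s hs]
    exact h2

/-- The propagator of a Hermitian generator is unitary. -/
theorem propagator_mem_unitary {H U : ℝ → QOp (Fin ns)} {t : ℝ}
    (hH : ∀ s ∈ Icc 0 t, (H s).IsHermitian) (h0 : U 0 = 1)
    (hU : ∀ s ∈ Icc 0 t, HasDerivAt U (-Complex.I • (H s * U s)) s) {s : ℝ} (hs : s ∈ Icc 0 t) :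
    U s ∈ unitaryGroup (Bits (Fin ns)) ℂ := by
  have hd : ∀ s ∈ Icc 0 t, HasDerivAt (fun s => star (U s) * U s) 0 s := by
    intro s hs
    have h1 := (hU s hs).star.mul (hU s hs)
    have e : star (-Complex.I • (H s * U s)) * U s + star (U s) * -Complex.I • (H s * U s) = 0 := by
      rw [star_smul, star_mul, star_eq_conjTranspose (H s), (hH s hs).eq]
      simp [Matrix.mul_assoc]
    rw [e] at h1
    exact h1
  have hconst := constant_of_has_deriv_right_zero
    (f := fun s => star (U s) * U s) (a := 0) (b := t)
    (fun s hs => (hd s hs).continuousAt.continuousWithinAt)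
    (fun s hs => (hd s ⟨hs.1, hs.2.le⟩).hasDerivWithinAt) s hs
  rw [mem_unitaryGroup_iff']
  simpa [h0] using hconst

end Propagator

/-! ## Discretization of time -/

section Discretization

open Set MeasureTheory

variable {ns : ℕ} {H U : ℝ → QOp (Fin ns)} {t α h : ℝ}

theorem IsHamiltonian.norm_le_maxNorm (hH : IsHamiltonian H t α) {s : ℝ} (hs : s ∈ Icc 0 t) :
    ‖H s‖ ≤ maxNorm H t :=
  le_ciSup (f := fun s : Icc (0 : ℝ) t => ‖H s‖) ⟨α, by rintro _ ⟨s, rfl⟩; exact hH.norm_le s s.2⟩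
    ⟨s, hs⟩

theorem IsHamiltonian.maxNorm_le (hH : IsHamiltonian H t α) (ht : 0 ≤ t) : maxNorm H t ≤ α :=
  haveI : Nonempty (Icc (0 : ℝ) t) := ⟨⟨0, le_rfl, ht⟩⟩
  ciSup_le fun s => hH.norm_le s s.2

theorem IsHamiltonian.intervalIntegrable_norm (hH : IsHamiltonian H t α) {a c : ℝ} (ha : 0 ≤ a)
    (hac : a ≤ c) (hc : c ≤ t) :
    IntervalIntegrable (fun s => ‖derivWithin H (Icc 0 t) s‖) volume a c := by
  refine hH.integrable.norm.mono_set ?_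
  rw [uIcc_of_le hac, uIcc_of_le (ha.trans (hac.trans hc))]
  exact Icc_subset_Icc ha hc

theorem IsHamiltonian.norm_sub_le (hH : IsHamiltonian H t α) {a s : ℝ} (ha : 0 ≤ a) (has : a ≤ s)
    (hs : s ≤ t) : ‖H s - H a‖ ≤ ∫ u in a..s, ‖derivWithin H (Icc 0 t) u‖ := by
  have hsub : Icc a s ⊆ Icc 0 t := Icc_subset_Icc ha hs
  rw [← intervalIntegral.integral_eq_sub_of_hasDerivAt_of_le has
    (hH.differentiable.continuousOn.mono hsub) (f' := derivWithin H (Icc 0 t))]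
  · exact intervalIntegral.norm_integral_le_integral_norm has
  · intro u hu
    exact (hH.differentiable u (hsub (Ioo_subset_Icc_self hu))).hasDerivWithinAt.hasDerivAt
      (Icc_mem_nhds (ha.trans_lt hu.1) (hu.2.trans_le hs))
  · refine hH.integrable.mono_set ?_
    rwa [uIcc_of_le has, uIcc_of_le (ha.trans (has.trans hs))]

/-- The mean value inequality is applied to U(s) + i(s - a)H(a)U(a). Its derivative is -i((H(s) -
H(a))U(s) + H(a)(U(s) - U(a))), where the first term is bounded by ∫‖dH/ds‖ and the second by h²(c -
a). -/
theorem norm_propagator_step_le (hH : IsHamiltonian H t α) (hb : ∀ s ∈ Icc 0 t, ‖H s‖ ≤ h)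
    (hU : ∀ s ∈ Icc 0 t, HasDerivAt U (-Complex.I • (H s * U s)) s)
    (hU1 : ∀ s ∈ Icc 0 t, ‖U s‖ ≤ 1) {a c : ℝ} (ha : 0 ≤ a) (hac : a ≤ c) (hc : c ≤ t) :
    ‖U c - (1 + (-Complex.I * (c - a : ℝ)) • H a) * U a‖ ≤
      ((∫ u in a..c, ‖derivWithin H (Icc 0 t) u‖) + h ^ 2 * (c - a)) * (c - a) := by
  have hsub : Icc a c ⊆ Icc 0 t := Icc_subset_Icc ha hc
  have ha' : a ∈ Icc 0 t := ⟨ha, hac.trans hc⟩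
  have h0 : 0 ≤ h := (norm_nonneg _).trans (hb a ha')
  have hmul : ∀ {X Y : QOp (Fin ns)} {x y : ℝ}, ‖X‖ ≤ x → ‖Y‖ ≤ y → ‖X * Y‖ ≤ x * y :=
    fun hX hY => (norm_mul_le _ _).trans
      (mul_le_mul hX hY (norm_nonneg _) ((norm_nonneg _).trans hX))
  have hlip : ∀ s ∈ Icc a c, ‖U s - U a‖ ≤ h * (s - a) := by
    refine norm_image_sub_le_of_norm_deriv_le_segment'
      (fun s hs => (hU s (hsub hs)).hasDerivWithinAt) fun s hs => ?_
    have hs' := hsub (Ico_subset_Icc_self hs)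
    rw [norm_smul, norm_neg, Complex.norm_I, one_mul]
    simpa using hmul (hb s hs') (hU1 s hs')
  have hF : ∀ s ∈ Icc a c, HasDerivWithinAt (fun s => U s - (s - a) • (-Complex.I • (H a * U a)))
      (-Complex.I • (H s * U s) - (1 : ℝ) • (-Complex.I • (H a * U a))) (Icc a c) s := by
    intro s hs
    refine ((hU s (hsub hs)).sub ?_).hasDerivWithinAt
    exact ((hasDerivAt_id s).sub_const a).smul_const _
  have hbound : ∀ s ∈ Ico a c,
      ‖-Complex.I • (H s * U s) - (1 : ℝ) • (-Complex.I • (H a * U a))‖ ≤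
        (∫ u in a..c, ‖derivWithin H (Icc 0 t) u‖) + h ^ 2 * (c - a) := by
    intro s hs
    have hs' := Ico_subset_Icc_self hs
    have e : -Complex.I • (H s * U s) - (1 : ℝ) • (-Complex.I • (H a * U a)) =
        -Complex.I • ((H s - H a) * U s + H a * (U s - U a)) := by
      rw [one_smul, ← smul_sub, Matrix.sub_mul, Matrix.mul_sub]
      congr 1
      abel
    rw [e, norm_smul, norm_neg, Complex.norm_I, one_mul]
    refine (norm_add_le _ _).trans (add_le_add ?_ ?_)
    · have h1 := hmul (hH.norm_sub_le ha hs.1 (hs.2.le.trans hc)) (hU1 s (hsub hs'))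
      rw [mul_one] at h1
      refine h1.trans ?_
      exact intervalIntegral.integral_mono_interval le_rfl hs.1 hs.2.le
        (Filter.Eventually.of_forall fun u => norm_nonneg _) (hH.intervalIntegrable_norm ha hac hc)
    · refine (hmul (hb a ha') (hlip s hs')).trans ?_
      have := hs.2.le
      nlinarith [mul_nonneg h0 h0]
  have h1 := norm_image_sub_le_of_norm_deriv_le_segment' hF hbound c ⟨hac, le_rfl⟩
  have e : U c - (c - a) • (-Complex.I • (H a * U a)) -
      (U a - (a - a) • (-Complex.I • (H a * U a))) =
      U c - (1 + (-Complex.I * (c - a : ℝ)) • H a) * U a := by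
    rw [Matrix.add_mul, Matrix.one_mul, Matrix.smul_mul, sub_self, zero_smul, sub_zero, sub_sub,
      add_comm (U a), mul_comm, mul_smul, Complex.coe_smul]
  rwa [e] at h1

/-- Local errors add up, amplified by at most (1 + b)^M ≤ 2. Each involves the derivative on its own
subinterval, so the sum contains the integral over [0, t], that is, the average. -/
theorem norm_eulerProduct_sub_propagator_le (hH : IsHamiltonian H t α) (ht : 0 ≤ t)
    (hb : ∀ s ∈ Icc 0 t, ‖H s‖ ≤ h) (hU0 : U 0 = 1)
    (hU : ∀ s ∈ Icc 0 t, HasDerivAt U (-Complex.I • (H s * U s)) s)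
    (hU1 : ∀ s ∈ Icc 0 t, ‖U s‖ ≤ 1) {M : ℕ} (hM : 0 < M) (hbM : t / M * h * M ≤ 1 / 2) :
    ‖eulerProduct (fun m => (-Complex.I * t / M) • H (m * t / M)) M - U t‖ ≤
      2 * (t ^ 2 / M * (avgDerivNorm H t + h ^ 2)) := by
  have hM' : (0 : ℝ) < M := by exact_mod_cast hM
  set G : ℕ → QOp (Fin ns) := fun m => (-Complex.I * t / M) • H (m * t / M) with hG
  set s : ℕ → ℝ := fun m => m * t / M with hs
  have hs0 : s 0 = 0 := by simp [hs]
  have hsM : s M = t := by simp only [hs]; field_simp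
  have hmono : ∀ m, s m ≤ s (m + 1) := by
    intro m
    simp only [hs]
    push_cast
    gcongr
    linarith
  have hstep : ∀ m, s (m + 1) - s m = t / M := by
    intro m
    simp only [hs]
    push_cast
    ring
  have hnn : ∀ m, 0 ≤ s m := fun m => by positivity
  have hle : ∀ m ≤ M, s m ≤ t := by
    intro m hm
    rw [hs]
    simp only
    rw [div_le_iff₀ hM', mul_comm]
    gcongr
  have h0 : 0 ≤ h := (norm_nonneg _).trans (hb 0 ⟨le_rfl, ht⟩)
  set b := t / M * h with hbdef
  have hb0 : 0 ≤ b := by positivity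
  have hGb : ∀ m < M, ‖1 + G m‖ ≤ 1 + b := by
    intro m hm
    refine (norm_add_le _ _).trans ?_
    rw [norm_one, hG]
    simp only
    rw [norm_smul, norm_div, norm_mul, norm_neg, Complex.norm_I, one_mul, Complex.norm_real,
      Complex.norm_natCast, Real.norm_of_nonneg ht]
    have := mul_le_mul_of_nonneg_left (hb (s m) ⟨hnn m, hle m hm.le⟩)
      (by positivity : 0 ≤ t / M)
    linarith
  set d : ℕ → ℝ := fun m => (∫ u in s m..s (m + 1), ‖derivWithin H (Icc 0 t) u‖) + h ^ 2 * (t / M)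
    with hd
  have hd0 : ∀ m, 0 ≤ d m := fun m => add_nonneg
    (intervalIntegral.integral_nonneg (hmono m) fun _ _ => norm_nonneg _) (by positivity)
  have hlocal : ∀ m < M, ‖(1 + G m) * U (s m) - U (s (m + 1))‖ ≤ d m * (t / M) := by
    intro m hm
    have := norm_propagator_step_le hH hb hU hU1 (hnn m) (hmono m) (hle (m + 1) hm)
    rw [hstep, norm_sub_rev] at this
    have e : -Complex.I * ((t / M : ℝ) : ℂ) = -Complex.I * t / M := by
      push_cast
      ring
    rwa [e] at this
  have hmain : ∀ m ≤ M, ‖eulerProduct G m - U (s m)‖ ≤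
      (1 + b) ^ m * ∑ m' ∈ Finset.range m, d m' * (t / M) := by
    intro m hm
    induction m with
    | zero => simp [eulerProduct, hs0, hU0]
    | succ m ih =>
      have e : eulerProduct G (m + 1) - U (s (m + 1)) =
          (1 + G m) * (eulerProduct G m - U (s m)) +
            ((1 + G m) * U (s m) - U (s (m + 1))) := by
        rw [eulerProduct, Matrix.mul_sub]
        abel
      rw [e, Finset.sum_range_succ, mul_add]
      refine (norm_add_le _ _).trans (add_le_add ?_ ((hlocal m hm).trans ?_))
      · refine (norm_mul_le _ _).trans ((mul_le_mul (hGb m hm) (ih (by omega)) (norm_nonneg _)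
          (by linarith)).trans (le_of_eq ?_))
        ring
      · exact le_mul_of_one_le_left (mul_nonneg (hd0 m) (by positivity))
          (one_le_pow₀ (by linarith))
  have hsum : ∑ m ∈ Finset.range M, d m * (t / M) = t ^ 2 / M * (avgDerivNorm H t + h ^ 2) := by
    rw [← Finset.sum_mul]
    simp only [hd, Finset.sum_add_distrib, Finset.sum_const, Finset.card_range, nsmul_eq_mul]
    rw [intervalIntegral.sum_integral_adjacent_intervals fun m hm =>
      hH.intervalIntegrable_norm (hnn m) (hmono m) (hle (m + 1) hm), hs0, hsM, avgDerivNorm]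
    -- The average divides by t, so t = 0 is separate; both sides are then 0.
    rcases ht.eq_or_lt with rfl | ht
    · simp
    · field_simp
  have h2 := one_add_pow_le_two (m := M) hb0 hbM le_rfl
  have h3 := hmain M le_rfl
  rw [hsM, hsum] at h3
  refine h3.trans (mul_le_mul_of_nonneg_right h2 ?_)
  rw [← hsum]
  exact Finset.sum_nonneg fun m _ => mul_nonneg (hd0 m) (by positivity)

end Discretization

/-! ## The error and the cost of the simulation -/

section Simulation

variable {M na ns : ℕ}

theorem IsHamiltonian.propagator {H : ℝ → QOp (Fin ns)} {t α : ℝ} (hH : IsHamiltonian H t α)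
    (ht : 0 ≤ t) :
    ∃ U : ℝ → QOp (Fin ns), U 0 = 1 ∧ U t = timeOrderedExp H t ∧
      (∀ s ∈ Set.Icc 0 t, HasDerivAt U (-Complex.I • (H s * U s)) s) ∧
      ∀ s ∈ Set.Icc 0 t, U s ∈ unitaryGroup (Bits (Fin ns)) ℂ := by
  obtain ⟨U, h0, h1, h2⟩ := exists_propagator ht hH.differentiable.continuousOn
    fun s hs => hH.norm_le_maxNorm hs
  exact ⟨U, h0, h1, h2, fun s hs => propagator_mem_unitary hH.hermitian h0 h2 hs⟩

theorem IsHamiltonian.timeOrderedExp_mem_unitary {H : ℝ → QOp (Fin ns)} {t α : ℝ}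
    (hH : IsHamiltonian H t α) (ht : 0 ≤ t) :
    timeOrderedExp H t ∈ unitaryGroup (Bits (Fin ns)) ℂ := by
  obtain ⟨U, -, h1, -, h3⟩ := hH.propagator ht
  exact h1 ▸ h3 t ⟨ht, le_rfl⟩

theorem avgDerivNorm_nonneg (H : ℝ → QOp (Fin ns)) {t : ℝ} (ht : 0 ≤ t) : 0 ≤ avgDerivNorm H t :=
  mul_nonneg (by positivity) (intervalIntegral.integral_nonneg ht fun _ _ => norm_nonneg _)

/-- The budget is 4·ε/32 for truncation and 2·ε/32 for discretization, together at most ε/4.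
Amplification triples this, and ε < 2 ensures its condition ε/4 ≤ 1. -/
theorem norm_amplifiedSeries_sub_le {H : ℝ → QOp (Fin ns)} {t α ε : ℝ} (hH : IsHamiltonian H t α)
    (ht : 0 ≤ t) (htα : t * α ≤ 1 / 2) (hε : 0 < ε) (hε2 : ε < 2) (hM : 0 < M)
    (hMε : 32 * (t ^ 2 / ε * (avgDerivNorm H t + maxNorm H t ^ 2)) ≤ M) {A : QOp (Fin ns)}
    (hA : A = truncatedSeries (fun m => (-Complex.I * t / M) • H (m * t / M)) M
      (truncationOrder ε M) (t * α)) :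
    ‖(1 / 2 : ℂ) • ((3 : ℂ) • A - A * (Aᴴ * A)) - timeOrderedExp H t‖ ≤ ε := by
  obtain ⟨U, hU0, hUt, hU, hUu⟩ := hH.propagator ht
  have hM' : (0 : ℝ) < M := by exact_mod_cast hM
  set h := maxNorm H t with hh
  have hb : ∀ s ∈ Set.Icc 0 t, ‖H s‖ ≤ h := fun s hs => hH.norm_le_maxNorm hs
  have h0 : 0 ≤ h := (norm_nonneg _).trans (hb 0 ⟨le_rfl, ht⟩)
  have hx : t / M * h * M = t * h := by field_simp
  have hth : t * h ≤ 1 / 2 := (mul_le_mul_of_nonneg_left (hH.maxNorm_le ht) ht).trans htα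
  have havg := avgDerivNorm_nonneg H ht
  have hMε' : t ^ 2 * (avgDerivNorm H t + h ^ 2) ≤ ε * M / 32 := by
    have e : t ^ 2 / ε * (avgDerivNorm H t + h ^ 2) = t ^ 2 * (avgDerivNorm H t + h ^ 2) / ε := by
      ring
    rw [e, ← mul_div_assoc, div_le_iff₀ hε] at hMε
    linarith
  have hGb : ∀ m < M, ‖(-Complex.I * t / M : ℂ) • H (m * t / M)‖ ≤ t / M * h := by
    intro m hm
    have hm' : (m : ℝ) ≤ M := by exact_mod_cast hm.le
    rw [norm_smul, norm_div, norm_mul, norm_neg, Complex.norm_I, one_mul, Complex.norm_real,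
      Complex.norm_natCast, Real.norm_of_nonneg ht]
    refine mul_le_mul_of_nonneg_left (hb _ ⟨by positivity, ?_⟩) (by positivity)
    rw [div_le_iff₀ hM', mul_comm]
    gcongr
  have h1 := norm_truncatedSeries_sub_le (p := t * α) (by positivity) hGb (by rwa [hx]) htα
    (truncationOrder ε M)
  rw [← hA, hx] at h1
  have h2 := truncation_error_le (M := M) hε (mul_nonneg ht h0) hth (by
    refine le_trans ?_ hMε'
    rw [mul_pow]
    gcongr
    linarith)
  have h3 := norm_eulerProduct_sub_propagator_le hH ht hb hU0 hU
    (fun s hs => (CStarRing.norm_of_mem_unitary (hUu s hs)).le) hM (by rwa [hx])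
  have h4 : t ^ 2 / M * (avgDerivNorm H t + h ^ 2) ≤ ε / 32 := by
    rw [div_mul_eq_mul_div, div_le_iff₀ hM']
    linarith
  have h5 : ‖A - U t‖ ≤ ε / 4 := by
    refine (norm_sub_le_norm_sub_add_norm_sub _
      (eulerProduct (fun m => (-Complex.I * t / M) • H (m * t / M)) M) _).trans ?_
    linarith
  rw [← hUt]
  exact (norm_amplified_sub_le (hUu t ⟨ht, le_rfl⟩) h5 (by linarith)).trans (by linarith)

/-- Since ‖Wψ‖ ≥ 1 - ε, the failure probability is at most 1 - (1 - ε)² ≤ 2ε if ε ≤ 1; for larger ε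
there is nothing to prove. -/
theorem Circuit.failureProb_le {q : ℕ} {O : OracleOp M na ns}
    (hO : O ∈ unitaryGroup (Fin M × Bits (Fin na) × Bits (Fin ns)) ℂ) (V : Circuit M na ns q)
    {U : QOp (Fin ns)} (hU : U ∈ unitaryGroup (Bits (Fin ns)) ℂ) {ε : ℝ}
    (h : ‖V.implemented O - U‖ ≤ ε) {ψ : Bits (Fin ns) → ℂ} (hψ : ∑ y, ‖ψ y‖ ^ 2 = 1) :
    V.failureProb O ψ ≤ 2 * ε := by
  rw [V.failureProb_eq hO, hψ]
  have hnorm : ∀ v : Bits (Fin ns) → ℂ, ‖(WithLp.toLp 2 v : EuclideanSpace ℂ (Bits (Fin ns)))‖ ^ 2 =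
      ∑ y, ‖v y‖ ^ 2 := fun v => EuclideanSpace.norm_sq_eq _
  have h1 : ‖(WithLp.toLp 2 ψ : EuclideanSpace ℂ (Bits (Fin ns)))‖ = 1 := by
    rw [← sq_eq_sq₀ (norm_nonneg _) one_pos.le, hnorm, hψ, one_pow]
  have h2 : ‖(WithLp.toLp 2 (U *ᵥ ψ) : EuclideanSpace ℂ (Bits (Fin ns)))‖ = 1 := by
    rw [← sq_eq_sq₀ (norm_nonneg _) one_pos.le, hnorm,
      sum_norm_sq_mulVec (mem_unitaryGroup_iff'.1 hU), hψ, one_pow]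
  have h3 : ‖(WithLp.toLp 2 ((V.implemented O - U) *ᵥ ψ) :
      EuclideanSpace ℂ (Bits (Fin ns)))‖ ≤ ε := by
    refine (l2_opNorm_mulVec (V.implemented O - U) (WithLp.toLp 2 ψ)).trans ?_
    rw [h1, mul_one]
    exact h
  have h4 : 1 ≤ ‖(WithLp.toLp 2 (V.implemented O *ᵥ ψ) : EuclideanSpace ℂ (Bits (Fin ns)))‖ + ε := by
    have e : (WithLp.toLp 2 (U *ᵥ ψ) : EuclideanSpace ℂ (Bits (Fin ns))) =
        WithLp.toLp 2 (V.implemented O *ᵥ ψ) - WithLp.toLp 2 ((V.implemented O - U) *ᵥ ψ) := by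
      rw [← WithLp.toLp_sub, sub_mulVec, sub_sub_cancel]
    rw [← h2, e]
    exact (norm_sub_le _ _).trans (by linarith)
  rw [← hnorm]
  have h5 := norm_nonneg (WithLp.toLp 2 (V.implemented O *ᵥ ψ) : EuclideanSpace ℂ (Bits (Fin ns)))
  have h6 : 0 ≤ ε := (norm_nonneg _).trans h
  rcases le_total ε 1 with h7 | h7
  · nlinarith
  · nlinarith

theorem clog_le_log (hM : 0 < M) : (Nat.clog 2 M : ℝ) ≤ 2 * Real.log M + 1 := by
  have hM' : (1 : ℝ) ≤ M := by exact_mod_cast hM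
  have h0 := Real.log_nonneg hM'
  rcases Nat.lt_or_ge 1 M with h | h
  · have h1 : ((2 ^ (Nat.clog 2 M).pred : ℕ) : ℝ) ≤ M := by
      exact_mod_cast (Nat.pow_pred_clog_lt_self one_lt_two h).le
    have h2 := Real.log_le_log (by positivity) h1
    push_cast at h2
    rw [Real.log_pow] at h2
    have h3 : (Nat.clog 2 M : ℝ) ≤ (Nat.clog 2 M).pred + 1 := by
      have : Nat.clog 2 M ≤ (Nat.clog 2 M).pred + 1 := by rw [Nat.pred_eq_sub_one]; omega
      exact_mod_cast this
    nlinarith [Real.log_two_gt_d9, Nat.cast_nonneg (α := ℝ) (Nat.clog 2 M).pred]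
  · obtain rfl : M = 1 := by omega
    simp

end Simulation

end DysonSim

end

/-- There are absolute constants `c₀` and `C` such that one circuit, chosen before the Hamiltonian
and the oracle, works for all Hamiltonians for which the number `M` of time steps is at least
`c₀ (t² / ε) (⟨‖dH/ds‖⟩ + max ‖H‖²)`, and for all oracles that encode them. -/
theorem mainTheorem1 :
    ∃ c₀ > (0 : ℝ), ∃ C > (0 : ℝ),
      ∀ (ns na M : ℕ) (α t ε : ℝ), 0 < M → 0 < α → 0 ≤ t → t ≤ 1 / (2 * α) → 0 < ε →
        ∃ (q : ℕ) (V : DysonSim.Circuit M na ns q),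
          (V.queryCount : ℝ) ≤ C * DysonSim.logOverLogLog ε ∧
          (q : ℝ) ≤ C * (na + Real.log M + 1) ∧
          (V.gateCount : ℝ) ≤ C * ((na + Real.log M + 1) * DysonSim.logOverLogLog ε) ∧
          ∀ (H : ℝ → DysonSim.QOp (Fin ns)) (O : DysonSim.OracleOp M na ns),
            DysonSim.IsHamiltonian H t α →
            c₀ * (t ^ 2 / ε * (DysonSim.avgDerivNorm H t + DysonSim.maxNorm H t ^ 2)) ≤ M →
            DysonSim.IsHamT O H t α →
            ‖V.implemented O - DysonSim.timeOrderedExp H t‖ ≤ ε ∧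
            ∀ ψ : DysonSim.Bits (Fin ns) → ℂ, ∑ y, ‖ψ y‖ ^ 2 = 1 →
              V.failureProb O ψ ≤ C * ε := by
  -- The 32 is fixed by the error budget. The 10000 is generous; the gate bound needs 300·9·2.
  refine ⟨32, by norm_num, 10000, by norm_num, fun ns na M α t ε hM hα ht htα hε => ?_⟩
  have hM' : (1 : ℝ) ≤ M := by exact_mod_cast hM
  have hlog := Real.log_nonneg hM'
  have hL := DysonSim.one_le_logOverLogLog hε
  have hna : (0 : ℝ) ≤ na := na.cast_nonneg
  have htα' : t * α ≤ 1 / 2 := by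
    rw [le_div_iff₀ (by positivity)] at htα
    linarith
  suffices hmain : ∃ (q : ℕ) (V : DysonSim.Circuit M na ns q),
      (V.queryCount : ℝ) ≤ 10000 * DysonSim.logOverLogLog ε ∧
      (q : ℝ) ≤ 10000 * (na + Real.log M + 1) ∧
      (V.gateCount : ℝ) ≤ 10000 * ((na + Real.log M + 1) * DysonSim.logOverLogLog ε) ∧
      ∀ (H : ℝ → DysonSim.QOp (Fin ns)) (O : DysonSim.OracleOp M na ns),
        DysonSim.IsHamiltonian H t α →
        32 * (t ^ 2 / ε * (DysonSim.avgDerivNorm H t + DysonSim.maxNorm H t ^ 2)) ≤ M →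
        DysonSim.IsHamT O H t α →
        ‖V.implemented O - DysonSim.timeOrderedExp H t‖ ≤ ε by
    obtain ⟨q, V, h1, h2, h3, h4⟩ := hmain
    refine ⟨q, V, h1, h2, h3, fun H O hH hMε hO => ⟨h4 H O hH hMε hO, fun ψ hψ => ?_⟩⟩
    refine (V.failureProb_le hO.unitary (hH.timeOrderedExp_mem_unitary ht)
      (h4 H O hH hMε hO) hψ).trans ?_
    linarith
  -- For ε ≥ 2 the empty circuit will do, since two unitaries are at distance at most 2.
  rcases lt_or_ge ε 2 with hε2 | hε2
  · obtain ⟨K, hK⟩ : ∃ K, DysonSim.truncationOrder ε M = K + 1 :=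
      Nat.exists_eq_succ_of_ne_zero (DysonSim.truncationOrder_pos hε M).ne'
    obtain ⟨q, V, h1, h2, h3, h4⟩ := DysonSim.exists_series_circuit hM ns na K hα ht htα'
    have hk1 := DysonSim.truncationOrder_le hε M
    have hk2 := DysonSim.truncationOrder_le_log hε hM
    have hc := DysonSim.clog_le_log hM
    rw [hK] at hk1 hk2
    push_cast at hk1 hk2
    refine ⟨q, V, ?_, ?_, ?_, fun H O hH hMε hO => ?_⟩
    · have h1' : (V.queryCount : ℝ) ≤ 3 * (K + 1) := by exact_mod_cast h1
      linarith
    · have h2' : (q : ℝ) ≤ 4 * K + 8 * Nat.clog 2 M + 2 * na + 12 := by exact_mod_cast h2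
      linarith
    · have h3' : (V.gateCount : ℝ) ≤ 300 * ((K + 1) * (Nat.clog 2 M + na + 1)) := by
        exact_mod_cast h3
      have h5 : ((K : ℝ) + 1) * (Nat.clog 2 M + na + 1) ≤
          (9 * DysonSim.logOverLogLog ε) * (2 * (na + Real.log M + 1)) :=
        mul_le_mul hk1 (by linarith) (by positivity) (by linarith)
      have h6 : 0 ≤ (na + Real.log M + 1) * DysonSim.logOverLogLog ε :=
        mul_nonneg (by linarith) (by linarith)
      linarith
    · rw [h4 H O hO]
      exact DysonSim.norm_amplifiedSeries_sub_le hH ht htα' hε hε2 hM hMε (by rw [hK])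
  · refine ⟨0, [], ?_, ?_, ?_, fun H O hH _ _ => ?_⟩
    · simp only [DysonSim.Circuit.queryCount, List.countP_nil, Nat.cast_zero]
      linarith
    · rw [Nat.cast_zero]
      linarith
    · simp only [DysonSim.Circuit.gateCount, List.countP_nil, Nat.cast_zero]
      exact mul_nonneg (by norm_num) (mul_nonneg (by linarith) (by linarith))
    · have hone : DysonSim.Circuit.implemented O ([] : DysonSim.Circuit M na ns 0) = 1 := by
        ext y y'
        have hiff : (Sum.elim y fun _ => false : DysonSim.Bits (Fin ns ⊕ Fin 0)) =
            Sum.elim y' (fun _ => false) ↔ y = y' :=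
          ⟨fun h => funext fun i => congrFun h (Sum.inl i), fun h => h ▸ rfl⟩
        simp only [DysonSim.Circuit.implemented, DysonSim.Circuit.eval, Matrix.one_apply, hiff]
      rw [hone]
      refine (norm_sub_le _ _).trans ?_
      rw [norm_one, CStarRing.norm_of_mem_unitary (hH.timeOrderedExp_mem_unitary ht)]
      linarith
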